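/- **Presheaf model of the global theory.** *Conventions.* Let $L$ be a join-semilattice (the levels) with least element $\bot$. Let $(V_i)_{i\in L}$ be a hierarchy of universes of sets: $V_i\subseteq V_j$ if $i\le j$; $V_\bot$ contains a one-element set and (a copy of) every set of the smallest ambient universe; $V_i$ is closed under subsets cut out by predicates and under products indexed by $\mathbb N$; for $X\in V_i$ and $Y:X\to V_j$ the sets $\sum_{x:X}Y_x$ and $\prod_{x:X}Y_x$ are in $V_{i\vee j}$; and if $i<j$ then $V_i$ is in bijection with an element of $V_j$. The letter $k$ ranges over $\{0,1\}$, so a declaration or equation with subscript $k$ stands for two. Equations between terms whose types are only provably equal are read modulo transport. *Core theory.* A model of the core theory is a category with families ($\mathsf{Con}_i$, $\mathsf{Sub}$, $\mathsf{Ty}_j\,\Gamma$, $\mathsf{Tm}\,\Gamma\,A$, substitution $A[\sigma],t[\sigma]$, terminal context $\diamond\in\mathsf{Con}_\bot$ with $\epsilon:\mathsf{Sub}\,\Gamma\,\diamond$, extension $\Gamma\triangleright A\in \mathsf{Con}_{i\vee j}$ with $\mathsf p,\mathsf q$ and $(\sigma,t)$; write $\sigma{\uparrow}=(\sigma\circ\mathsf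 p,\mathsf q)$) with the following structure, all stable under substitution: $\top$ with exactly one term and $\Sigma$-types with $\beta,\eta$; identity types $\mathsf{Eq}$ with reflexivity, equality reflection and uniqueness of identity proofs; strict democracy, i.e. types $\mathsf K\,\Theta\in\mathsf{Ty}\,\Gamma$ for contexts $\Theta$ with $(\mathsf K\,\Theta)[\sigma]=\mathsf K\,\Theta$, $\mathsf{Sub}\,\Gamma\,\Theta=\mathsf{Tm}\,\Gamma\,(\mathsf K\,\Theta)$ (composition of substitutions being substitution in terms), $\mathsf K\,\diamond=\top$, $\mathsf K(\Theta\triangleright A)=\Sigma\,(\mathsf K\,\Theta)\,(A[\mathsf q])$ and $(\sigma,_{\triangleright}t)=(\sigma,_{\Sigma}t)$; $\Pi$-types given by an isomorphism $\mathsf{lam}:\mathsf{Tm}\,(\Gamma\triangleright A)\,B\cong\mathsf{Tm}\,\Gamma\,(\Pi\,A\,B):\mathsf{app}$, with $t\mathbin{\$}u:=\mathsf{app}\,t[\mathsf{id},u]$; universes: for $j<j'$ a type $\mathsf U\in\mathsf{Ty}_{j'}\,\Gamma$ with an isomorphism $\mathsf c:\mathsf{Ty}_j\,\Gamma\cong\mathsf{Tm}\,\Gamma\,\mathsf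 U:\mathsf{El}$; $\mathsf{Bool}$ with dependent elimination and its two $\beta$-rules. *Global theory.* A model of the global theory is a model of the core theory with: 1. a map $\forall$ on contexts, substitutions, types and terms (preserving levels) that strictly preserves the CwF structure, $\top$, $\Sigma$, $\mathsf{Eq}$ and $\mathsf K$, where the latter means $\forall(\mathsf K\,\Theta)=\mathsf K(\forall\Theta)$ and that $\forall$ on $\mathsf{Sub}\,\Gamma\,\Theta$ is $\forall$ on $\mathsf{Tm}\,\Gamma\,(\mathsf K\,\Theta)$; 2. natural transformations $\mathsf k_\Gamma:\mathsf{Sub}\,(\forall\Gamma)\,\Gamma$ for $k=0,1$; for $A\in\mathsf{Ty}\,\Gamma$ put $\mathsf k_A:=\mathsf q[\mathsf k_{\Gamma\triangleright A}]:\mathsf{Tm}\,(\forall\Gamma\triangleright\forall A)\,(A[\mathsf k_\Gamma\circ\mathsf p])$; 3. a natural transformation $\mathsf R_\Gamma:\mathsf{Sub}\,\Gamma\,(\forall\Gamma)$; 4. a natural transformation $\mathsf S_\Gamma:\mathsf{Sub}\,(\forall\forall\Gamma)\,(\forall\forall\Gamma)$; 5. the equations $\mathsf k_\Gamma\circ\mathsf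 R_\Gamma=\mathsf{id}$, $\ \mathsf k_{\forall\Gamma}\circ\mathsf S_\Gamma=\forall\mathsf k_\Gamma$, $\ \mathsf S_\Gamma\circ\mathsf R_{\forall\Gamma}=\forall\mathsf R_\Gamma$, $\ \mathsf S_\Gamma\circ\mathsf S_\Gamma=\mathsf{id}$, $\ \mathsf S_{\forall\Gamma}\circ\forall\mathsf S_\Gamma\circ\mathsf S_{\forall\Gamma}=\forall\mathsf S_\Gamma\circ\mathsf S_{\forall\Gamma}\circ\forall\mathsf S_\Gamma$; 6. for $A\in\mathsf{Ty}\,\Gamma$, $B\in\mathsf{Ty}\,(\Gamma\triangleright A)$, $\sigma:\mathsf{Sub}\,\Delta\,(\forall\Gamma)$, $t_k:\mathsf{Tm}\,\Delta\,((\Pi\,A\,B)[\mathsf k_\Gamma\circ\sigma])$ and $t:\mathsf{Tm}\,\Delta\,((\Pi\,(\forall A)\,(\forall B))[\sigma])$ satisfying $t_k[\mathsf p]\mathbin{\$}(\mathsf k_A[\sigma{\uparrow}])=\mathsf k_B[\sigma{\uparrow},\mathsf{app}\,t]$, a term $\mathsf{mk}\forall\Pi\,\sigma\,t_k\,t:\mathsf{Tm}\,\Delta\,((\forall(\Pi\,A\,B))[\sigma])$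 such that $$(\mathsf{mk}\forall\Pi\,\sigma\,t_k\,t)[\rho]=\mathsf{mk}\forall\Pi\,(\sigma\circ\rho)\,(t_k[\rho])\,(t[\rho]),$$ $$\mathsf k_{\Pi AB}[\sigma,\mathsf{mk}\forall\Pi\,\sigma\,t_k\,t]=t_k,\qquad (\mathsf{lam}\,(\forall(\mathsf{app}\,\mathsf q)))[\sigma,\mathsf{mk}\forall\Pi\,\sigma\,t_k\,t]=t,$$ and, for every $t_2:\mathsf{Tm}\,\Delta\,((\forall(\Pi\,A\,B))[\sigma])$, $\ \mathsf{mk}\forall\Pi\,\sigma\,(\mathsf k_{\Pi AB}[\sigma,t_2])\,\big((\mathsf{lam}\,(\forall(\mathsf{app}\,\mathsf q)))[\sigma,t_2]\big)=t_2$; 7. for types $A_0,A_1,A$ over $\Gamma$ of the level classified by $\mathsf U$ and $t_k:\mathsf{Tm}\,(\Gamma\triangleright A)\,(A_k[\mathsf p])$, a term $\mathsf{unspan}\,A_k\,A\,t_k:\mathsf{Tm}\,\Gamma\,((\forall\mathsf U)[\epsilon])$ such that $$(\mathsf{unspan}\,A_k\,A\,t_k)[\sigma]=\mathsf{unspan}\,(A_k[\sigma])\,(A[\sigma])\,(t_k[\sigma{\uparrow}]),\qquad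 \mathsf{El}(\mathsf k_{\mathsf U})[\epsilon,\mathsf{unspan}\,A_k\,A\,t_k]=A_k,$$ $$(\forall(\mathsf{El}\,\mathsf q))[\epsilon,\mathsf{unspan}\,A_k\,A\,t_k]=A,\qquad \mathsf k_{\mathsf{El}\,\mathsf q}[(\epsilon,\mathsf{unspan}\,A_k\,A\,t_k){\uparrow}]=t_k;$$ 8. strict preservation of $\mathsf{Bool}$, its constructors and its eliminator by $\forall$. *Cube category.* $\square$ has the natural numbers as objects; its morphisms are generated by identities, composition, $\mathsf{suc}:\square(J,I)\to\square(1+J,1+I)$, $k_I\in\square(I,1+I)$, $\mathsf R_I\in\square(1+I,I)$ and $\mathsf S_I\in\square(2+I,2+I)$, subject to the category laws and $\mathsf{suc}(f\circ g)=\mathsf{suc}f\circ\mathsf{suc}g$, $\mathsf{suc}\,\mathsf{id}=\mathsf{id}$, $k_I\circ f=\mathsf{suc}f\circ k_J$, $\mathsf R_I\circ\mathsf{suc}f=f\circ\mathsf R_J$, $\mathsf S_I\circ\mathsf{suc}(\mathsf{suc}f)=\mathsf{suc}(\mathsf{suc}f)\circ\mathsf S_J$, $\mathsf R_I\circ k_I=\mathsf{id}$,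 $\mathsf S_I\circ k_{1+I}=\mathsf{suc}\,k_I$, $\mathsf R_{1+I}\circ\mathsf S_I=\mathsf{suc}\,\mathsf R_I$, $\mathsf S_I\circ\mathsf S_I=\mathsf{id}$, $\mathsf S_{1+I}\circ\mathsf{suc}\,\mathsf S_I\circ\mathsf S_{1+I}=\mathsf{suc}\,\mathsf S_I\circ\mathsf S_{1+I}\circ\mathsf{suc}\,\mathsf S_I$. *Presheaf model.* Contexts of level $i$ are presheaves on $\square$ with values in $V_i$, substitutions are natural transformations, types of level $j$ are dependent presheaves with values in $V_j$, and terms are dependent natural transformations. Extension, $\top$, $\Sigma$, $\mathsf{Eq}$ and $\mathsf{Bool}$ are pointwise, and $\mathsf K\,\Theta\,I\,\gamma=\Theta\,I$. With $\mathsf y$ the Yoneda embedding and $\mathsf{yl}\,\gamma\,f=\gamma[f]$, $\ \Pi\,A\,B\,I\,\gamma=\mathsf{Tm}\,(\mathsf yI\triangleright A[\mathsf{yl}\,\gamma])\,(B[\mathsf{yl}\,\gamma{\uparrow}])$ with restriction $t[f]=t[\mathsf yf{\uparrow}]$, $\mathsf{lam}\,t\,\gamma=t[\mathsf{yl}\,\gamma{\uparrow}]$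 and $\mathsf{app}\,t\,(\gamma,a)=t\,\gamma\,(\mathsf{id},a)$; and $\mathsf U\,I\,\gamma$ is (a set in $V_{j'}$ in bijection with) $\mathsf{Ty}_j(\mathsf yI)$ with restriction $a[f]=a[\mathsf yf]$, $\mathsf{El}\,a\,I\,\gamma=a\,\gamma\,I\,\mathsf{id}$ and $\mathsf c\,A\,\gamma=A[\mathsf{yl}\,\gamma]$. This is a model of the core theory. **Statement.** The presheaf model of the core theory extends to a model of the global theory in which $\forall$ is precomposition with $\mathsf{suc}$, $$\forall\Gamma\,I=\Gamma(1+I),\quad \gamma[f]_{\forall\Gamma}=\gamma[\mathsf{suc}f]_\Gamma,\quad \forall A\,I\,\gamma=A\,(1+I)\,\gamma,\quad a[f]_{\forall A}=a[\mathsf{suc}f]_A,\quad \forall\sigma\,\delta=\sigma\,\delta,\quad\forall t\,\gamma=t\,\gamma,$$ and $\mathsf k$, $\mathsf R$, $\mathsf S$ are restriction along the face, degeneracy and symmetry maps: $$\mathsf k_\Gamma\,\gamma=\gamma[k_I],\qquad \mathsf R_\Gamma\,\gamma=\gamma[\mathsf R_I],\qquad \mathsf S_\Gamma\,\gamma=\gamma[\mathsf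 S_I].$$ In this model $\mathsf{unspan}$ is only a section: for every universe $\mathsf U$ (that is, for all levels $j<j'$) there are $\Gamma$ and $a_2:\mathsf{Tm}\,\Gamma\,((\forall\mathsf U)[\epsilon])$ with $$\mathsf{unspan}\,\big(\mathsf{El}(\mathsf k_{\mathsf U})[\epsilon,a_2]\big)\,\big((\forall(\mathsf{El}\,\mathsf q))[\epsilon,a_2]\big)\,\big(\mathsf k_{\mathsf{El}\,\mathsf q}[(\epsilon,a_2){\uparrow}]\big)\neq a_2 .$$ -/

import Mathlib

set_option linter.checkUnivs false

/-! ### Categories with families, the core theory, and the global theory -/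

universe l a b

/-- A category with families whose contexts, types and terms are indexed by universe levels in a
join-semilattice `L` with least element. Equations between terms whose types are only
propositionally equal are stated with heterogeneous equality. -/
structure CwF (L : Type l) [SemilatticeSup L] [OrderBot L] : Type (max l (a + 1) (b + 1)) where
  Con : L → Type a
  Sub : {i i' : L} → Con i → Con i' → Type b
  id : {i : L} → {Γ : Con i} → Sub Γ Γ
  comp : {i i' i'' : L} → {Γ : Con i} → {Δ : Con i'} → {Θ : Con i''} →
    Sub Δ Γ → Sub Θ Δ → Sub Θ Γ
  id_comp : ∀ {i i' : L} {Γ : Con i} {Δ : Con i'} (σ : Sub Δ Γ), comp id σ = σ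
  comp_id : ∀ {i i' : L} {Γ : Con i} {Δ : Con i'} (σ : Sub Δ Γ), comp σ id = σ
  assoc : ∀ {i i' i'' i''' : L} {Γ : Con i} {Δ : Con i'} {Θ : Con i''} {Ξ : Con i'''}
    (σ : Sub Δ Γ) (τ : Sub Θ Δ) (ρ : Sub Ξ Θ), comp (comp σ τ) ρ = comp σ (comp τ ρ)
  /-- the empty context, a terminal object -/
  emp : Con ⊥
  eps : {i : L} → {Γ : Con i} → Sub Γ emp
  eps_uniq : ∀ {i : L} {Γ : Con i} (σ : Sub Γ emp), σ = eps
  Ty : {i : L} → (j : L) → Con i → Type a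
  Tm : {i j : L} → (Γ : Con i) → Ty j Γ → Type b
  /-- `A[σ]` -/
  tySub : {i i' j : L} → {Γ : Con i} → {Δ : Con i'} → Ty j Γ → Sub Δ Γ → Ty j Δ
  /-- `t[σ]` -/
  tmSub : {i i' j : L} → {Γ : Con i} → {Δ : Con i'} → {A : Ty j Γ} →
    Tm Γ A → (σ : Sub Δ Γ) → Tm Δ (tySub A σ)
  tySub_id : ∀ {i j : L} {Γ : Con i} (A : Ty j Γ), tySub A id = A
  tySub_comp : ∀ {i i' i'' j : L} {Γ : Con i} {Δ : Con i'} {Θ : Con i''} (A : Ty j Γ)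
    (σ : Sub Δ Γ) (τ : Sub Θ Δ), tySub A (comp σ τ) = tySub (tySub A σ) τ
  tmSub_id : ∀ {i j : L} {Γ : Con i} {A : Ty j Γ} (t : Tm Γ A), HEq (tmSub t id) t
  tmSub_comp : ∀ {i i' i'' j : L} {Γ : Con i} {Δ : Con i'} {Θ : Con i''} {A : Ty j Γ}
    (t : Tm Γ A) (σ : Sub Δ Γ) (τ : Sub Θ Δ), HEq (tmSub t (comp σ τ)) (tmSub (tmSub t σ) τ)
  /-- context extension `Γ ▷ A` -/
  ext : {i j : L} → (Γ : Con i) → Ty j Γ → Con (i ⊔ j)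
  /-- extension of a substitution by a term, `(σ, t)` -/
  pair : {i i' j : L} → {Γ : Con i} → {Δ : Con i'} → {A : Ty j Γ} →
    (σ : Sub Δ Γ) → Tm Δ (tySub A σ) → Sub Δ (ext Γ A)
  p : {i j : L} → {Γ : Con i} → {A : Ty j Γ} → Sub (ext Γ A) Γ
  q : {i j : L} → {Γ : Con i} → {A : Ty j Γ} → Tm (ext Γ A) (tySub A p)
  p_pair : ∀ {i i' j : L} {Γ : Con i} {Δ : Con i'} {A : Ty j Γ} (σ : Sub Δ Γ)
    (t : Tm Δ (tySub A σ)), comp p (pair σ t) = σ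
  q_pair : ∀ {i i' j : L} {Γ : Con i} {Δ : Con i'} {A : Ty j Γ} (σ : Sub Δ Γ)
    (t : Tm Δ (tySub A σ)), HEq (tmSub q (pair σ t)) t
  pair_eta : ∀ {i i' j : L} {Γ : Con i} {Δ : Con i'} {A : Ty j Γ} (σ : Sub Δ (ext Γ A)),
    pair (comp p σ) (cast (congrArg (Tm Δ) (tySub_comp A p σ).symm) (tmSub q σ)) = σ

namespace CwF

variable {L : Type l} [SemilatticeSup L] [OrderBot L] (M : CwF.{l, a, b} L)

/-- Transport of a term along an equality of types. -/
def coe {i j : L} {Γ : M.Con i} {A A' : M.Ty j Γ} (h : A = A') (t : M.Tm Γ A) : M.Tm Γ A' :=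
  cast (congrArg (M.Tm Γ) h) t

/-- Transport of a type along an equality of contexts. -/
def castTy {i j : L} {Γ Γ' : M.Con i} (h : Γ = Γ') (A : M.Ty j Γ) : M.Ty j Γ' :=
  cast (congrArg (M.Ty j) h) A

/-- Transport of a term along an equality of contexts. -/
def castTm {i j : L} {Γ Γ' : M.Con i} (h : Γ = Γ') {A : M.Ty j Γ} (t : M.Tm Γ A) :
    M.Tm Γ' (M.castTy h A) :=
  cast (by subst h; rfl) t

/-- Transport of a substitution along an equality of its codomains. -/
def castCod {i i' : L} {Δ : M.Con i'} {Γ Γ' : M.Con i} (h : Γ = Γ') (σ : M.Sub Δ Γ) :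
    M.Sub Δ Γ' :=
  cast (congrArg (fun X => M.Sub Δ X) h) σ

/-- Transport of a substitution along an equality of its domains. -/
def castDom {i i' : L} {Δ Δ' : M.Con i'} {Γ : M.Con i} (h : Δ = Δ') (σ : M.Sub Δ Γ) :
    M.Sub Δ' Γ :=
  cast (congrArg (fun X => M.Sub X Γ) h) σ

/-- `(id, u)` -/
def sing {i j : L} {Γ : M.Con i} {A : M.Ty j Γ} (u : M.Tm Γ A) : M.Sub Γ (M.ext Γ A) :=
  M.pair M.id (M.coe (M.tySub_id A).symm u)

/-- The lifting `σ↑ = (σ ∘ p, q)`. -/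
def up {i i' j : L} {Γ : M.Con i} {Δ : M.Con i'} (σ : M.Sub Δ Γ) (A : M.Ty j Γ) :
    M.Sub (M.ext Δ (M.tySub A σ)) (M.ext Γ A) :=
  M.pair (M.comp σ M.p) (M.coe (M.tySub_comp A σ M.p).symm M.q)

theorem p_up {i i' j : L} {Γ : M.Con i} {Δ : M.Con i'} (σ : M.Sub Δ Γ) (A : M.Ty j Γ) :
    M.comp M.p (M.up σ A) = M.comp σ M.p := M.p_pair _ _

theorem tySub_castTy {i i' j : L} {Γ Γ' : M.Con i} {Δ : M.Con i'} (h : Γ = Γ') (A : M.Ty j Γ)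
    (σ : M.Sub Δ Γ') :
    M.tySub (M.castTy h A) σ = M.tySub A (M.castCod h.symm σ) := by
  subst h; rfl

end CwF

/-- A CwF with `⊤`, `Σ`, extensional identity types, `Π`, Coquand universes and booleans. -/
structure TypeFormers (L : Type l) [SemilatticeSup L] [OrderBot L]
    extends CwF.{l, a, b} L where
  -- unit type
  top : {i : L} → {Γ : Con i} → Ty ⊥ Γ
  top_sub : ∀ {i i' : L} {Γ : Con i} {Δ : Con i'} (σ : Sub Δ Γ), tySub (top (Γ := Γ)) σ = top
  tt : {i : L} → {Γ : Con i} → Tm Γ top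
  tt_uniq : ∀ {i : L} {Γ : Con i} (t : Tm Γ top), t = tt
  -- `Σ` types with `β` and `η`
  sig : {i j j' : L} → {Γ : Con i} → (A : Ty j Γ) → Ty j' (ext Γ A) → Ty (j ⊔ j') Γ
  sig_sub : ∀ {i i' j j' : L} {Γ : Con i} {Δ : Con i'} (A : Ty j Γ) (B : Ty j' (ext Γ A))
    (σ : Sub Δ Γ), tySub (sig A B) σ = sig (tySub A σ) (tySub B (toCwF.up σ A))
  spair : {i j j' : L} → {Γ : Con i} → {A : Ty j Γ} → {B : Ty j' (ext Γ A)} →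
    (u : Tm Γ A) → Tm Γ (tySub B (toCwF.sing u)) → Tm Γ (sig A B)
  fst : {i j j' : L} → {Γ : Con i} → {A : Ty j Γ} → {B : Ty j' (ext Γ A)} →
    Tm Γ (sig A B) → Tm Γ A
  snd : {i j j' : L} → {Γ : Con i} → {A : Ty j Γ} → {B : Ty j' (ext Γ A)} →
    (t : Tm Γ (sig A B)) → Tm Γ (tySub B (toCwF.sing (fst t)))
  fst_spair : ∀ {i j j' : L} {Γ : Con i} {A : Ty j Γ} {B : Ty j' (ext Γ A)} (u : Tm Γ A)
    (v : Tm Γ (tySub B (toCwF.sing u))), fst (spair u v) = u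
  snd_spair : ∀ {i j j' : L} {Γ : Con i} {A : Ty j Γ} {B : Ty j' (ext Γ A)} (u : Tm Γ A)
    (v : Tm Γ (tySub B (toCwF.sing u))), HEq (snd (spair u v)) v
  spair_eta : ∀ {i j j' : L} {Γ : Con i} {A : Ty j Γ} {B : Ty j' (ext Γ A)}
    (t : Tm Γ (sig A B)), spair (fst t) (snd t) = t
  fst_sub : ∀ {i i' j j' : L} {Γ : Con i} {Δ : Con i'} {A : Ty j Γ} {B : Ty j' (ext Γ A)}
    (t : Tm Γ (sig A B)) (σ : Sub Δ Γ),
    tmSub (fst t) σ = fst (toCwF.coe (sig_sub A B σ) (tmSub t σ))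
  snd_sub : ∀ {i i' j j' : L} {Γ : Con i} {Δ : Con i'} {A : Ty j Γ} {B : Ty j' (ext Γ A)}
    (t : Tm Γ (sig A B)) (σ : Sub Δ Γ),
    HEq (tmSub (snd t) σ) (snd (toCwF.coe (sig_sub A B σ) (tmSub t σ)))
  -- identity types with equality reflection and uniqueness of identity proofs
  eq : {i j : L} → {Γ : Con i} → {A : Ty j Γ} → Tm Γ A → Tm Γ A → Ty j Γ
  eq_sub : ∀ {i i' j : L} {Γ : Con i} {Δ : Con i'} {A : Ty j Γ} (u v : Tm Γ A) (σ : Sub Δ Γ),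
    tySub (eq u v) σ = eq (tmSub u σ) (tmSub v σ)
  refl : {i j : L} → {Γ : Con i} → {A : Ty j Γ} → (u : Tm Γ A) → Tm Γ (eq u u)
  reflect : ∀ {i j : L} {Γ : Con i} {A : Ty j Γ} {u v : Tm Γ A}, Tm Γ (eq u v) → u = v
  uip : ∀ {i j : L} {Γ : Con i} {A : Ty j Γ} {u : Tm Γ A} (e : Tm Γ (eq u u)), e = refl u
  -- `Π` types
  pi : {i j j' : L} → {Γ : Con i} → (A : Ty j Γ) → Ty j' (ext Γ A) → Ty (j ⊔ j') Γ
  pi_sub : ∀ {i i' j j' : L} {Γ : Con i} {Δ : Con i'} (A : Ty j Γ) (B : Ty j' (ext Γ A))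
    (σ : Sub Δ Γ), tySub (pi A B) σ = pi (tySub A σ) (tySub B (toCwF.up σ A))
  lam : {i j j' : L} → {Γ : Con i} → {A : Ty j Γ} → {B : Ty j' (ext Γ A)} →
    Tm (ext Γ A) B → Tm Γ (pi A B)
  app : {i j j' : L} → {Γ : Con i} → {A : Ty j Γ} → {B : Ty j' (ext Γ A)} →
    Tm Γ (pi A B) → Tm (ext Γ A) B
  app_lam : ∀ {i j j' : L} {Γ : Con i} {A : Ty j Γ} {B : Ty j' (ext Γ A)} (t : Tm (ext Γ A) B),
    app (lam t) = t
  lam_app : ∀ {i j j' : L} {Γ : Con i} {A : Ty j Γ} {B : Ty j' (ext Γ A)} (t : Tm Γ (pi A B)),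
    lam (app t) = t
  lam_sub : ∀ {i i' j j' : L} {Γ : Con i} {Δ : Con i'} {A : Ty j Γ} {B : Ty j' (ext Γ A)}
    (t : Tm (ext Γ A) B) (σ : Sub Δ Γ),
    HEq (tmSub (lam t) σ) (lam (tmSub t (toCwF.up σ A)))
  -- universes: a type of codes of the types of level `j` at every higher level `k`
  univ : {i j k : L} → j < k → {Γ : Con i} → Ty k Γ
  univ_sub : ∀ {i i' j k : L} (h : j < k) {Γ : Con i} {Δ : Con i'} (σ : Sub Δ Γ),
    tySub (univ h (Γ := Γ)) σ = univ h
  code : {i j k : L} → (h : j < k) → {Γ : Con i} → Ty j Γ → Tm Γ (univ h)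
  el : {i j k : L} → (h : j < k) → {Γ : Con i} → Tm Γ (univ h) → Ty j Γ
  el_code : ∀ {i j k : L} (h : j < k) {Γ : Con i} (A : Ty j Γ), el h (code h A) = A
  code_el : ∀ {i j k : L} (h : j < k) {Γ : Con i} (t : Tm Γ (univ h)), code h (el h t) = t
  el_sub : ∀ {i i' j k : L} (h : j < k) {Γ : Con i} {Δ : Con i'} (t : Tm Γ (univ h))
    (σ : Sub Δ Γ), tySub (el h t) σ = el h (toCwF.coe (univ_sub h σ) (tmSub t σ))
  -- booleans with dependent elimination; naturality of `ite` is stated up to transport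
  bool : {i : L} → {Γ : Con i} → Ty ⊥ Γ
  bool_sub : ∀ {i i' : L} {Γ : Con i} {Δ : Con i'} (σ : Sub Δ Γ), tySub (bool (Γ := Γ)) σ = bool
  true : {i : L} → {Γ : Con i} → Tm Γ bool
  false : {i : L} → {Γ : Con i} → Tm Γ bool
  true_sub : ∀ {i i' : L} {Γ : Con i} {Δ : Con i'} (σ : Sub Δ Γ),
    HEq (tmSub (true (Γ := Γ)) σ) (true (Γ := Δ))
  false_sub : ∀ {i i' : L} {Γ : Con i} {Δ : Con i'} (σ : Sub Δ Γ),
    HEq (tmSub (false (Γ := Γ)) σ) (false (Γ := Δ))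
  ite : {i j : L} → {Γ : Con i} → (A : Ty j (ext Γ bool)) → (t : Tm Γ bool) →
    Tm Γ (tySub A (toCwF.sing true)) → Tm Γ (tySub A (toCwF.sing false)) →
    Tm Γ (tySub A (toCwF.sing t))
  ite_true : ∀ {i j : L} {Γ : Con i} (A : Ty j (ext Γ bool))
    (u : Tm Γ (tySub A (toCwF.sing true))) (v : Tm Γ (tySub A (toCwF.sing false))),
    ite A true u v = u
  ite_false : ∀ {i j : L} {Γ : Con i} (A : Ty j (ext Γ bool))
    (u : Tm Γ (tySub A (toCwF.sing true))) (v : Tm Γ (tySub A (toCwF.sing false))),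
    ite A false u v = v
  ite_sub : ∀ {i i' j : L} {Γ : Con i} {Δ : Con i'} (A : Ty j (ext Γ bool)) (t : Tm Γ bool)
    (u : Tm Γ (tySub A (toCwF.sing true))) (v : Tm Γ (tySub A (toCwF.sing false)))
    (σ : Sub Δ Γ) (A' : Ty j (ext Δ bool)) (t' : Tm Δ bool)
    (u' : Tm Δ (tySub A' (toCwF.sing true))) (v' : Tm Δ (tySub A' (toCwF.sing false))),
    HEq A' (tySub A (toCwF.up σ bool)) → HEq t' (tmSub t σ) →
    HEq u' (tmSub u σ) → HEq v' (tmSub v σ) →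
    HEq (tmSub (ite A t u v) σ) (ite A' t' u' v')

/-- A model of the core theory: in addition, strict democracy. The sort equation identifies
substitutions into `Θ` with terms of type `K Θ`, compatibly with composition. -/
structure CoreModel (L : Type l) [SemilatticeSup L] [OrderBot L]
    extends TypeFormers.{l, a, b} L where
  K : {i m : L} → Con m → {Γ : Con i} → Ty m Γ
  K_sub : ∀ {i i' m : L} (Θ : Con m) {Γ : Con i} {Δ : Con i'} (σ : Sub Δ Γ),
    tySub (K Θ (Γ := Γ)) σ = K Θ
  sub_eq_tm : ∀ {i m : L} (Γ : Con i) (Θ : Con m), Sub Γ Θ = Tm Γ (K Θ)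
  comp_eq_tmSub : ∀ {i i' m : L} {Γ : Con i} {Δ : Con i'} {Θ : Con m} (σ : Sub Γ Θ)
    (τ : Sub Δ Γ), HEq (comp σ τ) (tmSub (cast (sub_eq_tm Γ Θ) σ) τ)
  K_emp : ∀ {i : L} {Γ : Con i}, K emp (Γ := Γ) = top
  K_ext : ∀ {i m j : L} {Γ : Con i} (Θ : Con m) (A : Ty j Θ),
    K (ext Θ A) (Γ := Γ) =
      sig (K Θ) (tySub A (cast (sub_eq_tm (ext Γ (K Θ)) Θ).symm
        (toCwF.coe (K_sub Θ p) (q (Γ := Γ) (A := K Θ)))))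
  pair_eq_spair : ∀ {i m j : L} {Γ : Con i} {Θ : Con m} (A : Ty j Θ) (σ : Sub Γ Θ)
    (t : Tm Γ (tySub A σ))
    (t' : Tm Γ (tySub (tySub A (cast (sub_eq_tm (ext Γ (K Θ)) Θ).symm
        (toCwF.coe (K_sub Θ p) (q (Γ := Γ) (A := K Θ)))))
        (toCwF.sing (cast (sub_eq_tm Γ Θ) σ)))),
    HEq t' t → HEq (pair σ t) (spair (cast (sub_eq_tm Γ Θ) σ) t')

namespace CoreModel

variable {L : Type l} [SemilatticeSup L] [OrderBot L] (M : CoreModel.{l, a, b} L)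

/-- Application `t $ u = (app t)[id, u]`. -/
def dollar {i j j' : L} {Γ : M.Con i} {A : M.Ty j Γ} {B : M.Ty j' (M.ext Γ A)}
    (t : M.Tm Γ (M.pi A B)) (u : M.Tm Γ A) : M.Tm Γ (M.tySub B (M.sing u)) :=
  M.tmSub (M.app t) (M.sing u)


end CoreModel

/-- The raw operations `∀`, `k` (for the two values of `k`), `R` and `S` on a model. -/
structure ForallOps {L : Type l} [SemilatticeSup L] [OrderBot L] (M : CoreModel.{l, a, b} L) where
  allCon : {i : L} → M.Con i → M.Con i
  allSub : {i i' : L} → {Γ : M.Con i} → {Δ : M.Con i'} → M.Sub Δ Γ → M.Sub (allCon Δ) (allCon Γ)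
  allTy : {i j : L} → {Γ : M.Con i} → M.Ty j Γ → M.Ty j (allCon Γ)
  allTm : {i j : L} → {Γ : M.Con i} → {A : M.Ty j Γ} → M.Tm Γ A → M.Tm (allCon Γ) (allTy A)
  k : Bool → {i : L} → (Γ : M.Con i) → M.Sub (allCon Γ) Γ
  R : {i : L} → (Γ : M.Con i) → M.Sub Γ (allCon Γ)
  S : {i : L} → (Γ : M.Con i) → M.Sub (allCon (allCon Γ)) (allCon (allCon Γ))

/-- `∀` is a strict endomorphism of the flCwF strictly preserving `K` and booleans, the operations
`k`, `R`, `S` are natural transformations, and the five cube equations hold. -/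
structure ForallStructure {L : Type l} [SemilatticeSup L] [OrderBot L]
    (M : CoreModel.{l, a, b} L) extends ForallOps M where
  -- the category and the families
  all_id : ∀ {i : L} (Γ : M.Con i), allSub (M.id (Γ := Γ)) = M.id
  all_comp : ∀ {i i' i'' : L} {Γ : M.Con i} {Δ : M.Con i'} {Θ : M.Con i''} (σ : M.Sub Δ Γ)
    (τ : M.Sub Θ Δ), allSub (M.comp σ τ) = M.comp (allSub σ) (allSub τ)
  all_emp : allCon M.emp = M.emp
  all_eps : ∀ {i : L} (Γ : M.Con i), HEq (allSub (M.eps (Γ := Γ))) (M.eps (Γ := allCon Γ))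
  allTy_sub : ∀ {i i' j : L} {Γ : M.Con i} {Δ : M.Con i'} (A : M.Ty j Γ) (σ : M.Sub Δ Γ),
    allTy (M.tySub A σ) = M.tySub (allTy A) (allSub σ)
  allTm_sub : ∀ {i i' j : L} {Γ : M.Con i} {Δ : M.Con i'} {A : M.Ty j Γ} (t : M.Tm Γ A)
    (σ : M.Sub Δ Γ), HEq (allTm (M.tmSub t σ)) (M.tmSub (allTm t) (allSub σ))
  all_ext : ∀ {i j : L} (Γ : M.Con i) (A : M.Ty j Γ),
    allCon (M.ext Γ A) = M.ext (allCon Γ) (allTy A)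
  all_pair : ∀ {i i' j : L} {Γ : M.Con i} {Δ : M.Con i'} {A : M.Ty j Γ} (σ : M.Sub Δ Γ)
    (t : M.Tm Δ (M.tySub A σ)),
    HEq (allSub (M.pair σ t)) (M.pair (allSub σ) (M.coe (allTy_sub A σ) (allTm t)))
  all_p : ∀ {i j : L} {Γ : M.Con i} (A : M.Ty j Γ),
    HEq (allSub (M.p (A := A))) (M.p (A := allTy A))
  all_q : ∀ {i j : L} {Γ : M.Con i} (A : M.Ty j Γ),
    HEq (allTm (M.q (A := A))) (M.q (A := allTy A))
  -- `⊤`, `Σ` and identity types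
  all_top : ∀ {i : L} (Γ : M.Con i), allTy (M.top (Γ := Γ)) = M.top
  all_tt : ∀ {i : L} (Γ : M.Con i), HEq (allTm (M.tt (Γ := Γ))) (M.tt (Γ := allCon Γ))
  all_sig : ∀ {i j j' : L} {Γ : M.Con i} (A : M.Ty j Γ) (B : M.Ty j' (M.ext Γ A)),
    allTy (M.sig A B) = M.sig (allTy A) (M.castTy (all_ext Γ A) (allTy B))
  all_spair : ∀ {i j j' : L} {Γ : M.Con i} {A : M.Ty j Γ} {B : M.Ty j' (M.ext Γ A)}
    (u : M.Tm Γ A) (v : M.Tm Γ (M.tySub B (M.sing u)))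
    (v' : M.Tm (allCon Γ) (M.tySub (M.castTy (all_ext Γ A) (allTy B)) (M.sing (allTm u)))),
    HEq v' (allTm v) → HEq (allTm (M.spair u v)) (M.spair (allTm u) v')
  all_fst : ∀ {i j j' : L} {Γ : M.Con i} {A : M.Ty j Γ} {B : M.Ty j' (M.ext Γ A)}
    (t : M.Tm Γ (M.sig A B)), allTm (M.fst t) = M.fst (M.coe (all_sig A B) (allTm t))
  all_snd : ∀ {i j j' : L} {Γ : M.Con i} {A : M.Ty j Γ} {B : M.Ty j' (M.ext Γ A)}
    (t : M.Tm Γ (M.sig A B)),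
    HEq (allTm (M.snd t)) (M.snd (M.coe (all_sig A B) (allTm t)))
  all_eq : ∀ {i j : L} {Γ : M.Con i} {A : M.Ty j Γ} (u v : M.Tm Γ A),
    allTy (M.eq u v) = M.eq (allTm u) (allTm v)
  all_refl : ∀ {i j : L} {Γ : M.Con i} {A : M.Ty j Γ} (u : M.Tm Γ A),
    HEq (allTm (M.refl u)) (M.refl (allTm u))
  -- strict democracy
  all_K : ∀ {i m : L} (Θ : M.Con m) (Γ : M.Con i), allTy (M.K Θ (Γ := Γ)) = M.K (allCon Θ)
  allSub_eq_allTm : ∀ {i m : L} {Γ : M.Con i} {Θ : M.Con m} (σ : M.Sub Γ Θ),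
    HEq (allSub σ) (allTm (cast (M.sub_eq_tm Γ Θ) σ))
  -- naturality of `k`, `R`, `S`
  k_nat : ∀ (b : Bool) {i i' : L} {Γ : M.Con i} {Δ : M.Con i'} (σ : M.Sub Δ Γ),
    M.comp (k b Γ) (allSub σ) = M.comp σ (k b Δ)
  R_nat : ∀ {i i' : L} {Γ : M.Con i} {Δ : M.Con i'} (σ : M.Sub Δ Γ),
    M.comp (R Γ) σ = M.comp (allSub σ) (R Δ)
  S_nat : ∀ {i i' : L} {Γ : M.Con i} {Δ : M.Con i'} (σ : M.Sub Δ Γ),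
    M.comp (S Γ) (allSub (allSub σ)) = M.comp (allSub (allSub σ)) (S Δ)
  -- the five equations
  k_R : ∀ (b : Bool) {i : L} (Γ : M.Con i), M.comp (k b Γ) (R Γ) = M.id
  k_S : ∀ (b : Bool) {i : L} (Γ : M.Con i), M.comp (k b (allCon Γ)) (S Γ) = allSub (k b Γ)
  S_R : ∀ {i : L} (Γ : M.Con i), M.comp (S Γ) (R (allCon Γ)) = allSub (R Γ)
  S_S : ∀ {i : L} (Γ : M.Con i), M.comp (S Γ) (S Γ) = M.id
  S_braid : ∀ {i : L} (Γ : M.Con i),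
    M.comp (M.comp (S (allCon Γ)) (allSub (S Γ))) (S (allCon Γ)) =
      M.comp (M.comp (allSub (S Γ)) (S (allCon Γ))) (allSub (S Γ))
  -- booleans; preservation of `ite` is stated up to transport
  all_bool : ∀ {i : L} (Γ : M.Con i), allTy (M.bool (Γ := Γ)) = M.bool
  all_true : ∀ {i : L} (Γ : M.Con i), HEq (allTm (M.true (Γ := Γ))) (M.true (Γ := allCon Γ))
  all_false : ∀ {i : L} (Γ : M.Con i), HEq (allTm (M.false (Γ := Γ))) (M.false (Γ := allCon Γ))
  all_ite : ∀ {i j : L} {Γ : M.Con i} (A : M.Ty j (M.ext Γ M.bool)) (t : M.Tm Γ M.bool)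
    (u : M.Tm Γ (M.tySub A (M.sing M.true))) (v : M.Tm Γ (M.tySub A (M.sing M.false)))
    (A' : M.Ty j (M.ext (allCon Γ) M.bool)) (t' : M.Tm (allCon Γ) M.bool)
    (u' : M.Tm (allCon Γ) (M.tySub A' (M.sing M.true)))
    (v' : M.Tm (allCon Γ) (M.tySub A' (M.sing M.false))),
    HEq A' (allTy A) → HEq t' (allTm t) → HEq u' (allTm u) → HEq v' (allTm v) →
    HEq (allTm (M.ite A t u v)) (M.ite A' t' u' v')

namespace ForallStructure

variable {L : Type l} [SemilatticeSup L] [OrderBot L] {M : CoreModel.{l, a, b} L}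
  (F : ForallStructure M)

theorem kTy_aux (b : Bool) {i j : L} {Γ : M.Con i} (A : M.Ty j Γ) :
    M.Tm (F.allCon (M.ext Γ A)) (M.tySub (M.tySub A M.p) (F.k b (M.ext Γ A))) =
      M.Tm (M.ext (F.allCon Γ) (F.allTy A)) (M.tySub A (M.comp (F.k b Γ) M.p)) := by
  rw [← M.tySub_comp, ← F.k_nat]
  have key : ∀ (X : M.Con (i ⊔ j)) (_ : X = M.ext (F.allCon Γ) (F.allTy A))
      (s : M.Sub X (F.allCon Γ)), HEq s (M.p (A := F.allTy A)) →
      M.Tm X (M.tySub A (M.comp (F.k b Γ) s)) =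
        M.Tm (M.ext (F.allCon Γ) (F.allTy A)) (M.tySub A (M.comp (F.k b Γ) M.p)) := by
    intro X hX s hs
    subst hX
    rw [eq_of_heq hs]
  exact key _ (F.all_ext Γ A) _ (F.all_p A)

/-- The action of `k` on types, `k_A = q[k_{Γ ▷ A}]`. -/
def kTy (b : Bool) {i j : L} {Γ : M.Con i} (A : M.Ty j Γ) :
    M.Tm (M.ext (F.allCon Γ) (F.allTy A)) (M.tySub A (M.comp (F.k b Γ) M.p)) :=
  cast (F.kTy_aux b A) (M.tmSub M.q (F.k b (M.ext Γ A)))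

/-- `∀B` as a type over `∀Γ ▷ ∀A`, for a type `B` over `Γ ▷ A`. -/
def allTyExt {i j j' : L} {Γ : M.Con i} {A : M.Ty j Γ} (B : M.Ty j' (M.ext Γ A)) :
    M.Ty j' (M.ext (F.allCon Γ) (F.allTy A)) :=
  M.castTy (F.all_ext Γ A) (F.allTy B)

/-- `∀t` as a term over `∀Γ ▷ ∀A`, for a term `t` over `Γ ▷ A`. -/
def allTmExt {i j j' : L} {Γ : M.Con i} {A : M.Ty j Γ} {B : M.Ty j' (M.ext Γ A)}
    (t : M.Tm (M.ext Γ A) B) : M.Tm (M.ext (F.allCon Γ) (F.allTy A)) (F.allTyExt B) :=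
  M.castTm (F.all_ext Γ A) (F.allTm t)

/-- A substitution into `∀Γ ▷ ∀A` as a substitution into `∀(Γ ▷ A)`. -/
def toAllExt {i i' j : L} {Γ : M.Con i} {Δ : M.Con i'} {A : M.Ty j Γ}
    (σ : M.Sub Δ (M.ext (F.allCon Γ) (F.allTy A))) : M.Sub Δ (F.allCon (M.ext Γ A)) :=
  M.castCod (F.all_ext Γ A).symm σ

theorem kTy_sub_up {i i' j : L} {Γ : M.Con i} {Δ : M.Con i'} (b : Bool) (A : M.Ty j Γ)
    (σ : M.Sub Δ (F.allCon Γ)) :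
    M.tySub (M.tySub A (M.comp (F.k b Γ) M.p)) (M.up σ (F.allTy A)) =
      M.tySub (M.tySub A (M.comp (F.k b Γ) σ)) M.p := by
  rw [← M.tySub_comp, ← M.tySub_comp, M.assoc, M.assoc, M.p_up]

/-- The condition under which functions `t_k` at the bases and a function `t` at the apex are
compatible: `t_k[p] $ k_A[σ↑] = k_B[σ↑, app t]`. -/
def PiCompat {i i' j j' : L} {Γ : M.Con i} {Δ : M.Con i'} {A : M.Ty j Γ}
    {B : M.Ty j' (M.ext Γ A)} (σ : M.Sub Δ (F.allCon Γ))
    (tk : (b : Bool) → M.Tm Δ (M.tySub (M.pi A B) (M.comp (F.k b Γ) σ)))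
    (t : M.Tm Δ (M.tySub (M.pi (F.allTy A) (F.allTyExt B)) σ)) : Prop :=
  ∀ b : Bool,
    HEq
      (M.dollar
        (M.coe (by rw [M.pi_sub, M.pi_sub])
          (M.tmSub (tk b) (M.p (A := M.tySub (F.allTy A) σ))) :
          M.Tm (M.ext Δ (M.tySub (F.allTy A) σ))
            (M.pi (M.tySub (M.tySub A (M.comp (F.k b Γ) σ)) M.p)
              (M.tySub (M.tySub B (M.up (M.comp (F.k b Γ) σ) A))
                (M.up M.p (M.tySub A (M.comp (F.k b Γ) σ))))))
        (M.coe (F.kTy_sub_up b A σ) (M.tmSub (F.kTy b A) (M.up σ (F.allTy A)))))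
      (M.tmSub (F.kTy b B)
        (M.pair (F.toAllExt (M.up σ (F.allTy A)))
          (M.coe (M.tySub_castTy (F.all_ext Γ A) (F.allTy B) (M.up σ (F.allTy A)))
            (M.app (M.coe (M.pi_sub (F.allTy A) (F.allTyExt B) σ) t)))))

/-- The component `t_k` of an element of `∀(Π A B)`: `k_{Π A B}[σ, t₂]`. -/
def piBase {i i' j j' : L} {Γ : M.Con i} {Δ : M.Con i'} {A : M.Ty j Γ}
    {B : M.Ty j' (M.ext Γ A)} (σ : M.Sub Δ (F.allCon Γ))
    (t₂ : M.Tm Δ (M.tySub (F.allTy (M.pi A B)) σ)) (b : Bool) :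
    M.Tm Δ (M.tySub (M.pi A B) (M.comp (F.k b Γ) σ)) :=
  M.coe (by rw [← M.tySub_comp, M.assoc, M.p_pair])
    (M.tmSub (F.kTy b (M.pi A B)) (M.pair σ t₂))

/-- The component `t` of an element of `∀(Π A B)`: `lam (∀(app q))[σ, t₂]`. -/
def piApex {i i' j j' : L} {Γ : M.Con i} {Δ : M.Con i'} {A : M.Ty j Γ}
    {B : M.Ty j' (M.ext Γ A)} (σ : M.Sub Δ (F.allCon Γ))
    (t₂ : M.Tm Δ (M.tySub (F.allTy (M.pi A B)) σ)) :=
  M.tmSub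
    (M.lam (F.allTmExt (M.app (M.coe (M.pi_sub A B M.p) (M.q (Γ := Γ) (A := M.pi A B))))))
    (F.toAllExt (M.pair σ t₂))

/-- `k_U` as a term of type `U`. -/
def kUniv {j k : L} (h : j < k) (b : Bool) :
    M.Tm (M.ext (F.allCon M.emp) (F.allTy (M.univ h (Γ := M.emp)))) (M.univ h) :=
  M.coe (M.univ_sub h _) (F.kTy b (M.univ h (Γ := M.emp)))

/-- The generic small type `El q` over `◇ ▷ U`. -/
def elq {j k : L} (h : j < k) : M.Ty j (M.ext M.emp (M.univ h (Γ := M.emp))) :=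
  M.el h (M.coe (M.univ_sub h _) M.q)

/-- The substitution `ε` into `∀◇`. -/
def allEps {i : L} (Γ : M.Con i) : M.Sub Γ (F.allCon M.emp) :=
  M.castCod F.all_emp.symm M.eps

/-- Elements of `∀U`, that is, terms of type `∀U[ε]`. -/
abbrev AllUniv {j k : L} (h : j < k) {i : L} (Γ : M.Con i) :=
  M.Tm Γ (M.tySub (F.allTy (M.univ h (Γ := M.emp))) (F.allEps Γ))

/-- The base `El(k_U)[ε, a₂]` of the span of an element of `∀U`. -/
def spanBase {j k : L} (h : j < k) {i : L} {Γ : M.Con i} (a₂ : F.AllUniv h Γ) (b : Bool) :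
    M.Ty j Γ :=
  M.tySub (M.el h (F.kUniv h b)) (M.pair (F.allEps Γ) a₂)

/-- The apex `∀(El q)[ε, a₂]` of the span of an element of `∀U`. -/
def spanApex {j k : L} (h : j < k) {i : L} {Γ : M.Con i} (a₂ : F.AllUniv h Γ) : M.Ty j Γ :=
  M.tySub (F.allTy (elq h)) (F.toAllExt (M.pair (F.allEps Γ) a₂))

/-- The leg `k_{El q}[(ε, a₂)↑]` of the span of an element of `∀U`. -/
def spanLeg {j k : L} (h : j < k) {i : L} {Γ : M.Con i} (a₂ : F.AllUniv h Γ) (b : Bool) :=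
  M.tmSub (F.kTy b (elq (M := M) h))
    (M.up (F.toAllExt (M.pair (F.allEps Γ) a₂)) (F.allTy (elq h)))

end ForallStructure

/-- The additional structure that makes a model of the core theory a model of the global theory.
Equations whose two sides have only propositionally equal types are stated up to transport. -/
structure GlobalStructure {L : Type l} [SemilatticeSup L] [OrderBot L]
    (M : CoreModel.{l, a, b} L) extends ForallStructure M where
  mkAllPi : {i i' j j' : L} → {Γ : M.Con i} → {Δ : M.Con i'} → {A : M.Ty j Γ} →
    {B : M.Ty j' (M.ext Γ A)} → (σ : M.Sub Δ (allCon Γ)) →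
    (tk : (b : Bool) → M.Tm Δ (M.tySub (M.pi A B) (M.comp (k b Γ) σ))) →
    (t : M.Tm Δ (M.tySub (M.pi (allTy A) (toForallStructure.allTyExt B)) σ)) →
    toForallStructure.PiCompat σ tk t → M.Tm Δ (M.tySub (allTy (M.pi A B)) σ)
  mkAllPi_sub : ∀ {i i' i'' j j' : L} {Γ : M.Con i} {Δ : M.Con i'} {Θ : M.Con i''}
    {A : M.Ty j Γ} {B : M.Ty j' (M.ext Γ A)} (σ : M.Sub Δ (allCon Γ))
    (tk : (b : Bool) → M.Tm Δ (M.tySub (M.pi A B) (M.comp (k b Γ) σ)))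
    (t : M.Tm Δ (M.tySub (M.pi (allTy A) (toForallStructure.allTyExt B)) σ))
    (c : toForallStructure.PiCompat σ tk t) (ρ : M.Sub Θ Δ)
    (tk' : (b : Bool) → M.Tm Θ (M.tySub (M.pi A B) (M.comp (k b Γ) (M.comp σ ρ))))
    (t' : M.Tm Θ (M.tySub (M.pi (allTy A) (toForallStructure.allTyExt B)) (M.comp σ ρ))),
    (∀ b, HEq (tk' b) (M.tmSub (tk b) ρ)) → HEq t' (M.tmSub t ρ) →
    ∃ c' : toForallStructure.PiCompat (M.comp σ ρ) tk' t',
      HEq (M.tmSub (mkAllPi σ tk t c) ρ) (mkAllPi (M.comp σ ρ) tk' t' c')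
  piBase_mkAllPi : ∀ {i i' j j' : L} {Γ : M.Con i} {Δ : M.Con i'} {A : M.Ty j Γ}
    {B : M.Ty j' (M.ext Γ A)} (σ : M.Sub Δ (allCon Γ))
    (tk : (b : Bool) → M.Tm Δ (M.tySub (M.pi A B) (M.comp (k b Γ) σ)))
    (t : M.Tm Δ (M.tySub (M.pi (allTy A) (toForallStructure.allTyExt B)) σ))
    (c : toForallStructure.PiCompat σ tk t) (b : Bool),
    toForallStructure.piBase σ (mkAllPi σ tk t c) b = tk b
  piApex_mkAllPi : ∀ {i i' j j' : L} {Γ : M.Con i} {Δ : M.Con i'} {A : M.Ty j Γ}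
    {B : M.Ty j' (M.ext Γ A)} (σ : M.Sub Δ (allCon Γ))
    (tk : (b : Bool) → M.Tm Δ (M.tySub (M.pi A B) (M.comp (k b Γ) σ)))
    (t : M.Tm Δ (M.tySub (M.pi (allTy A) (toForallStructure.allTyExt B)) σ))
    (c : toForallStructure.PiCompat σ tk t),
    HEq (toForallStructure.piApex σ (mkAllPi σ tk t c)) t
  mkAllPi_eta : ∀ {i i' j j' : L} {Γ : M.Con i} {Δ : M.Con i'} {A : M.Ty j Γ}
    {B : M.Ty j' (M.ext Γ A)} (σ : M.Sub Δ (allCon Γ))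
    (t₂ : M.Tm Δ (M.tySub (allTy (M.pi A B)) σ)),
    ∃ (t : M.Tm Δ (M.tySub (M.pi (allTy A) (toForallStructure.allTyExt B)) σ))
      (c : toForallStructure.PiCompat σ (toForallStructure.piBase σ t₂) t),
      HEq t (toForallStructure.piApex σ t₂) ∧
        mkAllPi σ (toForallStructure.piBase σ t₂) t c = t₂
  unspan : {i j k' : L} → (h : j < k') → {Γ : M.Con i} → (Ak : Bool → M.Ty j Γ) →
    (A : M.Ty j Γ) → ((b : Bool) → M.Tm (M.ext Γ A) (M.tySub (Ak b) M.p)) →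
    toForallStructure.AllUniv h Γ
  unspan_sub : ∀ {i i' j k' : L} (h : j < k') {Γ : M.Con i} {Δ : M.Con i'}
    (Ak : Bool → M.Ty j Γ) (A : M.Ty j Γ)
    (tk : (b : Bool) → M.Tm (M.ext Γ A) (M.tySub (Ak b) M.p)) (σ : M.Sub Δ Γ),
    HEq (M.tmSub (unspan h Ak A tk) σ)
      (unspan h (fun b => M.tySub (Ak b) σ) (M.tySub A σ) (fun b =>
        M.coe (by rw [← M.tySub_comp, ← M.tySub_comp, M.p_up]) (M.tmSub (tk b) (M.up σ A))))
  spanBase_unspan : ∀ {i j k' : L} (h : j < k') {Γ : M.Con i} (Ak : Bool → M.Ty j Γ)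
    (A : M.Ty j Γ) (tk : (b : Bool) → M.Tm (M.ext Γ A) (M.tySub (Ak b) M.p)) (b : Bool),
    toForallStructure.spanBase h (unspan h Ak A tk) b = Ak b
  spanApex_unspan : ∀ {i j k' : L} (h : j < k') {Γ : M.Con i} (Ak : Bool → M.Ty j Γ)
    (A : M.Ty j Γ) (tk : (b : Bool) → M.Tm (M.ext Γ A) (M.tySub (Ak b) M.p)),
    toForallStructure.spanApex h (unspan h Ak A tk) = A
  spanLeg_unspan : ∀ {i j k' : L} (h : j < k') {Γ : M.Con i} (Ak : Bool → M.Ty j Γ)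
    (A : M.Ty j Γ) (tk : (b : Bool) → M.Tm (M.ext Γ A) (M.tySub (Ak b) M.p)) (b : Bool),
    HEq (toForallStructure.spanLeg h (unspan h Ak A tk) b) (tk b)

/-! ### The BCH cube category -/

namespace Cube

/-- Formal morphisms of the cube category; objects are natural numbers, and the values
`false`, `true` of a Boolean `k` stand for the two faces `0`, `1`. -/
inductive Raw : ℕ → ℕ → Type
  | id (I : ℕ) : Raw I I
  | comp {K J I : ℕ} (f : Raw J I) (g : Raw K J) : Raw K I
  | suc {J I : ℕ} (f : Raw J I) : Raw (J + 1) (I + 1)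
  | face (k : Bool) (I : ℕ) : Raw I (I + 1)
  | degen (I : ℕ) : Raw (I + 1) I
  | symm (I : ℕ) : Raw (I + 2) (I + 2)

/-- The generating equations of the cube category, closed under composition and `suc`. -/
inductive Rel : {J I : ℕ} → Raw J I → Raw J I → Prop
  | comp_left {K J I : ℕ} {f f' : Raw J I} (g : Raw K J) :
      Rel f f' → Rel (.comp f g) (.comp f' g)
  | comp_right {K J I : ℕ} (f : Raw J I) {g g' : Raw K J} :
      Rel g g' → Rel (.comp f g) (.comp f g')
  | suc_congr {J I : ℕ} {f f' : Raw J I} : Rel f f' → Rel (.suc f) (.suc f')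
  | id_comp {J I : ℕ} (f : Raw J I) : Rel (.comp (.id I) f) f
  | comp_id {J I : ℕ} (f : Raw J I) : Rel (.comp f (.id J)) f
  | assoc {M K J I : ℕ} (f : Raw J I) (g : Raw K J) (h : Raw M K) :
      Rel (.comp (.comp f g) h) (.comp f (.comp g h))
  | suc_comp {K J I : ℕ} (f : Raw J I) (g : Raw K J) :
      Rel (.suc (.comp f g)) (.comp (.suc f) (.suc g))
  | suc_id (I : ℕ) : Rel (.suc (.id I)) (.id (I + 1))
  | face_nat (k : Bool) {J I : ℕ} (f : Raw J I) :
      Rel (.comp (.face k I) f) (.comp (.suc f) (.face k J))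
  | degen_nat {J I : ℕ} (f : Raw J I) :
      Rel (.comp (.degen I) (.suc f)) (.comp f (.degen J))
  | symm_nat {J I : ℕ} (f : Raw J I) :
      Rel (.comp (.symm I) (.suc (.suc f))) (.comp (.suc (.suc f)) (.symm J))
  | degen_face (k : Bool) (I : ℕ) : Rel (.comp (.degen I) (.face k I)) (.id I)
  | symm_face (k : Bool) (I : ℕ) :
      Rel (.comp (.symm I) (.face k (I + 1))) (.suc (.face k I))
  | degen_symm (I : ℕ) : Rel (.comp (.degen (I + 1)) (.symm I)) (.suc (.degen I))
  | symm_symm (I : ℕ) : Rel (.comp (.symm I) (.symm I)) (.id (I + 2))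
  | braid (I : ℕ) :
      Rel (.comp (.comp (.symm (I + 1)) (.suc (.symm I))) (.symm (I + 1)))
        (.comp (.comp (.suc (.symm I)) (.symm (I + 1))) (.suc (.symm I)))

/-- The set `□(J, I)` of morphisms from `J` to `I`: formal morphisms modulo the equivalence
relation generated by `Rel`. -/
def Hom (J I : ℕ) : Type := Quot (Rel (J := J) (I := I))

def id (I : ℕ) : Hom I I := Quot.mk _ (.id I)

/-- `comp f g` is `f ∘ g`. -/
def comp {K J I : ℕ} : Hom J I → Hom K J → Hom K I :=
  Quot.map₂ Raw.comp (fun f _ _ h => .comp_right f h) (fun _ _ g h => .comp_left g h)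

def suc {J I : ℕ} : Hom J I → Hom (J + 1) (I + 1) :=
  Quot.map Raw.suc (fun _ _ h => .suc_congr h)

def face (k : Bool) (I : ℕ) : Hom I (I + 1) := Quot.mk _ (.face k I)
def degen (I : ℕ) : Hom (I + 1) I := Quot.mk _ (.degen I)
def symm (I : ℕ) : Hom (I + 2) (I + 2) := Quot.mk _ (.symm I)

theorem id_comp {J I : ℕ} (f : Hom J I) : comp (id I) f = f := by
  induction f using Quot.ind; exact Quot.sound (.id_comp _)

theorem comp_id {J I : ℕ} (f : Hom J I) : comp f (id J) = f := by
  induction f using Quot.ind; exact Quot.sound (.comp_id _)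

theorem assoc {M K J I : ℕ} (f : Hom J I) (g : Hom K J) (h : Hom M K) :
    comp (comp f g) h = comp f (comp g h) := by
  induction f using Quot.ind; induction g using Quot.ind; induction h using Quot.ind
  exact Quot.sound (.assoc _ _ _)

theorem suc_comp {K J I : ℕ} (f : Hom J I) (g : Hom K J) :
    suc (comp f g) = comp (suc f) (suc g) := by
  induction f using Quot.ind; induction g using Quot.ind
  exact Quot.sound (.suc_comp _ _)

theorem suc_id (I : ℕ) : suc (id I) = id (I + 1) := Quot.sound (.suc_id _)

theorem face_nat (k : Bool) {J I : ℕ} (f : Hom J I) :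
    comp (face k I) f = comp (suc f) (face k J) := by
  induction f using Quot.ind; exact Quot.sound (.face_nat _ _)

theorem degen_nat {J I : ℕ} (f : Hom J I) : comp (degen I) (suc f) = comp f (degen J) := by
  induction f using Quot.ind; exact Quot.sound (.degen_nat _)

theorem symm_nat {J I : ℕ} (f : Hom J I) :
    comp (symm I) (suc (suc f)) = comp (suc (suc f)) (symm J) := by
  induction f using Quot.ind; exact Quot.sound (.symm_nat _)

theorem degen_face (k : Bool) (I : ℕ) : comp (degen I) (face k I) = id I :=
  Quot.sound (.degen_face _ _)

theorem symm_face (k : Bool) (I : ℕ) : comp (symm I) (face k (I + 1)) = suc (face k I) :=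
  Quot.sound (.symm_face _ _)

theorem degen_symm (I : ℕ) : comp (degen (I + 1)) (symm I) = suc (degen I) :=
  Quot.sound (.degen_symm _)

theorem symm_symm (I : ℕ) : comp (symm I) (symm I) = id (I + 2) := Quot.sound (.symm_symm _)

theorem braid (I : ℕ) :
    comp (comp (symm (I + 1)) (suc (symm I))) (symm (I + 1)) =
      comp (comp (suc (symm I)) (symm (I + 1))) (suc (symm I)) := Quot.sound (.braid _)

end Cube

/-! ### Presheaves over the cube category -/

universe w

/-- A presheaf over the cube category; `act γ f` is the restriction `γ[f]`. -/
structure PSh : Type (w + 1) where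
  obj : ℕ → Type w
  act : {J I : ℕ} → obj I → Cube.Hom J I → obj J
  act_id : ∀ {I : ℕ} (γ : obj I), act γ (Cube.id I) = γ
  act_comp : ∀ {K J I : ℕ} (γ : obj I) (f : Cube.Hom J I) (g : Cube.Hom K J),
    act γ (Cube.comp f g) = act (act γ f) g

/-- A dependent presheaf over `Γ`. The restriction of `a ∈ A I γ` along `f` is an element of
`A J γ'` for any `γ'` equal to `γ[f]`; the equality is an argument, so that no transports are
needed. -/
structure DPsh (Γ : PSh.{w}) : Type (w + 1) where
  obj : (I : ℕ) → Γ.obj I → Type w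
  act : {J I : ℕ} → {γ : Γ.obj I} → {γ' : Γ.obj J} → (f : Cube.Hom J I) → Γ.act γ f = γ' →
    obj I γ → obj J γ'
  act_id : ∀ {I : ℕ} {γ : Γ.obj I} (h : Γ.act γ (Cube.id I) = γ) (x : obj I γ),
    act (Cube.id I) h x = x
  act_comp : ∀ {K J I : ℕ} {γ : Γ.obj I} {γ' : Γ.obj J} {γ'' : Γ.obj K} (f : Cube.Hom J I)
    (g : Cube.Hom K J) (hf : Γ.act γ f = γ') (hg : Γ.act γ' g = γ'')
    (hfg : Γ.act γ (Cube.comp f g) = γ'') (x : obj I γ),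
    act (Cube.comp f g) hfg x = act g hg (act f hf x)

/-- Terms: dependent natural transformations. -/
def DTm (Γ : PSh.{w}) (A : DPsh Γ) : Type w :=
  {t : (I : ℕ) → (γ : Γ.obj I) → A.obj I γ //
    ∀ (J I : ℕ) (f : Cube.Hom J I) (γ : Γ.obj I) (γ' : Γ.obj J) (h : Γ.act γ f = γ'),
      A.act f h (t I γ) = t J γ'}

namespace PSh

/-- The dependent presheaf over `Γ` that is constantly `Θ`. -/
def K (Θ : PSh.{w}) (Γ : PSh.{w}) : DPsh Γ where
  obj I _ := Θ.obj I
  act f _ x := Θ.act x f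
  act_id _ x := Θ.act_id x
  act_comp f g _ _ _ x := Θ.act_comp x f g

/-- Natural transformations from `Δ` to `Γ`, presented as terms of the constant dependent
presheaf. -/
abbrev Sub (Δ Γ : PSh.{w}) : Type w := DTm Δ (Γ.K Δ)

theorem Sub.nat {Δ Γ : PSh.{w}} (σ : Sub Δ Γ) {J I : ℕ} (f : Cube.Hom J I) (δ : Δ.obj I) :
    Γ.act (σ.1 I δ) f = σ.1 J (Δ.act δ f) := σ.2 J I f δ _ rfl

theorem Sub.nat' {Δ Γ : PSh.{w}} (σ : Sub Δ Γ) {J I : ℕ} {f : Cube.Hom J I} {δ : Δ.obj I}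
    {δ' : Δ.obj J} (h : Δ.act δ f = δ') : Γ.act (σ.1 I δ) f = σ.1 J δ' := σ.2 J I f δ _ h

def Sub.id (Γ : PSh.{w}) : Sub Γ Γ := ⟨fun _ γ => γ, fun _ _ _ _ _ h => h⟩

def Sub.comp {Γ Δ Θ : PSh.{w}} (σ : Sub Δ Γ) (τ : Sub Θ Δ) : Sub Θ Γ :=
  ⟨fun I θ => σ.1 I (τ.1 I θ), fun _ _ _ _ _ h => σ.nat' (τ.nat' h)⟩

end PSh

namespace DPsh

variable {Γ Δ : PSh.{w}}

/-- `A[σ]` -/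
def subst (A : DPsh Γ) (σ : PSh.Sub Δ Γ) : DPsh Δ where
  obj I δ := A.obj I (σ.1 I δ)
  act f h x := A.act f (σ.nat' h) x
  act_id _ x := A.act_id _ x
  act_comp f g _ _ _ x := A.act_comp f g _ _ _ x

/-- `t[σ]` -/
def _root_.DTm.subst {A : DPsh Γ} (t : DTm Γ A) (σ : PSh.Sub Δ Γ) : DTm Δ (A.subst σ) :=
  ⟨fun I δ => t.1 I (σ.1 I δ), fun J I f _ _ h => t.2 J I f _ _ (σ.nat' h)⟩

/-- The total presheaf `Γ ▷ A`. -/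
def total (A : DPsh Γ) : PSh.{w} where
  obj I := (γ : Γ.obj I) × A.obj I γ
  act x f := ⟨Γ.act x.1 f, A.act f rfl x.2⟩
  act_id := by
    rintro I ⟨γ, x⟩
    have key : ∀ (γ' : Γ.obj I) (h : Γ.act γ (Cube.id I) = γ'),
        (⟨γ', A.act (Cube.id I) h x⟩ : (γ : Γ.obj I) × A.obj I γ) = ⟨γ, x⟩ := by
      intro γ' h
      obtain rfl : γ' = γ := h.symm.trans (Γ.act_id γ)
      rw [A.act_id]
    exact key _ rfl
  act_comp := by
    rintro K J I ⟨γ, x⟩ f g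
    have key : ∀ (γ' : Γ.obj K) (h : Γ.act γ (Cube.comp f g) = γ')
        (h' : Γ.act (Γ.act γ f) g = γ'),
        (⟨γ', A.act (Cube.comp f g) h x⟩ : (γ : Γ.obj K) × A.obj K γ) =
          ⟨Γ.act (Γ.act γ f) g, A.act g rfl (A.act f rfl x)⟩ := by
      intro γ' h h'
      subst h'
      rw [A.act_comp f g rfl rfl h]
    exact key _ rfl (Γ.act_comp γ f g).symm

theorem total_act {A : DPsh Γ} {J I : ℕ} {f : Cube.Hom J I} {x : A.total.obj I}
    {y : A.total.obj J} (h : Γ.act x.1 f = y.1) (h' : A.act f h x.2 = y.2) :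
    A.total.act x f = y := by
  obtain ⟨γ, x⟩ := x
  obtain ⟨γ', y⟩ := y
  dsimp only at h h'
  subst h
  subst h'
  rfl

theorem total_fst {A : DPsh Γ} {J I : ℕ} {f : Cube.Hom J I} {x : A.total.obj I}
    {y : A.total.obj J} (h : A.total.act x f = y) : Γ.act x.1 f = y.1 := by
  subst h; rfl

theorem total_snd {A : DPsh Γ} {J I : ℕ} {f : Cube.Hom J I} {x : A.total.obj I}
    {y : A.total.obj J} (h : A.total.act x f = y) : A.act f (total_fst h) x.2 = y.2 := by
  subst h; rfl

def wk (A : DPsh Γ) : PSh.Sub A.total Γ := ⟨fun _ x => x.1, fun _ _ _ _ _ h => total_fst h⟩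

def var (A : DPsh Γ) : DTm A.total (A.subst A.wk) :=
  ⟨fun _ x => x.2, fun _ _ _ _ _ h => total_snd h⟩

def pair {A : DPsh Γ} (σ : PSh.Sub Δ Γ) (t : DTm Δ (A.subst σ)) : PSh.Sub Δ A.total :=
  ⟨fun I δ => ⟨σ.1 I δ, t.1 I δ⟩,
    fun J I f _ _ h => total_act (σ.nat' h) (t.2 J I f _ _ h)⟩

/-- `σ↑` -/
def up (σ : PSh.Sub Δ Γ) (A : DPsh Γ) : PSh.Sub (A.subst σ).total A.total :=
  pair (σ.comp (A.subst σ).wk) (A.subst σ).var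

def sing {A : DPsh Γ} (u : DTm Γ A) : PSh.Sub Γ A.total := pair (PSh.Sub.id Γ) u

/-- `Σ` types -/
def sig (A : DPsh Γ) (B : DPsh A.total) : DPsh Γ where
  obj I γ := (x : A.obj I γ) × B.obj I ⟨γ, x⟩
  act f h z := ⟨A.act f h z.1, B.act f (total_act h rfl) z.2⟩
  act_id := by
    rintro I γ h ⟨x, y⟩
    have key : ∀ (x' : A.obj I γ) (hx : A.act (Cube.id I) h x = x'),
        (⟨x', B.act (γ := ⟨γ, x⟩) (γ' := ⟨γ, x'⟩) (Cube.id I) (total_act h hx) y⟩ :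
          (x : A.obj I γ) × B.obj I ⟨γ, x⟩) = ⟨x, y⟩ := by
      intro x' hx
      obtain rfl : x' = x := hx.symm.trans (A.act_id h x)
      exact congrArg (Sigma.mk x') (B.act_id _ y)
    exact key _ rfl
  act_comp := by
    rintro K J I γ γ' γ'' f g hf hg hfg ⟨x, y⟩
    have key : ∀ (x' : A.obj K γ'') (hx : A.act (Cube.comp f g) hfg x = x')
        (_ : A.act g hg (A.act f hf x) = x'),
        (⟨x', B.act (γ := ⟨γ, x⟩) (γ' := ⟨γ'', x'⟩) (Cube.comp f g) (total_act hfg hx) y⟩ :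
          (x : A.obj K γ'') × B.obj K ⟨γ'', x⟩) =
          ⟨A.act g hg (A.act f hf x),
            B.act (γ := ⟨γ', A.act f hf x⟩) (γ' := ⟨γ'', A.act g hg (A.act f hf x)⟩) g
              (total_act hg rfl) (B.act (γ := ⟨γ, x⟩) f (total_act hf rfl) y)⟩ := by
      intro x' hx hx'
      subst hx'
      exact congrArg (Sigma.mk _) (B.act_comp f g _ _ _ y)
    exact key _ rfl (A.act_comp f g hf hg hfg x).symm

theorem sig_ext {A : DPsh Γ} {B : DPsh A.total} {I : ℕ} {γ : Γ.obj I}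
    {x y : (sig A B).obj I γ} (h : x.1 = y.1) (h' : HEq x.2 y.2) : x = y := by
  obtain ⟨x, a⟩ := x
  obtain ⟨y, b⟩ := y
  dsimp only at h h'
  subst h
  rw [eq_of_heq h']

theorem sig_snd {A : DPsh Γ} {B : DPsh A.total} {I : ℕ} {γ : Γ.obj I}
    {x y : (sig A B).obj I γ} (h : x = y) : HEq x.2 y.2 := by
  subst h; rfl

/-- Identity types: the fibre over `γ` has exactly one element if `u γ = v γ`, otherwise none. -/
def eq {A : DPsh Γ} (u v : DTm Γ A) : DPsh Γ where
  obj I γ := {_x : PUnit.{w + 1} // u.1 I γ = v.1 I γ}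
  act {J I γ γ'} f h x := ⟨PUnit.unit, by
    rw [← u.2 J I f γ γ' h, ← v.2 J I f γ γ' h, x.2]⟩
  act_id _ _ := rfl
  act_comp _ _ _ _ _ _ := rfl

/-- The constant dependent presheaf on a set. -/
def const (X : Type w) (Γ : PSh.{w}) : DPsh Γ where
  obj _ _ := X
  act _ _ x := x
  act_id _ _ := rfl
  act_comp _ _ _ _ _ _ := rfl

theorem act_id_heq (A : DPsh Γ) {I : ℕ} {γ γ' : Γ.obj I} (h : Γ.act γ (Cube.id I) = γ')
    (x : A.obj I γ) : HEq (A.act (Cube.id I) h x) x := by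
  obtain rfl : γ' = γ := h.symm.trans (Γ.act_id γ)
  rw [A.act_id]

theorem act_heq (A : DPsh Γ) {J I : ℕ} {γ₁ γ₂ : Γ.obj I} {γ₁' γ₂' : Γ.obj J}
    {f₁ f₂ : Cube.Hom J I} (h₁ : Γ.act γ₁ f₁ = γ₁') (h₂ : Γ.act γ₂ f₂ = γ₂') (hγ : γ₁ = γ₂)
    (hf : f₁ = f₂) {x₁ : A.obj I γ₁} {x₂ : A.obj I γ₂} (hx : HEq x₁ x₂) :
    HEq (A.act f₁ h₁ x₁) (A.act f₂ h₂ x₂) := by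
  subst hγ hf h₁ h₂
  rw [eq_of_heq hx]

theorem _root_.DTm.congr_heq {A : DPsh Γ} (t : DTm Γ A) {I : ℕ} {γ γ' : Γ.obj I} (h : γ = γ') :
    HEq (t.1 I γ) (t.1 I γ') := by
  subst h; rfl

theorem total_ext {A : DPsh Γ} {I : ℕ} {x y : A.total.obj I} (h : x.1 = y.1)
    (h' : HEq x.2 y.2) : x = y := by
  obtain ⟨x, a⟩ := x
  obtain ⟨y, b⟩ := y
  dsimp only at h h'
  subst h
  rw [eq_of_heq h']

theorem ext' {A B : DPsh Γ} (hobj : ∀ I γ, A.obj I γ = B.obj I γ)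
    (hact : ∀ (J I : ℕ) (f : Cube.Hom J I) (γ : Γ.obj I) (γ' : Γ.obj J) (h : Γ.act γ f = γ')
      (x : A.obj I γ) (y : B.obj I γ), HEq x y → HEq (A.act f h x) (B.act f h y)) : A = B := by
  obtain ⟨Ao, Aa, _, _⟩ := A
  obtain ⟨Bo, Ba, _, _⟩ := B
  obtain rfl : Ao = Bo := funext fun I => funext fun γ => hobj I γ
  obtain rfl : @Aa = @Ba := by
    funext J I γ γ' f h x
    exact eq_of_heq (hact J I f γ γ' h x x HEq.rfl)
  rfl

end DPsh

namespace PSh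

/-- The representable presheaf on `I`. -/
def y (I : ℕ) : PSh.{w} where
  obj J := ULift.{w} (Cube.Hom J I)
  act f g := ⟨Cube.comp f.down g⟩
  act_id f := by cases f; simp [Cube.comp_id]
  act_comp f g h := by simp [Cube.assoc]

/-- The action of the Yoneda embedding on morphisms. -/
def yMap {J I : ℕ} (f : Cube.Hom J I) : Sub (y.{w} J) (y.{w} I) :=
  ⟨fun _ g => ⟨Cube.comp f g.down⟩, by
    rintro L K g ⟨h⟩ _ rfl
    exact congrArg ULift.up (Cube.assoc f h g)⟩

/-- The Yoneda lemma: `yl γ f = γ[f]`. -/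
def yl {Γ : PSh.{w}} {I : ℕ} (γ : Γ.obj I) : Sub (y.{w} I) Γ :=
  ⟨fun _ f => Γ.act γ f.down, by
    rintro L K g ⟨h⟩ _ rfl
    exact (Γ.act_comp γ h g).symm⟩

theorem yl_yMap {Γ : PSh.{w}} {J I : ℕ} {f : Cube.Hom J I} {γ : Γ.obj I} {γ' : Γ.obj J}
    (h : Γ.act γ f = γ') : (yl γ).comp (yMap f) = yl γ' := by
  subst h
  apply Subtype.ext
  funext K g
  exact Γ.act_comp γ f g.down

theorem comp_yl {Γ Δ : PSh.{w}} (σ : Sub Δ Γ) {I : ℕ} (δ : Δ.obj I) :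
    σ.comp (yl δ) = yl (σ.1 I δ) := by
  apply Subtype.ext
  funext K g
  exact (σ.nat g.down δ).symm

theorem yMap_id (I : ℕ) : yMap.{w} (Cube.id I) = Sub.id _ := by
  apply Subtype.ext
  funext K g
  exact congrArg ULift.up (Cube.id_comp g.down)

theorem yMap_comp {K J I : ℕ} (f : Cube.Hom J I) (g : Cube.Hom K J) :
    yMap.{w} (Cube.comp f g) = (yMap f).comp (yMap g) := by
  apply Subtype.ext
  funext K h
  exact congrArg ULift.up (Cube.assoc f g h.down)

end PSh

namespace DPsh

variable {Γ Δ : PSh.{w}}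

/-- Terms of `B[s↑]` over `Θ ▷ A[s]`, for a substitution `s` from `Θ` to `Γ`. -/
abbrev PiSet (A : DPsh Γ) (B : DPsh A.total) {Θ : PSh.{w}} (s : PSh.Sub Θ Γ) : Type w :=
  DTm (A.subst s).total (B.subst (up s A))

/-- Restriction of such terms along `r`. -/
def PiSet.res {A : DPsh Γ} {B : DPsh A.total} {Θ Ξ : PSh.{w}} {s : PSh.Sub Θ Γ}
    (t : PiSet A B s) (r : PSh.Sub Ξ Θ) {s' : PSh.Sub Ξ Γ} (h : s.comp r = s') : PiSet A B s' :=
  cast (congrArg (PiSet A B) h) (DTm.subst t (up r (A.subst s)))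

/-- `Π` types: `Π A B I γ = Tm (y I ▷ A[yl γ]) (B[yl γ ↑])`. -/
def pi (A : DPsh Γ) (B : DPsh A.total) : DPsh Γ where
  obj _ γ := PiSet A B (PSh.yl γ)
  act f h t := PiSet.res t (PSh.yMap f) (PSh.yl_yMap h)
  act_id := by
    intro I γ h t
    have key : ∀ (r : PSh.Sub (PSh.y I) (PSh.y I)) (_ : r = PSh.Sub.id _)
        (h : (PSh.yl γ).comp r = PSh.yl γ), PiSet.res t r h = t := by
      rintro r rfl h
      rfl
    exact key _ (PSh.yMap_id I) _
  act_comp := by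
    intro K J I γ γ' γ'' f g hf hg hfg t
    have key : ∀ (s : PSh.Sub (PSh.y.{w} I) Γ) (s' : PSh.Sub (PSh.y.{w} J) Γ)
        (s'' : PSh.Sub (PSh.y.{w} K) Γ) (r : PSh.Sub (PSh.y K) (PSh.y I))
        (f : PSh.Sub (PSh.y J) (PSh.y I)) (g : PSh.Sub (PSh.y K) (PSh.y J))
        (_ : r = f.comp g) (hf : s.comp f = s') (hg : s'.comp g = s'') (hr : s.comp r = s'')
        (t : PiSet A B s), PiSet.res t r hr = PiSet.res (PiSet.res t f hf) g hg := by
      rintro s s' s'' r f g rfl rfl rfl hr t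
      rfl
    exact key _ _ _ _ _ _ (PSh.yMap_comp f g) _ _ _ t

theorem pi_subst (A : DPsh Γ) (B : DPsh A.total) (σ : PSh.Sub Δ Γ) :
    (pi A B).subst σ = pi (A.subst σ) (B.subst (up σ A)) := by
  have key : ∀ {Θ Ξ : PSh.{w}} (s₁ : PSh.Sub Θ Δ) (s₂ : PSh.Sub Θ Γ) (_ : σ.comp s₁ = s₂)
      (s₁' : PSh.Sub Ξ Δ) (s₂' : PSh.Sub Ξ Γ) (_ : σ.comp s₁' = s₂')
      (r : PSh.Sub Ξ Θ) (h₁ : s₁.comp r = s₁') (h₂ : s₂.comp r = s₂')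
      (t₁ : PiSet (A.subst σ) (B.subst (up σ A)) s₁) (t₂ : PiSet A B s₂), HEq t₂ t₁ →
      HEq (PiSet.res t₂ r h₂) (PiSet.res t₁ r h₁) := by
    rintro Θ Ξ s₁ _ rfl s₁' _ rfl r rfl h₂ t₁ t₂ h
    obtain rfl := eq_of_heq h
    rfl
  apply ext'
  · intro I δ
    change PiSet A B (PSh.yl (σ.1 I δ)) = PiSet A B (σ.comp (PSh.yl δ))
    rw [PSh.comp_yl]
  · intro J I f δ δ' h x y hxy
    exact key _ _ (PSh.comp_yl σ δ) _ _ (PSh.comp_yl σ δ') _ (PSh.yl_yMap h)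
      (PSh.yl_yMap (σ.nat' h)) _ _ hxy

def lam {A : DPsh Γ} {B : DPsh A.total} (t : DTm A.total B) : DTm Γ (pi A B) :=
  ⟨fun _ γ => t.subst (up (PSh.yl γ) A), by
    intro J I f γ γ' h
    have key : ∀ (s' : PSh.Sub (PSh.y.{w} J) Γ) (h : (PSh.yl γ).comp (PSh.yMap f) = s'),
        PiSet.res (B := B) (t.subst (up (PSh.yl γ) A)) (PSh.yMap f) h = t.subst (up s' A) := by
      rintro _ rfl
      rfl
    exact key _ (PSh.yl_yMap h)⟩

theorem pi_nat {A : DPsh Γ} {B : DPsh A.total} (t : DTm Γ (pi A B)) {K J I : ℕ}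
    (f : Cube.Hom J I) (γ : Γ.obj I) (γ' : Γ.obj J) (h : Γ.act γ f = γ') (g : Cube.Hom K J)
    (x' : A.obj K (Γ.act γ' g)) (x : A.obj K (Γ.act γ (Cube.comp f g))) (hx : HEq x' x) :
    HEq ((t.1 J γ').1 K ⟨⟨g⟩, x'⟩) ((t.1 I γ).1 K ⟨⟨Cube.comp f g⟩, x⟩) := by
  have key : ∀ (s' : PSh.Sub (PSh.y.{w} J) Γ) (h : (PSh.yl γ).comp (PSh.yMap f) = s')
      (T : PiSet A B s') (_ : PiSet.res (t.1 I γ) (PSh.yMap f) h = T)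
      (x' : A.obj K (s'.1 K ⟨g⟩)) (_ : HEq x' x),
      HEq (T.1 K ⟨⟨g⟩, x'⟩) ((t.1 I γ).1 K ⟨⟨Cube.comp f g⟩, x⟩) := by
    rintro _ rfl _ rfl x' hx
    obtain rfl := eq_of_heq hx
    rfl
  exact key _ (PSh.yl_yMap h) _ (t.2 J I f γ γ' h) x' hx

/-- `app t (γ, a) = t γ (id, a)`; both `a` and the result are transported along `γ[id] = γ`. -/
def app {A : DPsh Γ} {B : DPsh A.total} (t : DTm Γ (pi A B)) : DTm A.total B :=
  ⟨fun I x => B.act (Cube.id I) ((A.total.act_id _).trans (A.total.act_id x))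
      ((t.1 I x.1).1 I ⟨⟨Cube.id I⟩, A.act (Cube.id I) rfl x.2⟩), by
    intro J I f x x' h
    apply eq_of_heq
    obtain ⟨γ, a⟩ := x
    have h1 := (t.1 I γ).2 J I f ⟨⟨Cube.id I⟩, A.act (Cube.id I) rfl a⟩ _ rfl
    have h2 : HEq ((t.1 J x'.1).1 J ⟨⟨Cube.id J⟩, A.act (Cube.id J) rfl x'.2⟩)
        ((t.1 I γ).1 J ⟨⟨Cube.comp f (Cube.id J)⟩,
          A.act (Cube.comp f (Cube.id J)) rfl a⟩) := by
      apply pi_nat t f γ x'.1 (total_fst h) (Cube.id J)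
      obtain rfl := h
      exact (A.act_id_heq _ _).trans (A.act_heq rfl rfl rfl (Cube.comp_id f).symm HEq.rfl)
    refine HEq.trans ?_ (B.act_id_heq _ _).symm
    refine HEq.trans ?_ h2.symm
    refine (B.act_heq (γ₂ := ⟨Γ.act γ (Cube.id I), A.act (Cube.id I) rfl a⟩)
      h ((up (PSh.yl γ) A).nat' (δ := ⟨⟨Cube.id I⟩, A.act (Cube.id I) rfl a⟩) rfl)
      (A.total.act_id ⟨γ, a⟩).symm rfl (B.act_id_heq _ _)).trans ?_
    refine (heq_of_eq h1).trans ?_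
    apply DTm.congr_heq
    apply total_ext
    · exact congrArg ULift.up ((Cube.id_comp f).trans (Cube.comp_id f).symm)
    · exact (A.act_heq ((PSh.yl γ).nat' (δ := ⟨Cube.id I⟩) rfl) rfl (Γ.act_id γ)
        (Cube.comp_id f).symm (A.act_id_heq _ a))⟩

theorem app_lam {A : DPsh Γ} {B : DPsh A.total} (t : DTm A.total B) : app (lam t) = t := by
  apply Subtype.ext
  funext I x
  apply eq_of_heq
  refine (B.act_id_heq _ _).trans ?_
  exact DTm.congr_heq t (A.total.act_id x)

theorem lam_app {A : DPsh Γ} {B : DPsh A.total} (t : DTm Γ (pi A B)) : lam (app t) = t := by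
  apply Subtype.ext
  funext I γ
  apply Subtype.ext
  funext K z
  obtain ⟨⟨f⟩, a⟩ := z
  apply eq_of_heq
  refine (B.act_id_heq _ _).trans ?_
  refine (pi_nat t f γ _ rfl (Cube.id K) _ ((A.subst (PSh.yl γ)).act (γ := ⟨f⟩) (γ' := ⟨Cube.comp f (Cube.id K)⟩) (Cube.id K) rfl a)
    ?_).trans ?_
  · exact (A.act_id_heq _ _).trans ((A.subst (PSh.yl γ)).act_id_heq _ _).symm
  · apply DTm.congr_heq
    exact (A.subst (PSh.yl γ)).total.act_id ⟨⟨f⟩, a⟩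

theorem lam_subst {A : DPsh Γ} {B : DPsh A.total} (t : DTm A.total B) (σ : PSh.Sub Δ Γ) :
    HEq (DTm.subst (lam t) σ) (lam (t.subst (up σ A))) := by
  have key : ∀ (P : DPsh Δ) (_ : P = pi (A.subst σ) (B.subst (up σ A))) (u : DTm Δ P)
      (v : DTm Δ (pi (A.subst σ) (B.subst (up σ A)))) (_ : ∀ I δ, HEq (u.1 I δ) (v.1 I δ)),
      HEq u v := by
    rintro P rfl u v h
    exact heq_of_eq (Subtype.ext (funext fun I => funext fun δ => eq_of_heq (h I δ)))
  refine key _ (pi_subst A B σ) _ _ fun I δ => ?_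
  have key' : ∀ (s : PSh.Sub (PSh.y.{w} I) Γ) (_ : σ.comp (PSh.yl δ) = s),
      HEq (t.subst (up s A)) (DTm.subst (t.subst (up σ A)) (up (PSh.yl δ) (A.subst σ))) := by
    rintro _ rfl
    rfl
  exact key' _ (PSh.comp_yl σ δ)

end DPsh

/-! ### Precomposition with `suc`, and the face, degeneracy and symmetry maps -/

/-- Precomposition of a presheaf with `suc`. -/
def PSh.shift (Γ : PSh.{w}) : PSh.{w} where
  obj I := Γ.obj (I + 1)
  act γ f := Γ.act γ (Cube.suc f)
  act_id γ := by rw [Cube.suc_id, Γ.act_id]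
  act_comp γ f g := by rw [Cube.suc_comp, Γ.act_comp]

/-- Precomposition of a dependent presheaf with `suc`. -/
def DPsh.shift {Γ : PSh.{w}} (A : DPsh Γ) : DPsh Γ.shift where
  obj I γ := A.obj (I + 1) γ
  act f h x := A.act (Cube.suc f) h x
  act_id {I γ} h x := by
    apply eq_of_heq
    refine (A.act_heq h (Γ.act_id (I := I + 1) γ) rfl (Cube.suc_id I) HEq.rfl).trans ?_
    exact A.act_id_heq _ x
  act_comp {K J I γ γ' γ''} f g hf hg hfg x := by
    apply eq_of_heq
    refine (A.act_heq hfg ((Γ.act_comp (I := I + 1) γ _ _).trans (by subst hf; exact hg)) rfl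
      (Cube.suc_comp f g) HEq.rfl).trans ?_
    exact heq_of_eq (A.act_comp _ _ hf hg _ x)

/-- Precomposition of a term, in particular of a natural transformation, with `suc`. -/
def DTm.shift {Γ : PSh.{w}} {A : DPsh Γ} (t : DTm Γ A) : DTm Γ.shift A.shift :=
  ⟨fun I γ => t.1 (I + 1) γ, fun J I f _ _ h => t.2 (J + 1) (I + 1) (Cube.suc f) _ _ h⟩

namespace PSh

/-- Restriction along the face maps. -/
def faceSub (b : Bool) (Γ : PSh.{w}) : Sub Γ.shift Γ :=
  ⟨fun I γ => Γ.act (I := I + 1) γ (Cube.face b I), by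
    rintro J I f γ _ rfl
    exact (Γ.act_comp (I := I + 1) γ _ _).symm.trans
      ((congrArg (Γ.act (I := I + 1) γ) (Cube.face_nat b f)).trans
        (Γ.act_comp (I := I + 1) γ _ _))⟩

/-- Restriction along the degeneracy maps. -/
def degenSub (Γ : PSh.{w}) : Sub Γ Γ.shift :=
  ⟨fun I γ => Γ.act γ (Cube.degen I), by
    rintro J I f γ _ rfl
    exact (Γ.act_comp γ _ _).symm.trans
      ((congrArg (Γ.act γ) (Cube.degen_nat f)).trans (Γ.act_comp γ _ _))⟩

/-- Restriction along the symmetry maps. -/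
def symmSub (Γ : PSh.{w}) : Sub Γ.shift.shift Γ.shift.shift :=
  ⟨fun I γ => Γ.act (I := I + 2) γ (Cube.symm I), by
    rintro J I f γ _ rfl
    exact (Γ.act_comp (I := I + 2) γ _ _).symm.trans
      ((congrArg (Γ.act (I := I + 2) γ) (Cube.symm_nat f)).trans
        (Γ.act_comp (I := I + 2) γ _ _))⟩

end PSh

/-! ### Universe hierarchies and the presheaf model of the core theory -/

/-- A hierarchy of universes of sets indexed by levels: `mem i` is the universe of level `i`, a
collection of types in `Type w`. It is closed under the usual operations, and for `i < j` the
universe of level `i` is represented by a member of the universe of level `j`. -/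
structure UniverseHierarchy (L : Type l) [SemilatticeSup L] [OrderBot L] : Type (max l (w + 2)) where
  mem : L → Set (Type w)
  mono : ∀ {i j : L}, i ≤ j → mem i ⊆ mem j
  unit : PUnit.{w + 1} ∈ mem ⊥
  lift : ∀ T : Type, ULift.{w} T ∈ mem ⊥
  sigma : ∀ {i j : L} {X : Type w} {Y : X → Type w}, X ∈ mem i → (∀ x, Y x ∈ mem j) →
    ((x : X) × Y x) ∈ mem (i ⊔ j)
  pi : ∀ {i j : L} {X : Type w} {Y : X → Type w}, X ∈ mem i → (∀ x, Y x ∈ mem j) →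
    ((x : X) → Y x) ∈ mem (i ⊔ j)
  piNat : ∀ {i : L} {Y : ℕ → Type w}, (∀ n, Y n ∈ mem i) → ((n : ℕ) → Y n) ∈ mem i
  sub : ∀ {i : L} {X : Type w} (P : X → Prop), X ∈ mem i → {x : X // P x} ∈ mem i
  univ : ∀ {i j : L}, i < j → ∃ V ∈ mem j, Nonempty (V ≃ mem i)

namespace UniverseHierarchy

variable {L : Type l} [SemilatticeSup L] [OrderBot L] (H : UniverseHierarchy.{l, w} L)

/-- Presheaves of level `i`. -/
def Con (i : L) : Type (w + 1) := {Γ : PSh.{w} // ∀ I, Γ.obj I ∈ H.mem i}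

/-- Dependent presheaves of level `j`. -/
def Ty (j : L) (Γ : PSh.{w}) : Type (w + 1) := {A : DPsh Γ // ∀ I γ, A.obj I γ ∈ H.mem j}

variable {H}

theorem Ty.ext {j : L} {Γ : PSh.{w}} {A B : H.Ty j Γ} (h : A.1 = B.1) : A = B := Subtype.ext h

def Ty.subst {j : L} {Γ Δ : PSh.{w}} (A : H.Ty j Γ) (σ : PSh.Sub Δ Γ) : H.Ty j Δ :=
  ⟨A.1.subst σ, fun I δ => A.2 I (σ.1 I δ)⟩

variable (H)

theorem piSet_mem {j j' : L} {Γ : PSh.{w}} {A : DPsh Γ} {B : DPsh A.total}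
    (hA : ∀ I γ, A.obj I γ ∈ H.mem j) (hB : ∀ I γ, B.obj I γ ∈ H.mem j') {I : ℕ}
    (s : PSh.Sub (PSh.y.{w} I) Γ) : DPsh.PiSet A B s ∈ H.mem (j ⊔ j') := by
  refine H.sub _ (H.piNat fun K => H.pi ?_ fun x => hB K _)
  have := H.sigma (X := (PSh.y.{w} I).obj K) (Y := fun f => A.obj K (s.1 K f))
    (H.lift (Cube.Hom K I)) (fun f => hA K _)
  exact H.mono (by simp) this

/-- The types of level `j` over `y I` are represented by a set of every higher level. -/
theorem exists_rep {j k : L} (h : j < k) (I : ℕ) :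
    ∃ R ∈ H.mem k, Nonempty (H.Ty j (PSh.y.{w} I) ≃ R) := by
  obtain ⟨V, hV, ⟨e⟩⟩ := H.univ h
  let Acts : ((J : ℕ) → (PSh.y.{w} I).obj J → H.mem j) → Type w := fun o =>
    (J K : ℕ) → (f : ULift.{w} (Cube.Hom K J)) → (g : (PSh.y.{w} I).obj J) →
      (o J g).1 → (o K ((PSh.y.{w} I).act g f.down)).1
  let E : ((J : ℕ) → (PSh.y.{w} I).obj J → V) ≃ ((J : ℕ) → (PSh.y.{w} I).obj J → H.mem j) :=
    Equiv.piCongrRight fun J => Equiv.piCongrRight fun g => e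
  let T : Type w := (o : (J : ℕ) → (PSh.y.{w} I).obj J → V) × Acts (E o)
  let X : Type (w + 1) := (o : (J : ℕ) → (PSh.y.{w} I).obj J → H.mem j) × Acts o
  let F : T ≃ X := Equiv.sigmaCongrLeft E
  have hle : j ≤ k := h.le
  have hb : ∀ {Y : Type w}, Y ∈ H.mem ⊥ → Y ∈ H.mem k := fun hY => H.mono bot_le hY
  have pik : ∀ {X : Type w} {Y : X → Type w}, X ∈ H.mem k → (∀ x, Y x ∈ H.mem k) →
      ((x : X) → Y x) ∈ H.mem k := fun hX hY => H.mono (sup_idem k).le (H.pi hX hY)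
  have hT : T ∈ H.mem k := by
    refine H.mono (sup_idem k).le (H.sigma ?_ fun o => ?_)
    · exact H.piNat fun J => pik (hb (H.lift _)) fun _ => hV
    · refine H.piNat fun J => H.piNat fun K => pik (hb (H.lift _)) fun f =>
        pik (hb (H.lift _)) fun g => ?_
      exact pik (H.mono hle (Subtype.property _)) fun _ => H.mono hle (Subtype.property _)
  let G : H.Ty j (PSh.y.{w} I) → X := fun A =>
    ⟨fun J g => ⟨A.1.obj J g, A.2 J g⟩, fun J K f g x => A.1.act f.down rfl x⟩
  have hG : Function.Injective G := by
    rintro ⟨A, hA⟩ ⟨B, hB⟩ hAB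
    apply Ty.ext
    obtain ⟨Ao, Aa, _, _⟩ := A
    obtain ⟨Bo, Ba, _, _⟩ := B
    obtain ⟨h1, h2⟩ := Sigma.mk.inj_iff.1 hAB
    obtain rfl : Ao = Bo := by
      funext J g
      exact congrArg Subtype.val (congrFun (congrFun h1 J) g)
    have h3 := eq_of_heq h2
    obtain rfl : @Aa = @Ba := by
      funext J K g g' f hf x
      subst hf
      exact congrFun (congrFun (congrFun (congrFun (congrFun h3 K) J) ⟨f⟩) g) x
    rfl
  refine ⟨{t : T // t ∈ Set.range (F.symm ∘ G)}, H.sub _ hT, ⟨?_⟩⟩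
  exact Equiv.ofInjective _ (F.symm.injective.comp hG)

/-- The set of codes of types of level `j` over `y I`, a set of level `k`. -/
def Code {j k : L} (h : j < k) (I : ℕ) : Type w := (H.exists_rep h I).choose

theorem code_mem {j k : L} (h : j < k) (I : ℕ) : H.Code h I ∈ H.mem k :=
  (H.exists_rep h I).choose_spec.1

/-- The bijection between types of level `j` over `y I` and their codes. -/
noncomputable def codeEquiv {j k : L} (h : j < k) (I : ℕ) :
    H.Ty j (PSh.y.{w} I) ≃ H.Code h I :=
  (H.exists_rep h I).choose_spec.2.some

/-- The universe: `U I γ = Ty (y I)` with restriction `a[f] = a[y f]`. -/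
noncomputable def univD {j k : L} (h : j < k) (Γ : PSh.{w}) : DPsh Γ where
  obj I _ := H.Code h I
  act {J I _ _} f _ a := H.codeEquiv h J (((H.codeEquiv h I).symm a).subst (PSh.yMap f))
  act_id {I} γ _ a := by
    rw [PSh.yMap_id]
    exact (H.codeEquiv h I).apply_symm_apply a
  act_comp {K J I} _ _ _ f g _ _ _ a := by
    rw [PSh.yMap_comp, Equiv.symm_apply_apply]
    rfl

/-- `c A γ = A[yl γ]` -/
noncomputable def codeD {j k : L} (h : j < k) {Γ : PSh.{w}} (A : H.Ty j Γ) :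
    DTm Γ (H.univD h Γ) :=
  ⟨fun I γ => H.codeEquiv h I (A.subst (PSh.yl γ)), by
    intro J I f γ γ' hf
    change H.codeEquiv h J (((H.codeEquiv h I).symm (H.codeEquiv h I _)).subst _) = _
    rw [Equiv.symm_apply_apply]
    exact congrArg (fun s => H.codeEquiv h J (A.subst s)) (PSh.yl_yMap hf)⟩

variable {H} in
/-- The type over `y I` coded by `a γ`. -/
noncomputable def dec {j k : L} {h : j < k} {Γ : PSh.{w}} (a : DTm Γ (H.univD h Γ)) {I : ℕ}
    (γ : Γ.obj I) : H.Ty j (PSh.y.{w} I) :=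
  (H.codeEquiv h I).symm (a.1 I γ)

variable {H} in
theorem dec_nat {j k : L} {h : j < k} {Γ : PSh.{w}} (a : DTm Γ (H.univD h Γ)) {J I : ℕ}
    (f : Cube.Hom J I) {γ : Γ.obj I} {γ' : Γ.obj J} (hf : Γ.act γ f = γ') :
    (dec a γ').1 = (dec a γ).1.subst (PSh.yMap f) := by
  have := a.2 J I f γ γ' hf
  unfold dec
  rw [← this]
  change ((H.codeEquiv h J).symm (H.codeEquiv h J _)).1 = _
  rw [Equiv.symm_apply_apply]
  rfl

variable {H} in
/-- The restriction of `El a`: restriction in the type coded by `a γ`, followed by the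
identification of `a γ J f` with `a γ' J id`. -/
noncomputable def elAct {j k : L} {h : j < k} {Γ : PSh.{w}} (a : DTm Γ (H.univD h Γ)) {J I : ℕ}
    {γ : Γ.obj I} {γ' : Γ.obj J} (f : Cube.Hom J I) (hf : Γ.act γ f = γ')
    (x : (dec a γ).1.obj I ⟨Cube.id I⟩) : (dec a γ').1.obj J ⟨Cube.id J⟩ :=
  cast (congrArg (fun A : DPsh (PSh.y.{w} J) => A.obj J ⟨Cube.id J⟩) (dec_nat a f hf).symm)
    ((dec a γ).1.act (γ' := ⟨Cube.comp f (Cube.id J)⟩) f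
      (congrArg ULift.up ((Cube.id_comp f).trans (Cube.comp_id f).symm)) x)

variable {H} in
theorem elAct_heq {j k : L} {h : j < k} {Γ : PSh.{w}} (a : DTm Γ (H.univD h Γ)) {J I : ℕ}
    {γ : Γ.obj I} {γ' : Γ.obj J} (f : Cube.Hom J I) (hf : Γ.act γ f = γ')
    (x : (dec a γ).1.obj I ⟨Cube.id I⟩) :
    HEq (elAct a f hf x) ((dec a γ).1.act f rfl x) :=
  (cast_heq _ _).trans (DPsh.act_heq _ _ _ rfl rfl HEq.rfl)

/-- `El a I γ = a γ I id` -/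
noncomputable def elD {j k : L} (h : j < k) {Γ : PSh.{w}} (a : DTm Γ (H.univD h Γ)) :
    H.Ty j Γ :=
  ⟨{  obj I γ := (dec a γ).1.obj I ⟨Cube.id I⟩
      act f hf x := elAct a f hf x
      act_id hf x := eq_of_heq ((elAct_heq a _ hf x).trans (DPsh.act_id_heq _ _ _))
      act_comp {K J I γ γ' γ''} f g hf hg hfg x := by
        apply eq_of_heq
        refine (elAct_heq a _ hfg x).trans ?_
        refine HEq.trans ?_ (elAct_heq a g hg _).symm
        have key : ∀ (A' : DPsh (PSh.y.{w} J)) (_ : A' = (dec a γ).1.subst (PSh.yMap f))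
            (x' : A'.obj J ⟨Cube.id J⟩), HEq x' ((dec a γ).1.act f rfl x) →
            HEq (A'.act g rfl x') ((dec a γ).1.act g rfl ((dec a γ).1.act f rfl x)) := by
          rintro A' rfl x' hx'
          refine DPsh.act_heq (dec a γ).1 _ _ ?_ rfl hx'
          exact congrArg ULift.up ((Cube.comp_id f).trans (Cube.id_comp f).symm)
        refine HEq.trans ?_ (key _ (dec_nat a f hf) _ (elAct_heq a f hf x)).symm
        exact heq_of_eq_of_heq ((dec a γ).1.act_comp f g rfl
          ((PSh.y.{w} I).act_comp _ f g).symm rfl x)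
          (DPsh.act_heq _ _ _ rfl rfl HEq.rfl) },
    fun I γ => (dec a γ).2 I _⟩

theorem el_codeD {j k : L} (h : j < k) {Γ : PSh.{w}} (A : H.Ty j Γ) :
    H.elD h (H.codeD h A) = A := by
  have hd : ∀ {I : ℕ} (γ : Γ.obj I), (dec (H.codeD h A) γ).1 = A.1.subst (PSh.yl γ) := by
    intro I γ
    exact congrArg Subtype.val ((H.codeEquiv h I).symm_apply_apply _)
  apply Ty.ext
  apply DPsh.ext'
  · intro I γ
    change (dec (H.codeD h A) γ).1.obj I ⟨Cube.id I⟩ = _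
    rw [hd]
    exact congrArg (A.1.obj I) (Γ.act_id γ)
  · intro J I f γ γ' hf x y hxy
    refine (elAct_heq _ f hf x).trans ?_
    have key : ∀ (A' : DPsh (PSh.y.{w} I)) (_ : A' = A.1.subst (PSh.yl γ))
        (x' : A'.obj I ⟨Cube.id I⟩), HEq x' y →
        HEq (A'.act f rfl x') (A.1.act f hf y) := by
      rintro A' rfl x' hx'
      exact DPsh.act_heq A.1 _ _ (Γ.act_id γ) rfl hx'
    exact key _ (hd γ) x hxy

theorem code_elD {j k : L} (h : j < k) {Γ : PSh.{w}} (a : DTm Γ (H.univD h Γ)) :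
    H.codeD h (H.elD h a) = a := by
  apply Subtype.ext
  funext I γ
  change H.codeEquiv h I ((H.elD h a).subst (PSh.yl γ)) = a.1 I γ
  apply (Equiv.eq_symm_apply _).1
  apply Ty.ext
  apply DPsh.ext'
  · rintro K ⟨f⟩
    change (dec a (Γ.act γ f)).1.obj K ⟨Cube.id K⟩ = (dec a γ).1.obj K ⟨f⟩
    rw [dec_nat a f rfl]
    exact congrArg (fun g => (dec a γ).1.obj K ⟨g⟩) (Cube.comp_id f)
  · rintro J K g ⟨f⟩ ⟨f'⟩ hf x z hxz
    refine (elAct_heq a g ((PSh.yl γ).nat' hf) x).trans ?_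
    have key : ∀ (A' : DPsh (PSh.y.{w} K)) (_ : A' = (dec a γ).1.subst (PSh.yMap f))
        (x' : A'.obj K ⟨Cube.id K⟩), HEq x' z →
        HEq (A'.act g rfl x') ((dec a γ).1.act g hf z) := by
      rintro A' rfl x' hx'
      exact DPsh.act_heq (dec a γ).1 _ _ (congrArg ULift.up (Cube.comp_id f)) rfl hx'
    exact key _ (dec_nat a f rfl) x hxz

/-- Dependent elimination for booleans, computed pointwise. -/
def iteD {Γ : PSh.{w}} (A : DPsh (DPsh.const (ULift.{w} Bool) Γ).total)
    (t : DTm Γ (DPsh.const (ULift.{w} Bool) Γ))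
    (u : DTm Γ (A.subst (DPsh.sing ⟨fun _ _ => ⟨true⟩, fun _ _ _ _ _ _ => rfl⟩)))
    (v : DTm Γ (A.subst (DPsh.sing ⟨fun _ _ => ⟨false⟩, fun _ _ _ _ _ _ => rfl⟩))) :
    DTm Γ (A.subst (DPsh.sing t)) :=
  ⟨fun I γ => Bool.rec (motive := fun b => A.obj I ⟨γ, ⟨b⟩⟩) (v.1 I γ) (u.1 I γ) (t.1 I γ).down, by
    intro J I f γ γ' h
    have key : ∀ (x y : ULift.{w} Bool) (hxy : x = y)
        (h' : (DPsh.const (ULift.{w} Bool) Γ).total.act ⟨γ, x⟩ f = ⟨γ', y⟩),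
        A.act f h' (Bool.rec (motive := fun b => A.obj I ⟨γ, ⟨b⟩⟩) (v.1 I γ) (u.1 I γ) x.down) =
          Bool.rec (motive := fun b => A.obj J ⟨γ', ⟨b⟩⟩) (v.1 J γ') (u.1 J γ') y.down := by
      rintro ⟨x⟩ _ rfl h'
      cases x
      · exact v.2 J I f γ γ' h
      · exact u.2 J I f γ γ' h
    exact key _ _ (t.2 J I f γ γ' h) _⟩

/-- The presheaf model of the core theory. -/
noncomputable def pshModel : CoreModel.{l, w + 1, w} L where
  Con i := H.Con i
  Sub Δ Γ := PSh.Sub Δ.1 Γ.1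
  id := PSh.Sub.id _
  comp σ τ := σ.comp τ
  id_comp _ := rfl
  comp_id _ := rfl
  assoc _ _ _ := rfl
  emp := ⟨⟨fun _ => PUnit, fun x _ => x, fun _ => rfl, fun _ _ _ => rfl⟩, fun _ => H.unit⟩
  eps := ⟨fun _ _ => PUnit.unit, fun _ _ _ _ _ _ => rfl⟩
  eps_uniq _ := rfl
  Ty j Γ := H.Ty j Γ.1
  Tm Γ A := DTm Γ.1 A.1
  tySub A σ := A.subst σ
  tmSub t σ := t.subst σ
  tySub_id _ := rfl
  tySub_comp _ _ _ := rfl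
  tmSub_id _ := HEq.rfl
  tmSub_comp _ _ _ := HEq.rfl
  ext Γ A := ⟨A.1.total, fun I => H.sigma (Γ.2 I) (A.2 I)⟩
  pair σ t := DPsh.pair σ t
  p := DPsh.wk _
  q := DPsh.var _
  p_pair _ _ := rfl
  q_pair _ _ := HEq.rfl
  pair_eta _ := rfl
  top := ⟨DPsh.const PUnit _, fun _ _ => H.unit⟩
  top_sub _ := rfl
  tt := ⟨fun _ _ => PUnit.unit, fun _ _ _ _ _ _ => rfl⟩
  tt_uniq _ := rfl
  sig A B := ⟨DPsh.sig A.1 B.1, fun I γ => H.sigma (A.2 I γ) fun _ => B.2 I _⟩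
  sig_sub _ _ _ := rfl
  spair {_ _ _ _ _ B} u v := ⟨fun I γ => ⟨u.1 I γ, v.1 I γ⟩, fun J I f γ γ' h =>
    DPsh.sig_ext (u.2 J I f γ γ' h) ((DPsh.act_heq B.1 _ _ rfl rfl HEq.rfl).trans
      (heq_of_eq (v.2 J I f γ γ' h)))⟩
  fst t := ⟨fun I γ => (t.1 I γ).1, fun J I f γ γ' h => congrArg Sigma.fst (t.2 J I f γ γ' h)⟩
  snd {_ _ _ _ _ B} t := ⟨fun I γ => (t.1 I γ).2, fun J I f γ γ' h => eq_of_heq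
    ((DPsh.act_heq B.1 _ _ rfl rfl HEq.rfl).trans (DPsh.sig_snd (t.2 J I f γ γ' h)))⟩
  fst_spair _ _ := rfl
  snd_spair _ _ := HEq.rfl
  spair_eta _ := rfl
  fst_sub _ _ := rfl
  snd_sub _ _ := HEq.rfl
  eq u v := ⟨DPsh.eq u v, fun _ _ => H.sub _ (H.mono bot_le H.unit)⟩
  eq_sub _ _ _ := rfl
  refl u := ⟨fun _ _ => ⟨PUnit.unit, rfl⟩, fun _ _ _ _ _ _ => rfl⟩
  reflect e := Subtype.ext (funext fun I => funext fun γ => (e.1 I γ).2)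
  uip _ := rfl
  pi A B := ⟨DPsh.pi A.1 B.1, fun _ γ => H.piSet_mem A.2 B.2 (PSh.yl γ)⟩
  pi_sub A B σ := Ty.ext (DPsh.pi_subst A.1 B.1 σ)
  lam t := DPsh.lam t
  app t := DPsh.app t
  app_lam t := DPsh.app_lam t
  lam_app t := DPsh.lam_app t
  lam_sub t σ := DPsh.lam_subst t σ
  univ h _ := ⟨H.univD h _, fun I _ => H.code_mem h I⟩
  univ_sub _ _ _ _ := rfl
  code h _ A := H.codeD h A
  el h _ t := H.elD h t
  el_code h _ A := H.el_codeD h A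
  code_el h _ t := H.code_elD h t
  el_sub _ _ _ _ _ := rfl
  bool := ⟨DPsh.const (ULift Bool) _, fun _ _ => H.lift Bool⟩
  bool_sub _ := rfl
  true := ⟨fun _ _ => ⟨true⟩, fun _ _ _ _ _ _ => rfl⟩
  false := ⟨fun _ _ => ⟨false⟩, fun _ _ _ _ _ _ => rfl⟩
  true_sub _ := HEq.rfl
  false_sub _ := HEq.rfl
  ite A t u v := iteD A.1 t u v
  ite_true _ _ _ := rfl
  ite_false _ _ _ := rfl
  ite_sub A t u v σ A' t' u' v' hA ht hu hv := by
    obtain rfl := eq_of_heq hA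
    obtain rfl := eq_of_heq ht
    obtain rfl := eq_of_heq hu
    obtain rfl := eq_of_heq hv
    rfl
  K Θ _ := ⟨Θ.1.K _, fun I _ => Θ.2 I⟩
  K_sub _ _ _ _ := rfl
  sub_eq_tm _ _ := rfl
  comp_eq_tmSub _ _ := HEq.rfl
  K_emp := rfl
  K_ext _ _ := rfl
  pair_eq_spair A σ t t' h := by
    obtain rfl := eq_of_heq h
    rfl

/-- `∀` is precomposition with `suc`; `k`, `R` and `S` are restriction along the face, degeneracy
and symmetry maps of the cube category. -/
noncomputable def pshOps : ForallOps (pshModel H) where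
  allCon Γ := ⟨Γ.1.shift, fun I => Γ.2 (I + 1)⟩
  allSub σ := DTm.shift σ
  allTy A := ⟨A.1.shift, fun I γ => A.2 (I + 1) γ⟩
  allTm t := DTm.shift t
  k b _ Γ := Γ.1.faceSub b
  R Γ := Γ.1.degenSub
  S Γ := Γ.1.symmSub

end UniverseHierarchy

/-! ### A universe hierarchy with two levels -/

namespace UniverseHierarchy

universe u

/-- Codes for the closure of the lifted types under the operations of a universe. -/
inductive SmallCode : Type (u + 1)
  | unit
  | lift (T : Type)
  | sig (A : Type u) (a : SmallCode) (b : A → SmallCode)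
  | pi (A : Type u) (a : SmallCode) (b : A → SmallCode)
  | piNat (b : ℕ → SmallCode)
  | sub (A : Type u) (a : SmallCode) (P : A → Prop)

open Classical in
/-- The type denoted by a code. -/
noncomputable def SmallCode.ev : SmallCode.{u} → Type (u + 1)
  | unit => PUnit
  | lift T => ULift T
  | sig A a b => if h : Nonempty (ev a ≃ A) then (x : ev a) × ev (b (h.some x)) else PUnit
  | pi A a b => if h : Nonempty (ev a ≃ A) then (x : ev a) → ev (b (h.some x)) else PUnit
  | piNat b => (n : ℕ) → ev (b n)
  | sub A a P => if h : Nonempty (ev a ≃ A) then {x : ev a // P (h.some x)} else PUnit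

theorem SmallCode.small_ev (c : SmallCode.{u}) : Small.{u} c.ev := by
  induction c with
  | unit => exact inferInstanceAs (Small.{u} PUnit)
  | lift T => exact inferInstanceAs (Small.{u} (ULift T))
  | sig A a b ha hb =>
    unfold ev
    split_ifs
    · exact small_sigma _
    · infer_instance
  | pi A a b ha hb =>
    unfold ev
    split_ifs
    · exact small_Pi _
    · infer_instance
  | piNat b hb => exact small_Pi _
  | sub A a P ha =>
    unfold ev
    split_ifs
    · exact small_subtype _ _
    · infer_instance

/-- The universe of all types in `Type (u + 1)` together with a universe of types that are in
bijection with types in `Type u`. -/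
theorem exists_two_levels : Nonempty (UniverseHierarchy.{0, u + 1} (Fin 2)) := by
  let M : Fin 2 → Set (Type (u + 1)) := fun i =>
    {X | i = 0 → ∃ c : SmallCode.{u}, c.ev = X}
  have key : ∀ {X : Type (u + 1)}, (∃ c : SmallCode.{u}, c.ev = X) →
      ∃ (a : SmallCode.{u}) (A : Type u), a.ev = X ∧ Nonempty (a.ev ≃ A) := by
    rintro X ⟨a, rfl⟩
    have := a.small_ev
    exact ⟨a, Shrink a.ev, rfl, ⟨equivShrink _⟩⟩
  have sup0 : ∀ {i j : Fin 2}, i ⊔ j = 0 → i = 0 ∧ j = 0 := by decide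
  refine ⟨⟨M, ?_, ?_, ?_, ?_, ?_, ?_, ?_, ?_⟩⟩
  · intro i j hij X hX hj
    exact hX (le_antisymm (hj ▸ hij) (Fin.zero_le i))
  · exact fun _ => ⟨.unit, rfl⟩
  · exact fun T _ => ⟨.lift T, rfl⟩
  · intro i j X Y hX hY hij
    obtain ⟨a, A, rfl, h⟩ := key (hX (sup0 hij).1)
    choose c hc using fun x => hY x (sup0 hij).2
    refine ⟨.sig A a (c ∘ h.some.symm), ?_⟩
    simp [SmallCode.ev, h, hc]
  · intro i j X Y hX hY hij
    obtain ⟨a, A, rfl, h⟩ := key (hX (sup0 hij).1)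
    choose c hc using fun x => hY x (sup0 hij).2
    refine ⟨.pi A a (c ∘ h.some.symm), ?_⟩
    simp only [SmallCode.ev, dif_pos h]
    exact pi_congr fun x => by simp [hc]
  · intro i Y hY hi
    choose c hc using fun n => hY n hi
    exact ⟨.piNat c, pi_congr hc⟩
  · intro i X P hX hi
    obtain ⟨a, A, rfl, h⟩ := key (hX hi)
    exact ⟨.sub A a (P ∘ h.some.symm), by simp [SmallCode.ev, h]⟩
  · intro i j hij
    obtain rfl : i = 0 := by revert i j; decide
    have h1 : j ≠ 0 := hij.ne'
    have : Small.{u + 1} (M 0) := by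
      refine small_of_injective (β := SmallCode.{u}) (f := fun X => (X.2 rfl).choose) ?_
      intro X Y h
      apply Subtype.ext
      rw [← (X.2 rfl).choose_spec, ← (Y.2 rfl).choose_spec]
      exact congrArg SmallCode.ev h
    exact ⟨Shrink (M 0), fun h => absurd h h1, ⟨(equivShrink _).symm⟩⟩

end UniverseHierarchy

/-! Everything rests on one fact about the cube category: a morphism `f` into `I + 1` decomposes in
exactly one way, either as `face b ∘ g`, or as `suc g ∘ cyc n m`, where `cyc n m` is the symmetry
carrying the first dimension to position `m`. Existence (`nonempty_dec_cyc_comp`) is an induction on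
formal morphisms. Uniqueness (`Dec.heq`) needs no normal form and no faithful semantics: the image
of the first dimension name under `sem` separates the cases, and then the face maps, `suc` and the
invertible `cyc` can be cancelled.

For `Π`: an element of `∀(Π A B)` over `γ` is a natural family of values at the morphisms into `I +
1`. By the decomposition it is determined by its values at `face b ∘ g`, which are the two base
functions, and at `suc g`, which are the values of the apex function; those at `suc g ∘ cyc n m`
follow because `cyc` is invertible (`PiSet.ext_faces`). Conversely, base and apex functions that
agree on faces glue (`PiSet.exists_glue`). So `∀(Π A B)` is the set of compatible triples. `mkAllPi`
is the unique element with given components, and its equations, including stability under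
substitution, follow from that uniqueness (`all_pi_ext`, `exists_mkAllPi`).

For `U`: a term of type `∀U` over `Γ` is a family of types over `y (I + 1)`, natural in `γ`. A type
over the cylinder `Cyl Γ`, the tensor product of `Γ` with the interval, gives such a family
(`codeCyl`). By the decomposition, a point of the cylinder is either an end point with an element of
`Γ`, or a position `m` with an element of `Γ` one dimension lower. A span `A₀ ← A → A₁` becomes the
family with fibre `A_b` at the ends and `A` elsewhere, restriction to an end being `t_b`
(`DPsh.spanTy`). Since the points are explicit and not classes in a colimit, the construction is
strictly stable under substitution and the span is recovered on the nose.

`unspan` is not surjective. In a family made from a span, restriction along the symmetry of the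
square from position `0` to position `1` is the identity of a fibre of `A`. The family `twist` has
two-element fibres and exchanges the two elements there, so it comes from no span. -/

namespace Cube

/-! ### Unique decomposition of morphisms into a positive-dimensional cube -/

/-- The action of a formal morphism on dimension names: a name is sent to an endpoint or a name.
Names are natural numbers, not bounded by the dimension of the target. -/
def Raw.sem : {J I : ℕ} → Raw J I → ℕ → Bool ⊕ ℕ
  | _, _, .id _, n => .inr n
  | _, _, .comp f g, n => Sum.elim .inl g.sem (f.sem n)
  | _, _, .suc _, 0 => .inr 0
  | _, _, .suc f, n + 1 => Sum.map _root_.id Nat.succ (f.sem n)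
  | _, _, .face k _, 0 => .inl k
  | _, _, .face _ _, n + 1 => .inr n
  | _, _, .degen _, n => .inr (n + 1)
  | _, _, .symm _, 0 => .inr 1
  | _, _, .symm _, 1 => .inr 0
  | _, _, .symm _, n + 2 => .inr (n + 2)

/-- Name maps compose as in the Kleisli category of `Bool ⊕ ·`, with `suc` fixing the name `0` and
shifting the others. Each generating equation is then checked on the first few names and is uniform
on the rest. -/
theorem Rel.sem_eq {J I : ℕ} {f g : Raw J I} (h : Rel f g) : f.sem = g.sem := by
  induction h with
  | comp_left g _ ih => funext n; simp [Raw.sem, ih]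
  | comp_right f _ ih => funext n; simp [Raw.sem, ih]
  | suc_congr _ ih => funext n; cases n <;> simp [Raw.sem, ih]
  | id_comp f => rfl
  | comp_id f => funext n; simp only [Raw.sem]; cases f.sem n <;> rfl
  | assoc f g h => funext n; simp only [Raw.sem]; cases f.sem n <;> rfl
  | suc_comp f g =>
    funext n
    cases n with
    | zero => rfl
    | succ n => simp only [Raw.sem]; cases f.sem n <;> rfl
  | suc_id I => funext n; cases n <;> rfl
  | face_nat k f =>
    funext n
    cases n with
    | zero => rfl
    | succ n => simp only [Raw.sem, Sum.elim_inr]; cases f.sem n <;> rfl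
  | degen_nat f => funext n; simp only [Raw.sem, Sum.elim_inr]; cases f.sem n <;> rfl
  | symm_nat f =>
    funext n
    match n with
    | 0 => rfl
    | 1 => rfl
    | n + 2 => simp only [Raw.sem, Sum.elim_inr]; cases f.sem n <;> rfl
  | degen_face k I => rfl
  | symm_face k I => funext n; match n with | 0 | 1 | n + 2 => rfl
  | degen_symm I => funext n; match n with | 0 | n + 1 => rfl
  | symm_symm I => funext n; match n with | 0 | 1 | n + 2 => rfl
  | braid I => funext n; match n with | 0 | 1 | 2 | n + 3 => rfl

/-- The action of a morphism on dimension names. -/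
def sem {J I : ℕ} : Hom J I → ℕ → Bool ⊕ ℕ :=
  Quot.lift Raw.sem fun _ _ h => h.sem_eq

theorem sem_comp {K J I : ℕ} (f : Hom J I) (g : Hom K J) (n : ℕ) :
    sem (comp f g) n = Sum.elim .inl (sem g) (sem f n) := by
  induction f using Quot.ind; induction g using Quot.ind; rfl

theorem sem_suc_zero {J I : ℕ} (f : Hom J I) : sem (suc f) 0 = .inr 0 := by
  induction f using Quot.ind; rfl

theorem sem_suc_succ {J I : ℕ} (f : Hom J I) (n : ℕ) :
    sem (suc f) (n + 1) = Sum.map _root_.id Nat.succ (sem f n) := by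
  induction f using Quot.ind; rfl

theorem symm_suc_face (k : Bool) (I : ℕ) : comp (symm I) (suc (face k I)) = face k (I + 1) := by
  rw [← symm_face, ← assoc, symm_symm, id_comp]

theorem suc_degen_symm (I : ℕ) : comp (suc (degen I)) (symm I) = degen (I + 1) := by
  rw [← degen_symm, assoc, symm_symm, comp_id]

/-- The degeneracy is a retraction of each face. -/
theorem face_injective (k : Bool) {J I : ℕ} {f g : Hom J I}
    (h : comp (face k I) f = comp (face k I) g) : f = g := by
  have := congrArg (comp (degen I)) h
  simpa only [← assoc, degen_face, id_comp] using this

/-- Naturality of the faces turns `suc f ∘ face` into `face ∘ f`, and faces are monic. This is what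
avoids a normal form theorem: distinctness of morphisms is never read off from `sem` beyond the
first name. -/
theorem suc_injective {J I : ℕ} {f g : Hom J I} (h : suc f = suc g) : f = g := by
  have := congrArg (fun x => comp x (face false J)) h
  simp only [← face_nat] at this
  exact face_injective _ this

/-- The symmetry that moves the first dimension to position `m`. -/
def cyc : (n m : ℕ) → Hom (n + 1) (n + 1)
  | n, 0 => id (n + 1)
  | 0, _ + 1 => id 1
  | n + 1, m + 1 => comp (symm n) (suc (cyc n m))

/-- The inverse of `cyc`. -/
def cycInv : (n m : ℕ) → Hom (n + 1) (n + 1)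
  | n, 0 => id (n + 1)
  | 0, _ + 1 => id 1
  | n + 1, m + 1 => comp (suc (cycInv n m)) (symm n)

theorem cyc_zero (n : ℕ) : cyc n 0 = id (n + 1) := by cases n <;> rfl

theorem cyc_one (n : ℕ) : cyc (n + 1) 1 = symm n := by
  rw [cyc, cyc_zero, suc_id, comp_id]

theorem cyc_cycInv (n m : ℕ) : comp (cyc n m) (cycInv n m) = id (n + 1) := by
  induction n generalizing m with
  | zero => cases m <;> exact id_comp _
  | succ n ih =>
    cases m with
    | zero => exact id_comp _
    | succ m =>
      rw [cyc, cycInv, assoc, ← assoc (suc _), ← suc_comp, ih, suc_id, id_comp, symm_symm]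

theorem cycInv_cyc (n m : ℕ) : comp (cycInv n m) (cyc n m) = id (n + 1) := by
  induction n generalizing m with
  | zero => cases m <;> exact id_comp _
  | succ n ih =>
    cases m with
    | zero => exact id_comp _
    | succ m =>
      rw [cyc, cycInv, assoc, ← assoc (symm n), symm_symm, id_comp, ← suc_comp, ih, suc_id]

/-- The bound is needed: for `m` out of range `cyc` takes a default value. -/
theorem sem_cyc_zero {n m : ℕ} (h : m ≤ n) : sem (cyc n m) 0 = .inr m := by
  induction n generalizing m with
  | zero => obtain rfl : m = 0 := by omega
            rfl
  | succ n ih =>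
    cases m with
    | zero => rfl
    | succ m =>
      rw [cyc, sem_comp]
      change sem (suc (cyc n m)) 1 = _
      rw [sem_suc_succ, ih (by omega)]
      rfl

/-- Decompositions of a morphism into a positive-dimensional cube: either it factors through a
face of the first dimension, or it sends the first dimension to the dimension `m`. -/
inductive Dec {I : ℕ} : {K : ℕ} → Hom K (I + 1) → Type
  | face (b : Bool) {K : ℕ} (g : Hom K I) : Dec (comp (Cube.face b I) g)
  | suc {n : ℕ} (g : Hom n I) (m : ℕ) (hm : m ≤ n) : Dec (comp (Cube.suc g) (cyc n m))

theorem sem_face_comp {K I : ℕ} (b : Bool) (g : Hom K I) :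
    sem (comp (face b I) g) 0 = .inl b := by
  rw [sem_comp]; rfl

theorem sem_suc_cyc {n I : ℕ} (g : Hom n I) {m : ℕ} (hm : m ≤ n) :
    sem (comp (suc g) (cyc n m)) 0 = .inr m := by
  rw [sem_comp, sem_suc_zero]; exact sem_cyc_zero hm

theorem face_ne_suc {n I : ℕ} {b : Bool} {g : Hom (n + 1) I} {g' : Hom n I} {m : ℕ} (hm : m ≤ n) :
    comp (face b I) g ≠ comp (suc g') (cyc n m) := by
  intro h
  have := congrArg (sem · 0) h
  simp [sem_face_comp, sem_suc_cyc g' hm] at this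

theorem face_comp_inj {K I : ℕ} {b b' : Bool} {g g' : Hom K I}
    (h : comp (face b I) g = comp (face b' I) g') : b = b' ∧ g = g' := by
  have := congrArg (sem · 0) h
  simp only [sem_face_comp, Sum.inl.injEq] at this
  subst this
  exact ⟨rfl, face_injective _ h⟩

theorem cyc_cancel {n I m : ℕ} {f g : Hom (n + 1) I}
    (h : comp f (cyc n m) = comp g (cyc n m)) : f = g := by
  have := congrArg (fun x => comp x (cycInv n m)) h
  simpa only [assoc, cyc_cycInv, comp_id] using this

theorem suc_cyc_inj {n I : ℕ} {g g' : Hom n I} {m m' : ℕ} (hm : m ≤ n) (hm' : m' ≤ n)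
    (h : comp (suc g) (cyc n m) = comp (suc g') (cyc n m')) : m = m' ∧ g = g' := by
  have := congrArg (sem · 0) h
  simp only [sem_suc_cyc g hm, sem_suc_cyc g' hm', Sum.inr.injEq] at this
  subst this
  exact ⟨rfl, suc_injective (cyc_cancel h)⟩

/-- The kind of the decomposition, the endpoint `b` and the position `m` are visible in the image of
the first name; the remaining factor is then cancelled. Stated for two propositionally equal
morphisms so that case analysis on both decompositions does not have to unify composites. -/
theorem Dec.heq {K I : ℕ} {f f' : Hom K (I + 1)} (d : Dec f) (d' : Dec f') (h : f = f') :
    HEq d d' := by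
  cases d with
  | face b g =>
    cases d' with
    | face b' g' => obtain ⟨rfl, rfl⟩ := face_comp_inj h; rfl
    | suc g' m' hm' => exact absurd h (face_ne_suc hm')
  | suc g m hm =>
    cases d' with
    | face b' g' => exact absurd h.symm (face_ne_suc hm)
    | suc g' m' hm' => obtain ⟨rfl, rfl⟩ := suc_cyc_inj hm hm' h; rfl

instance {K I : ℕ} (f : Hom K (I + 1)) : Subsingleton (Dec f) :=
  ⟨fun d d' => eq_of_heq (d.heq d' rfl)⟩

theorem Dec.nonempty_of_eq {K I : ℕ} {f f' : Hom K (I + 1)} (d : Dec f) (h : f = f') :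
    Nonempty (Dec f') := ⟨h ▸ d⟩

/-- The morphism represented by a generating expression. -/
def Raw.toHom {J I : ℕ} (f : Raw J I) : Hom J I := Quot.mk _ f

/-- The prefix `cyc n m` is what makes the induction work: decomposing the left factor of a
composite may leave a `cyc` in front of the right factor. The equation `J = n + 1` leaves the
codomain a free index for the induction. -/
theorem nonempty_dec_cyc_comp {K J : ℕ} (h : Raw K J) : ∀ (n : ℕ) (e : J = n + 1) (m : ℕ), m ≤ n →
    Nonempty (Dec (comp (cyc n m) (e ▸ h.toHom))) := by
  induction h with
  | id I =>
    rintro n rfl m hm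
    refine (Dec.suc (id n) m hm).nonempty_of_eq ?_
    rw [suc_id, id_comp]
    exact (comp_id _).symm
  | comp f g ihf ihg =>
    rintro n rfl m hm
    obtain ⟨d⟩ := ihf n rfl m hm
    change Nonempty (Dec (comp (cyc n m) (comp f.toHom g.toHom)))
    dsimp only at d
    rw [← assoc]
    generalize comp (cyc n m) f.toHom = x at d
    cases d with
    | face b x => exact (Dec.face b (comp x g.toHom)).nonempty_of_eq (assoc _ _ _).symm
    -- The first dimension has moved to position `m'` in the domain of `f`, so the hypothesis for
    -- `g` is used at `m'`.
    | suc x m' hm' =>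
      obtain ⟨d⟩ := ihg _ rfl m' hm'
      dsimp only at d
      rw [assoc]
      generalize comp (cyc _ m') g.toHom = z at d
      cases d with
      | face b z =>
        refine (Dec.face b (comp x z)).nonempty_of_eq ?_
        rw [← assoc, ← assoc, face_nat]
      | suc z m₂ hm₂ =>
        refine (Dec.suc (comp x z) m₂ hm₂).nonempty_of_eq ?_
        rw [suc_comp, assoc]
  | @suc J I f ih =>
    intro n e m hm
    obtain rfl : I = n := Nat.succ_injective e
    change Nonempty (Dec (comp (cyc I m) (suc f.toHom)))
    cases m with
    | zero =>
      refine (Dec.suc f.toHom 0 (Nat.zero_le _)).nonempty_of_eq ?_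
      rw [cyc_zero, cyc_zero, id_comp, comp_id]
    | succ m =>
      obtain ⟨n, rfl⟩ : ∃ n, I = n + 1 := ⟨I - 1, by omega⟩
      obtain ⟨d⟩ := ih n rfl m (by omega)
      dsimp only at d
      -- `cyc (n+1) (m+1)` is a symmetry after `suc (cyc n m)`. The second factor is absorbed into
      -- `f`, and the symmetry then slides past the decomposition under `suc`.
      rw [cyc, assoc, ← suc_comp]
      generalize comp (cyc _ m) f.toHom = x at d
      cases d with
      | face b x =>
        refine (Dec.face b (suc x)).nonempty_of_eq ?_
        rw [suc_comp, ← assoc, symm_suc_face]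
      | suc x m' hm' =>
        refine (Dec.suc (suc x) (m' + 1) (by omega)).nonempty_of_eq ?_
        rw [suc_comp, ← assoc, symm_nat, assoc, cyc]
  | face k I =>
    intro n e m hm
    obtain rfl : I = n := Nat.succ_injective e
    change Nonempty (Dec (comp (cyc I m) (face k I)))
    cases m with
    | zero =>
      refine (Dec.face k (id I)).nonempty_of_eq ?_
      rw [cyc_zero, id_comp, comp_id]
    | succ m =>
      obtain ⟨n, rfl⟩ : ∃ n, I = n + 1 := ⟨I - 1, by omega⟩
      -- The face fixes the first dimension of its codomain, but the name followed is a later one,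
      -- at position `m + 1`; it survives and drops to position `m`.
      refine (Dec.suc (face k n) m (by omega)).nonempty_of_eq ?_
      rw [cyc, assoc, ← face_nat, ← assoc, symm_face]
  | degen I =>
    rintro n rfl m hm
    -- The degeneracy adds a dimension in front, which shifts position `m` to `m + 1`.
    refine (Dec.suc (degen n) (m + 1) (by omega)).nonempty_of_eq ?_
    change _ = comp (cyc n m) (degen (n + 1))
    rw [← degen_nat, cyc, ← assoc, suc_degen_symm]
  | symm I =>
    intro n e m hm
    obtain rfl : I + 1 = n := Nat.succ_injective e
    change Nonempty (Dec (comp (cyc (I + 1) m) (symm I)))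
    match m with
    | 0 =>
      refine (Dec.suc (id (I + 1)) 1 (by omega)).nonempty_of_eq ?_
      rw [suc_id, id_comp, cyc_zero, id_comp, cyc_one]
    | 1 =>
      refine (Dec.suc (id (I + 1)) 0 (by omega)).nonempty_of_eq ?_
      rw [suc_id, id_comp, cyc_zero, cyc_one, symm_symm]
    | m + 2 =>
      obtain ⟨n, rfl⟩ : ∃ n, I = n + 1 := ⟨I - 1, by omega⟩
      refine (Dec.suc (symm n) (m + 2) hm).nonempty_of_eq ?_
      -- The symmetry commutes with `suc (suc (cyc n m))`; what remains is the braid equation on the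
      -- first three dimensions. The other symmetry cases only permute positions `0` and `1`.
      simp only [cyc, suc_comp]
      rw [assoc, assoc, ← symm_nat, ← assoc (suc (symm n)), ← assoc (symm (n + 1)),
        ← assoc, ← assoc, braid]

theorem nonempty_dec {K I : ℕ} (f : Hom K (I + 1)) : Nonempty (Dec f) := by
  induction f using Quot.ind with
  | mk f =>
    obtain ⟨d⟩ := nonempty_dec_cyc_comp f I rfl 0 (Nat.zero_le _)
    refine d.nonempty_of_eq ?_
    rw [cyc_zero]
    exact id_comp f.toHom

/-- A chosen decomposition. -/
noncomputable def dec {K I : ℕ} (f : Hom K (I + 1)) : Dec f := (nonempty_dec f).some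

end Cube

/-! ### Elements of `Π A B` over a positive-dimensional cube: extensionality and gluing -/

namespace DPsh

variable {Γ Δ : PSh.{w}} {A : DPsh Γ} {B : DPsh A.total}

/-- The value of an element of `Π A B I γ` at a morphism `f` and an element of `A` over any `γ'`
equal to `γ[f]`. -/
def PiSet.ev {I : ℕ} {γ : Γ.obj I} (T : PiSet A B (PSh.yl γ)) {K : ℕ} (f : Cube.Hom K I)
    {γ' : Γ.obj K} (h : Γ.act γ f = γ') (x : A.obj K γ') : B.obj K ⟨γ', x⟩ :=
  match γ', h, x with
  | _, rfl, x => T.1 K ⟨⟨f⟩, x⟩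

theorem PiSet.ext_ev {I : ℕ} {γ : Γ.obj I} {T T' : PiSet A B (PSh.yl γ)}
    (h : ∀ (K : ℕ) (f : Cube.Hom K I) (γ' : Γ.obj K) (h : Γ.act γ f = γ') (x : A.obj K γ'),
      T.ev f h x = T'.ev f h x) : T = T' :=
  Subtype.ext (funext fun K => funext fun z => h K z.1.down _ rfl z.2)

/-- Naturality of the family `T`, with all base points and restricted arguments free up to given
equations. This form spares the later arguments any transport. -/
theorem PiSet.act_ev {I : ℕ} {γ : Γ.obj I} (T : PiSet A B (PSh.yl γ)) {K J : ℕ}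
    (f : Cube.Hom J I) (g : Cube.Hom K J) {γ' : Γ.obj J} {γ'' : Γ.obj K} (h : Γ.act γ f = γ')
    (hg : Γ.act γ' g = γ'') (h' : Γ.act γ (Cube.comp f g) = γ'') (x : A.obj J γ')
    {x' : A.obj K γ''} (hx : A.act g hg x = x') :
    B.act g (total_act hg hx) (T.ev f h x) = T.ev (Cube.comp f g) h' x' := by
  subst h h' hx
  exact T.2 K J g ⟨⟨f⟩, x⟩ ⟨⟨Cube.comp f g⟩, _⟩ (total_act rfl rfl)

/-- A natural family of values determines an element of `Π A B I γ`. -/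
def PiSet.ofFun {I : ℕ} {γ : Γ.obj I}
    (v : ∀ (K : ℕ) (f : Cube.Hom K I) (γ' : Γ.obj K) (_ : Γ.act γ f = γ') (x : A.obj K γ'),
      B.obj K ⟨γ', x⟩)
    (hv : ∀ (K J : ℕ) (f : Cube.Hom J I) (g : Cube.Hom K J) (γ' : Γ.obj J) (γ'' : Γ.obj K)
      (h : Γ.act γ f = γ') (hg : Γ.act γ' g = γ'') (h' : Γ.act γ (Cube.comp f g) = γ'')
      (x : A.obj J γ') (x' : A.obj K γ'') (hx : A.act g hg x = x'),
      B.act g (total_act hg hx) (v J f γ' h x) = v K (Cube.comp f g) γ'' h' x') :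
    PiSet A B (PSh.yl γ) :=
  ⟨fun K z => v K z.1.down _ rfl z.2, by
    rintro K J g ⟨⟨f⟩, x⟩ y rfl
    exact hv K J f g _ _ rfl ((PSh.yl γ).nat' rfl) rfl x _ rfl⟩

theorem PiSet.ofFun_ev {I : ℕ} {γ : Γ.obj I}
    (v : ∀ (K : ℕ) (f : Cube.Hom K I) (γ' : Γ.obj K) (_ : Γ.act γ f = γ') (x : A.obj K γ'),
      B.obj K ⟨γ', x⟩) (hv) {K : ℕ} (f : Cube.Hom K I) {γ' : Γ.obj K} (h : Γ.act γ f = γ')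
    (x : A.obj K γ') : (PiSet.ofFun v hv).ev f h x = v K f γ' h x := by
  subst h; rfl

theorem PiSet.ev_congr {I : ℕ} {γ : Γ.obj I} (T : PiSet A B (PSh.yl γ)) {K : ℕ}
    {f f' : Cube.Hom K I} (hf : f = f') {γ' : Γ.obj K} (h : Γ.act γ f = γ')
    (h' : Γ.act γ f' = γ') (x : A.obj K γ') : T.ev f h x = T.ev f' h' x := by
  subst hf; rfl

/-- Restriction in `Π` is precomposition with the Yoneda image of `f`. The index substitution is
generalised first because `yl γ ∘ y f` and `yl γ₁` are only propositionally equal. -/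
theorem pi_act_ev {J I : ℕ} {γ : Γ.obj I} (T : PiSet A B (PSh.yl γ)) (f : Cube.Hom J I)
    {γ₁ : Γ.obj J} (h₁ : Γ.act γ f = γ₁) {K : ℕ} (g : Cube.Hom K J) {γ' : Γ.obj K}
    (h : Γ.act γ₁ g = γ') (h' : Γ.act γ (Cube.comp f g) = γ') (x : A.obj K γ') :
    PiSet.ev (γ := γ₁) ((pi A B).act f h₁ T) g h x = T.ev (Cube.comp f g) h' x := by
  have key : ∀ (s : PSh.Sub (PSh.y.{w} J) Γ) (hs : (PSh.yl γ).comp (PSh.yMap f) = s)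
      (x : A.obj K (s.1 K ⟨g⟩)) (h' : Γ.act γ (Cube.comp f g) = s.1 K ⟨g⟩),
      (PiSet.res T (PSh.yMap f) hs).1 K ⟨⟨g⟩, x⟩ = T.ev (Cube.comp f g) h' x := by
    rintro _ rfl x h'
    rfl
  subst h
  exact key _ (PSh.yl_yMap h₁) x h'

theorem act_eq_of_eq {C : DPsh Γ} {J I : ℕ} {γ : Γ.obj I} {γ' : Γ.obj J} {f f' : Cube.Hom J I}
    (hf : f = f') (h : Γ.act γ f = γ') (h' : Γ.act γ f' = γ') (x : C.obj I γ) :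
    C.act f h x = C.act f' h' x := by
  subst hf; rfl

theorem exists_act_cyc_eq {C : DPsh Γ} {n m : ℕ} {γ γ' : Γ.obj (n + 1)}
    (h : Γ.act γ (Cube.cyc n m) = γ') (x : C.obj (n + 1) γ') :
    ∃ x₀, C.act (Cube.cyc n m) h x₀ = x := by
  have h1 : Γ.act γ' (Cube.cycInv n m) = γ := by
    rw [← h, ← Γ.act_comp, Cube.cyc_cycInv, Γ.act_id]
  refine ⟨C.act (Cube.cycInv n m) h1 x, ?_⟩
  rw [← C.act_comp _ _ h1 h (by rw [Γ.act_comp, h1, h]),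
    act_eq_of_eq (Cube.cycInv_cyc n m) _ (Γ.act_id _), C.act_id]

theorem act_cyc_injective {C : DPsh Γ} {n m : ℕ} {γ γ' : Γ.obj (n + 1)}
    (h : Γ.act γ (Cube.cyc n m) = γ') : Function.Injective (C.act (Cube.cyc n m) h) := by
  have h1 : Γ.act γ' (Cube.cycInv n m) = γ := by
    rw [← h, ← Γ.act_comp, Cube.cyc_cycInv, Γ.act_id]
  refine Function.LeftInverse.injective (g := C.act (Cube.cycInv n m) h1) fun x => ?_
  rw [← C.act_comp _ _ h h1 (by rw [Γ.act_comp, h, h1]),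
    act_eq_of_eq (Cube.cyc_cycInv n m) _ (Γ.act_id _), C.act_id]

/-- Two elements of `Π A B` over a positive-dimensional cube agree if they agree on the faces and
on the morphisms in the image of `suc`. -/
theorem PiSet.ext_faces {I : ℕ} {γ : Γ.obj (I + 1)} {T T' : PiSet A B (PSh.yl γ)}
    (hk : ∀ (b : Bool) (K : ℕ) (g : Cube.Hom K I) (γ' : Γ.obj K)
      (h : Γ.act γ (Cube.comp (Cube.face b I) g) = γ') (x : A.obj K γ'),
      T.ev _ h x = T'.ev _ h x)
    (hs : ∀ (n : ℕ) (g : Cube.Hom n I) (γ' : Γ.obj (n + 1)) (h : Γ.act γ (Cube.suc g) = γ')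
      (x : A.obj (n + 1) γ'), T.ev _ h x = T'.ev _ h x) : T = T' := by
  apply PiSet.ext_ev
  intro K f
  cases Cube.dec f with
  | face b g => exact hk b K g
  | @suc n g m hm =>
    intro γ' h x
    have h2 : Γ.act (Γ.act γ (Cube.suc g)) (Cube.cyc n m) = γ' := (Γ.act_comp _ _ _).symm.trans h
    obtain ⟨x₀, hx⟩ := exists_act_cyc_eq h2 x
    rw [← PiSet.act_ev T (Cube.suc g) (Cube.cyc n m) rfl h2 h _ hx,
      ← PiSet.act_ev T' (Cube.suc g) (Cube.cyc n m) rfl h2 h _ hx, hs]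

/-- `∀B` over `∀Γ ▷ ∀A`. -/
abbrev shiftExt (B : DPsh A.total) : DPsh A.shift.total := DPsh.shift B

section Glue

variable {I : ℕ} {γ : Γ.obj (I + 1)}
  (u : (b : Bool) → PiSet A B (PSh.yl (Γ.act γ (Cube.face b I))))
  (v : PiSet A.shift (shiftExt B) (PSh.yl (Γ := Γ.shift) (I := I) γ))

/-- Restricting a value of `v` to a face gives a value of `u`. -/
def GlueCompat : Prop :=
  ∀ (b : Bool) (n : ℕ) (g : Cube.Hom n I) (γ' : Γ.obj (n + 1)) (h : Γ.act γ (Cube.suc g) = γ')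
    (x : A.obj (n + 1) γ') (γ'' : Γ.obj n) (h' : Γ.act γ' (Cube.face b n) = γ'')
    (h'' : Γ.act (Γ.act γ (Cube.face b I)) g = γ'') (x' : A.obj n γ'')
    (hx : A.act (Cube.face b n) h' x = x'),
    B.act (γ := ⟨γ', x⟩) (Cube.face b n) (total_act h' hx) (PiSet.ev (Γ := Γ.shift) v g h x) =
      (u b).ev g h'' x'

/-- `z` is a value at `f` and `x` of the function glued from `u` and `v`. -/
def GlueVal {K : ℕ} (f : Cube.Hom K (I + 1)) {γ' : Γ.obj K} (h : Γ.act γ f = γ')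
    (x : A.obj K γ') (z : B.obj K ⟨γ', x⟩) : Prop :=
  (∃ (b : Bool) (g : Cube.Hom K I) (e : Cube.comp (Cube.face b I) g = f),
    z = (u b).ev g (by rw [← Γ.act_comp, e, h]) x) ∨
  ∃ (n : ℕ) (g : Cube.Hom n I) (ρ : Cube.Hom K (n + 1)) (_ : Cube.comp (Cube.suc g) ρ = f)
    (γ₀ : Γ.obj (n + 1)) (h₀ : Γ.act γ (Cube.suc g) = γ₀) (x₀ : A.obj (n + 1) γ₀)
    (hρ : Γ.act γ₀ ρ = γ') (hx : A.act ρ hρ x₀ = x),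
    z = B.act (γ := ⟨γ₀, x₀⟩) ρ (total_act hρ hx) (PiSet.ev (Γ := Γ.shift) v g h₀ x₀)

theorem GlueVal.exists {K : ℕ} (f : Cube.Hom K (I + 1)) {γ' : Γ.obj K} (h : Γ.act γ f = γ')
    (x : A.obj K γ') : ∃ z, GlueVal u v f h x z := by
  cases Cube.dec f with
  | face b g => exact ⟨_, .inl ⟨b, g, rfl, rfl⟩⟩
  | @suc n g m hm =>
    have h2 : Γ.act (Γ.act γ (Cube.suc g)) (Cube.cyc n m) = γ' := (Γ.act_comp _ _ _).symm.trans h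
    obtain ⟨x₀, hx⟩ := exists_act_cyc_eq h2 x
    exact ⟨_, .inr ⟨n, g, Cube.cyc n m, rfl, _, rfl, _, h2, hx, rfl⟩⟩

variable {u v}

/-- In the second alternative of `GlueVal` the morphism `ρ` is arbitrary and not one of the `cyc`.
Closure under restriction is therefore just composition in `g` or in `ρ`, with no new decomposition;
the price is paid in the uniqueness lemmas. -/
theorem GlueVal.act {K J : ℕ} {f : Cube.Hom J (I + 1)} {γ' : Γ.obj J} {h : Γ.act γ f = γ'}
    {x : A.obj J γ'} {z : B.obj J ⟨γ', x⟩} (hz : GlueVal u v f h x z) (g : Cube.Hom K J)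
    {γ'' : Γ.obj K} (hg : Γ.act γ' g = γ'') (h' : Γ.act γ (Cube.comp f g) = γ'')
    {x' : A.obj K γ''} (hx : A.act g hg x = x') :
    GlueVal u v (Cube.comp f g) h' x' (B.act g (total_act hg hx) z) := by
  obtain ⟨b, g₀, rfl, rfl⟩ | ⟨n, g₀, ρ, rfl, γ₀, h₀, x₀, hρ, rfl, rfl⟩ := hz
  · refine .inl ⟨b, Cube.comp g₀ g, (Cube.assoc _ _ _).symm, ?_⟩
    exact PiSet.act_ev _ _ _ _ hg _ _ hx
  · have hρg : Γ.act γ₀ (Cube.comp ρ g) = γ'' := by rw [Γ.act_comp, hρ, hg]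
    refine .inr ⟨n, g₀, Cube.comp ρ g, (Cube.assoc _ _ _).symm, γ₀, h₀, x₀, hρg, ?_, ?_⟩
    · rw [← hx]; exact A.act_comp ρ g hρ hg hρg x₀
    · exact (B.act_comp ρ g _ _ _ _).symm

/-- A value coming from `v` through some `ρ` can lie over a face only if `ρ` itself factors through
the same face, since the alternative contradicts uniqueness of decompositions. Compatibility then
rewrites it as a value of `u`. -/
theorem GlueVal.eq_face (hc : GlueCompat u v) {K : ℕ} {b : Bool} {g : Cube.Hom K I} {γ' : Γ.obj K}
    {h : Γ.act γ (Cube.comp (Cube.face b I) g) = γ'} {x : A.obj K γ'} {z : B.obj K ⟨γ', x⟩}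
    (hz : GlueVal u v (Cube.comp (Cube.face b I) g) h x z) :
    z = (u b).ev g ((Γ.act_comp _ _ _).symm.trans h) x := by
  obtain ⟨b', g', e, rfl⟩ | ⟨n, g₀, ρ, e, γ₀, h₀, x₀, hρ, rfl, rfl⟩ := hz
  · obtain ⟨rfl, rfl⟩ := Cube.face_comp_inj e
    rfl
  · cases Cube.dec ρ with
    | face b' k =>
      rw [← Cube.assoc, ← Cube.face_nat, Cube.assoc] at e
      obtain ⟨rfl, rfl⟩ := Cube.face_comp_inj e
      have hk : Γ.act (Γ.act γ₀ (Cube.face b' n)) k = γ' := (Γ.act_comp _ _ _).symm.trans hρ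
      have h1 := B.act_comp (γ := ⟨γ₀, x₀⟩) (γ' := ⟨_, A.act (Cube.face b' n) rfl x₀⟩)
        (γ'' := ⟨γ', A.act _ hρ x₀⟩) (Cube.face b' n) k
        (total_act rfl rfl) (total_act hk (A.act_comp _ _ rfl hk hρ x₀).symm)
        (total_act hρ rfl) (PiSet.ev (Γ := Γ.shift) v g₀ h₀ x₀)
      have h2 : Γ.act (Γ.act γ (Cube.face b' I)) g₀ = Γ.act γ₀ (Cube.face b' n) := by
        rw [← Γ.act_comp, Cube.face_nat, Γ.act_comp, h₀]
      refine h1.trans ((congrArg _ (hc b' n g₀ γ₀ h₀ x₀ _ rfl h2 _ rfl)).trans ?_)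
      exact PiSet.act_ev _ _ _ _ hk _ _ (A.act_comp _ _ rfl hk hρ x₀).symm
    | suc k m hm =>
      rw [← Cube.assoc, ← Cube.suc_comp] at e
      exact absurd e.symm (Cube.face_ne_suc hm)

/-- Here `ρ` must be `suc k ∘ cyc` with the same position, so the two values of `v` differ by
restriction along `suc k`, which is naturality of `v`. Compatibility with the faces plays no role.
-/
theorem GlueVal.eq_suc {n : ℕ} {g : Cube.Hom n I} {m : ℕ} (hm : m ≤ n) {γ' : Γ.obj (n + 1)}
    {h : Γ.act γ (Cube.comp (Cube.suc g) (Cube.cyc n m)) = γ'} {x : A.obj (n + 1) γ'}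
    {z : B.obj (n + 1) ⟨γ', x⟩}
    (hz : GlueVal u v (Cube.comp (Cube.suc g) (Cube.cyc n m)) h x z)
    {γ₁ : Γ.obj (n + 1)} (h₁ : Γ.act γ (Cube.suc g) = γ₁) (x₁ : A.obj (n + 1) γ₁)
    (hm₁ : Γ.act γ₁ (Cube.cyc n m) = γ') (hx₁ : A.act (Cube.cyc n m) hm₁ x₁ = x) :
    z = B.act (γ := ⟨γ₁, x₁⟩) (Cube.cyc n m) (total_act hm₁ hx₁)
      (PiSet.ev (Γ := Γ.shift) v g h₁ x₁) := by
  obtain ⟨b', g', e, rfl⟩ | ⟨n₀, g₀, ρ, e, γ₀, h₀, x₀, hρ, hx, rfl⟩ := hz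
  · exact absurd e (Cube.face_ne_suc hm)
  · cases Cube.dec ρ with
    | face b' k =>
      rw [← Cube.assoc, ← Cube.face_nat, Cube.assoc] at e
      exact absurd e (Cube.face_ne_suc hm)
    | suc k m' hm' =>
      rw [← Cube.assoc, ← Cube.suc_comp] at e
      obtain ⟨rfl, rfl⟩ := Cube.suc_cyc_inj hm' hm e
      have hk : Γ.act γ₀ (Cube.suc k) = γ₁ := by
        rw [← h₀, ← Γ.act_comp, ← Cube.suc_comp, h₁]
      have h2 : A.act (Cube.suc k) hk x₀ = x₁ := by
        -- The restrictions of both arguments along the invertible `cyc n m'` are `x`.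
        apply act_cyc_injective hm₁
        rw [← A.act_comp _ _ hk hm₁ hρ, hx, hx₁]
      refine (B.act_comp (γ := ⟨γ₀, x₀⟩) (γ' := ⟨γ₁, x₁⟩) (γ'' := ⟨γ', x⟩) (Cube.suc k)
        (Cube.cyc n m') (total_act hk h2) (total_act hm₁ hx₁) _ _).trans ?_
      exact congrArg _
        (PiSet.act_ev (Γ := Γ.shift) (A := A.shift) (B := shiftExt B) v g₀ k h₀ hk h₁ x₀ h2)

theorem GlueVal.unique (hc : GlueCompat u v) {K : ℕ}
    {f : Cube.Hom K (I + 1)} {γ' : Γ.obj K} {h : Γ.act γ f = γ'}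
    {x : A.obj K γ'} {z z' : B.obj K ⟨γ', x⟩} (hz : GlueVal u v f h x z)
    (hz' : GlueVal u v f h x z') : z = z' := by
  cases Cube.dec f with
  | face b g => rw [hz.eq_face hc, hz'.eq_face hc]
  | @suc n g m hm =>
    have h2 : Γ.act (Γ.act γ (Cube.suc g)) (Cube.cyc n m) = γ' := (Γ.act_comp _ _ _).symm.trans h
    obtain ⟨x₀, hx⟩ := exists_act_cyc_eq h2 x
    rw [hz.eq_suc hm rfl _ h2 hx, hz'.eq_suc hm rfl _ h2 hx]

/-- Compatible functions on the two faces and on the shifted presheaf can be glued. -/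
theorem PiSet.exists_glue (hc : GlueCompat u v) : ∃ T : PiSet A B (PSh.yl γ),
    (∀ b, (pi A B).act (Cube.face b I) rfl T = u b) ∧
    ∀ (n : ℕ) (g : Cube.Hom n I) (γ' : Γ.obj (n + 1)) (h : Γ.act γ (Cube.suc g) = γ')
      (x : A.obj (n + 1) γ'), T.ev (Cube.suc g) h x = PiSet.ev (Γ := Γ.shift) v g h x := by
  -- Values are chosen by existence; uniqueness turns closure of `GlueVal` under restriction into
  -- naturality of the choice.
  choose w hw using fun K (f : Cube.Hom K (I + 1)) (γ' : Γ.obj K) (h : Γ.act γ f = γ')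
    (x : A.obj K γ') => GlueVal.exists u v f h x
  refine ⟨PiSet.ofFun w ?_, fun b => PiSet.ext_ev fun K g γ' h x => ?_, fun n g γ' h x => ?_⟩
  · intro K J f g γ' γ'' h hg h' x x' hx
    exact ((hw J f γ' h x).act g hg h' hx).unique hc (hw K _ γ'' h' x')
  · refine (pi_act_ev _ _ _ g h ((Γ.act_comp _ _ _).trans h) x).trans ?_
    rw [PiSet.ofFun_ev]
    exact (hw K _ γ' _ x).eq_face hc
  · rw [PiSet.ofFun_ev]
    refine (hw _ _ γ' h x).unique hc (.inr ⟨n, g, Cube.id _, Cube.comp_id _, γ', h, x,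
      Γ.act_id _, A.act_id _ _, ?_⟩)
    exact (B.act_id (γ := ⟨γ', x⟩) _ _).symm

end Glue

end DPsh

/-! ### The presheaf model in layers, and the laws of `∀`, `k`, `R`, `S` -/

namespace UniverseHierarchy

variable {L : Type l} [SemilatticeSup L] [OrderBot L] (H : UniverseHierarchy.{l, w} L)

/-- The category with families of the presheaf model. Splitting `pshModel` along the layers of
`CoreModel` makes it cheap to unfold. -/
noncomputable def pshCwF : CwF.{l, w + 1, w} L where
  Con i := H.Con i
  Sub Δ Γ := PSh.Sub Δ.1 Γ.1
  id := PSh.Sub.id _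
  comp σ τ := σ.comp τ
  id_comp _ := rfl
  comp_id _ := rfl
  assoc _ _ _ := rfl
  emp := ⟨⟨fun _ => PUnit, fun x _ => x, fun _ => rfl, fun _ _ _ => rfl⟩, fun _ => H.unit⟩
  eps := ⟨fun _ _ => PUnit.unit, fun _ _ _ _ _ _ => rfl⟩
  eps_uniq _ := rfl
  Ty j Γ := H.Ty j Γ.1
  Tm Γ A := DTm Γ.1 A.1
  tySub A σ := A.subst σ
  tmSub t σ := t.subst σ
  tySub_id _ := rfl
  tySub_comp _ _ _ := rfl
  tmSub_id _ := HEq.rfl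
  tmSub_comp _ _ _ := HEq.rfl
  ext Γ A := ⟨A.1.total, fun I => H.sigma (Γ.2 I) (A.2 I)⟩
  pair σ t := DPsh.pair σ t
  p := DPsh.wk _
  q := DPsh.var _
  p_pair _ _ := rfl
  q_pair _ _ := HEq.rfl
  pair_eta _ := rfl

/-- The type formers of the presheaf model. -/
noncomputable def pshTypeFormers : TypeFormers.{l, w + 1, w} L where
  toCwF := H.pshCwF
  top := ⟨DPsh.const PUnit _, fun _ _ => H.unit⟩
  top_sub _ := rfl
  tt := ⟨fun _ _ => PUnit.unit, fun _ _ _ _ _ _ => rfl⟩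
  tt_uniq _ := rfl
  sig A B := ⟨DPsh.sig A.1 B.1, fun I γ => H.sigma (A.2 I γ) fun _ => B.2 I _⟩
  sig_sub _ _ _ := rfl
  spair {_ _ _ _ _ B} u v := ⟨fun I γ => ⟨u.1 I γ, v.1 I γ⟩, fun J I f γ γ' h =>
    DPsh.sig_ext (u.2 J I f γ γ' h) ((DPsh.act_heq B.1 _ _ rfl rfl HEq.rfl).trans
      (heq_of_eq (v.2 J I f γ γ' h)))⟩
  fst t := ⟨fun I γ => (t.1 I γ).1, fun J I f γ γ' h => congrArg Sigma.fst (t.2 J I f γ γ' h)⟩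
  snd {_ _ _ _ _ B} t := ⟨fun I γ => (t.1 I γ).2, fun J I f γ γ' h => eq_of_heq
    ((DPsh.act_heq B.1 _ _ rfl rfl HEq.rfl).trans (DPsh.sig_snd (t.2 J I f γ γ' h)))⟩
  fst_spair _ _ := rfl
  snd_spair _ _ := HEq.rfl
  spair_eta _ := rfl
  fst_sub _ _ := rfl
  snd_sub _ _ := HEq.rfl
  eq u v := ⟨DPsh.eq u v, fun _ _ => H.sub _ (H.mono bot_le H.unit)⟩
  eq_sub _ _ _ := rfl
  refl u := ⟨fun _ _ => ⟨PUnit.unit, rfl⟩, fun _ _ _ _ _ _ => rfl⟩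
  reflect e := Subtype.ext (funext fun I => funext fun γ => (e.1 I γ).2)
  uip _ := rfl
  pi A B := ⟨DPsh.pi A.1 B.1, fun _ γ => H.piSet_mem A.2 B.2 (PSh.yl γ)⟩
  pi_sub A B σ := Ty.ext (DPsh.pi_subst A.1 B.1 σ)
  lam t := DPsh.lam t
  app t := DPsh.app t
  app_lam t := DPsh.app_lam t
  lam_app t := DPsh.lam_app t
  lam_sub t σ := DPsh.lam_subst t σ
  univ h _ := ⟨H.univD h _, fun I _ => H.code_mem h I⟩
  univ_sub _ _ _ _ := rfl
  code h _ A := H.codeD h A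
  el h _ t := H.elD h t
  el_code h _ A := H.el_codeD h A
  code_el h _ t := H.code_elD h t
  el_sub _ _ _ _ _ := rfl
  bool := ⟨DPsh.const (ULift Bool) _, fun _ _ => H.lift Bool⟩
  bool_sub _ := rfl
  true := ⟨fun _ _ => ⟨true⟩, fun _ _ _ _ _ _ => rfl⟩
  false := ⟨fun _ _ => ⟨false⟩, fun _ _ _ _ _ _ => rfl⟩
  true_sub _ := HEq.rfl
  false_sub _ := HEq.rfl
  ite A t u v := iteD A.1 t u v
  ite_true _ _ _ := rfl
  ite_false _ _ _ := rfl
  ite_sub A t u v σ A' t' u' v' hA ht hu hv := by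
    obtain rfl := eq_of_heq hA
    obtain rfl := eq_of_heq ht
    obtain rfl := eq_of_heq hu
    obtain rfl := eq_of_heq hv
    rfl

/-- The presheaf model, definitionally equal to `pshModel`. -/
noncomputable def pshCore : CoreModel.{l, w + 1, w} L where
  toTypeFormers := H.pshTypeFormers
  K Θ _ := ⟨Θ.1.K _, fun I _ => Θ.2 I⟩
  K_sub _ _ _ _ := rfl
  sub_eq_tm _ _ := rfl
  comp_eq_tmSub _ _ := HEq.rfl
  K_emp := rfl
  K_ext _ _ := rfl
  pair_eq_spair A σ t t' h := by
    obtain rfl := eq_of_heq h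
    rfl

theorem pshCore_eq : H.pshCore = H.pshModel := rfl

/-- The operations `pshOps`, on `pshCore`. -/
noncomputable def coreOps : ForallOps H.pshCore where
  allCon Γ := ⟨Γ.1.shift, fun I => Γ.2 (I + 1)⟩
  allSub σ := DTm.shift σ
  allTy A := ⟨A.1.shift, fun I γ => A.2 (I + 1) γ⟩
  allTm t := DTm.shift t
  k b _ Γ := Γ.1.faceSub b
  R Γ := Γ.1.degenSub
  S Γ := Γ.1.symmSub

theorem coreOps_heq : HEq H.coreOps H.pshOps := HEq.rfl

end UniverseHierarchy

theorem PSh.act_act_act {Γ : PSh.{w}} {M K J I : ℕ} (γ : Γ.obj I) (f : Cube.Hom J I)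
    (g : Cube.Hom K J) (h : Cube.Hom M K) :
    Γ.act (Γ.act (Γ.act γ f) g) h = Γ.act γ (Cube.comp (Cube.comp f g) h) := by
  rw [Γ.act_comp, Γ.act_comp]

namespace UniverseHierarchy

variable {L : Type l} [SemilatticeSup L] [OrderBot L] (H : UniverseHierarchy.{l, w} L)

/-- `∀`, `k`, `R` and `S` on the presheaf model satisfy the equations of the global theory. -/
noncomputable def coreForall : ForallStructure H.pshCore where
  toForallOps := H.coreOps
  all_id _ := rfl
  all_comp _ _ := rfl
  all_emp := rfl
  all_eps _ := HEq.rfl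
  allTy_sub _ _ := rfl
  allTm_sub _ _ := HEq.rfl
  all_ext _ _ := rfl
  all_pair _ _ := HEq.rfl
  all_p _ := HEq.rfl
  all_q _ := HEq.rfl
  all_top _ := rfl
  all_tt _ := HEq.rfl
  all_sig _ _ := rfl
  all_spair u v v' h := by
    obtain rfl := eq_of_heq h
    rfl
  all_fst _ := rfl
  all_snd _ := HEq.rfl
  all_eq _ _ := rfl
  all_refl _ := HEq.rfl
  all_K _ _ := rfl
  allSub_eq_allTm _ := HEq.rfl
  k_nat b _ _ Γ Δ σ := Subtype.ext <| funext fun I => funext fun δ =>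
    σ.nat (Cube.face b I) (I := I + 1) δ
  R_nat {_ _ Γ Δ} σ := Subtype.ext <| funext fun I => funext fun δ => σ.nat (Cube.degen I) δ
  S_nat {_ _ Γ Δ} σ := Subtype.ext <| funext fun I => funext fun δ =>
    σ.nat (Cube.symm I) (I := I + 2) δ
  k_R b _ Γ := Subtype.ext <| funext fun I => funext fun γ => by
    refine (Γ.1.act_comp γ _ _).symm.trans ?_
    rw [Cube.degen_face]
    exact Γ.1.act_id γ
  -- Restriction is contravariant: `k` at `∀Γ` restricts along `suc (face b I)`, while `∀k`
  -- restricts along `face b (I + 1)`. Hence the form of the cube equation with the symmetry moved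
  -- to the other side; likewise for `S_R`.
  k_S b _ Γ := Subtype.ext <| funext fun I => funext fun γ => by
    refine (Γ.1.act_comp (I := I + 2) γ _ _).symm.trans ?_
    rw [Cube.symm_suc_face]
    rfl
  S_R Γ := Subtype.ext <| funext fun I => funext fun γ => by
    refine (Γ.1.act_comp (I := I + 1) γ _ _).symm.trans ?_
    rw [Cube.suc_degen_symm]
    rfl
  S_S Γ := Subtype.ext <| funext fun I => funext fun γ => by
    refine (Γ.1.act_comp (I := I + 2) γ _ _).symm.trans ?_
    rw [Cube.symm_symm]
    exact Γ.1.act_id (I := I + 2) γ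
  -- `S` at `∀Γ` acts by `suc (symm I)` and `∀S` by `symm (I + 1)`, so the two sides of the braid
  -- equation are exchanged.
  S_braid Γ := Subtype.ext <| funext fun I => funext fun γ => by
    exact (PSh.act_act_act (Γ := Γ.1) (I := I + 3) γ _ _ _).trans
      ((congrArg (Γ.1.act (I := I + 3) γ) (Cube.braid I).symm).trans
        (PSh.act_act_act (Γ := Γ.1) (I := I + 3) γ _ _ _).symm)
  all_bool _ := rfl
  all_true _ := HEq.rfl
  all_false _ := HEq.rfl
  all_ite A t u v A' t' u' v' hA ht hu hv := by
    obtain rfl := eq_of_heq hA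
    obtain rfl := eq_of_heq ht
    obtain rfl := eq_of_heq hu
    obtain rfl := eq_of_heq hv
    rfl

end UniverseHierarchy

/-! ### Values of functions under substitution, application and abstraction -/

namespace DPsh

variable {Γ Δ : PSh.{w}} {A : DPsh Γ} {B : DPsh A.total}

theorem _root_.DTm.heq_of_forall {A A' : DPsh Γ} (hA : A = A') {t : DTm Γ A} {t' : DTm Γ A'}
    (h : ∀ I γ, HEq (t.1 I γ) (t'.1 I γ)) : HEq t t' := by
  subst hA
  exact heq_of_eq (Subtype.ext (funext fun I => funext fun γ => eq_of_heq (h I γ)))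

theorem _root_.DTm.heq_apply {A A' : DPsh Γ} (hA : A = A') {t : DTm Γ A} {t' : DTm Γ A'}
    (h : HEq t t') (I : ℕ) (γ : Γ.obj I) : HEq (t.1 I γ) (t'.1 I γ) := by
  subst hA
  subst h
  rfl

/-- Values are unchanged when `(Π A B)[σ]` is identified with `Π A[σ] B[σ↑]`. -/
theorem PiSet.ev_subst (σ : PSh.Sub Δ Γ) {I : ℕ} {δ : Δ.obj I}
    (T : PiSet (A.subst σ) (B.subst (up σ A)) (PSh.yl δ)) (T' : PiSet A B (PSh.yl (σ.1 I δ)))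
    (hT : HEq T T') {K : ℕ} (f : Cube.Hom K I) {δ' : Δ.obj K} (h : Δ.act δ f = δ')
    (x : A.obj K (σ.1 K δ')) :
    T.ev f h x = T'.ev f (σ.nat' h) x := by
  -- The point `z` is kept general because its second component lies over `(σ δ)[f]` and `x` lies
  -- over `σ (δ[f])`; these are equal only by naturality of `σ`.
  have key : ∀ (s : PSh.Sub (PSh.y.{w} I) Γ) (hs : σ.comp (PSh.yl δ) = s) (T' : PiSet A B s)
      (_ : HEq T T') (x : A.obj K (σ.1 K (Δ.act δ f))) (z : (A.subst s).total.obj K)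
      (_ : HEq (⟨σ.1 K (Δ.act δ f), x⟩ : A.total.obj K) ((up s A).1 K z)) (_ : z.1 = ⟨f⟩),
      HEq (T.1 K ⟨⟨f⟩, x⟩) (T'.1 K z) := by
    rintro _ rfl T' hT x ⟨_, z⟩ hz rfl
    obtain rfl := eq_of_heq hT
    obtain rfl : x = z := by
      have := eq_of_heq hz
      exact eq_of_heq (Sigma.mk.inj_iff.1 this).2
    rfl
  subst h
  refine eq_of_heq ((key _ (PSh.comp_yl σ δ) T' hT x
    ⟨⟨f⟩, cast (congrArg (A.obj K) (σ.nat f δ).symm) x⟩ ?_ rfl).trans ?_)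
  · apply heq_of_eq
    exact total_ext (σ.nat f δ).symm (cast_heq _ _).symm
  · have key' : ∀ (γ' : Γ.obj K) (h : Γ.act (σ.1 I δ) f = γ') (x : A.obj K γ')
        (x₀ : A.obj K (Γ.act (σ.1 I δ) f)), HEq x₀ x → HEq (T'.1 K ⟨⟨f⟩, x₀⟩) (T'.ev f h x) := by
      rintro _ rfl x x₀ hx
      obtain rfl := eq_of_heq hx
      rfl
    exact key' _ _ _ _ (cast_heq _ _)

/-- The two sets are equal through `σ ∘ yl δ = yl (σ δ)`; after a cast along that equality the claim
is extensionality of values. -/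
theorem PiSet.heq_iff_ev (σ : PSh.Sub Δ Γ) {I : ℕ} {δ : Δ.obj I}
    (T : PiSet (A.subst σ) (B.subst (up σ A)) (PSh.yl δ)) (T' : PiSet A B (PSh.yl (σ.1 I δ))) :
    HEq T T' ↔ ∀ (K : ℕ) (f : Cube.Hom K I) (δ' : Δ.obj K) (h : Δ.act δ f = δ')
      (x : A.obj K (σ.1 K δ')), T.ev f h x = T'.ev f (σ.nat' h) x := by
  constructor
  · intro hT K f δ' h x
    exact PiSet.ev_subst σ T T' hT f h x
  · intro hT
    have e : PiSet (A.subst σ) (B.subst (up σ A)) (PSh.yl δ) = PiSet A B (PSh.yl (σ.1 I δ)) :=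
      congrArg (PiSet A B) (PSh.comp_yl σ δ)
    refine (cast_heq e T).symm.trans (heq_of_eq (PiSet.ext_ev fun K f γ' h x => ?_))
    obtain rfl : γ' = σ.1 K (Δ.act δ f) := h.symm.trans (σ.nat f δ)
    rw [← PiSet.ev_subst σ T _ (cast_heq e T).symm f rfl x, hT]

/-- Absorbs the transports along `γ[id] = γ` in the definition of `app`. -/
theorem app_val (t : DTm Γ (pi A B)) {I : ℕ} (γ : Γ.obj I) (x : A.obj I γ) :
    (app t).1 I ⟨γ, x⟩ = PiSet.ev (t.1 I γ) (Cube.id I) (Γ.act_id γ) x := by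
  apply eq_of_heq
  refine (B.act_id_heq _ _).trans ?_
  have key : ∀ (γ' : Γ.obj I) (h : Γ.act γ (Cube.id I) = γ') (x₀ : A.obj I (Γ.act γ (Cube.id I)))
      (x : A.obj I γ'), HEq x₀ x →
      HEq ((t.1 I γ).1 I ⟨⟨Cube.id I⟩, x₀⟩) (PiSet.ev (t.1 I γ) (Cube.id I) h x) := by
    rintro _ rfl x₀ x hx
    obtain rfl := eq_of_heq hx
    rfl
  exact key _ _ _ _ (A.act_id_heq _ _)

theorem lam_ev (t : DTm A.total B) {I : ℕ} (γ : Γ.obj I) {K : ℕ} (f : Cube.Hom K I)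
    {γ' : Γ.obj K} (h : Γ.act γ f = γ') (x : A.obj K γ') :
    PiSet.ev ((lam t).1 I γ) f h x = t.1 K ⟨γ', x⟩ := by
  subst h; rfl

end DPsh

/-! ### Pointwise form of the components of `∀(Π A B)` -/

namespace UniverseHierarchy

open DPsh

variable {L : Type l} [SemilatticeSup L] [OrderBot L] {H : UniverseHierarchy.{l, w} L}

variable {i i' j j' : L} {Γ : H.pshCore.Con i} {Δ : H.pshCore.Con i'} {A : H.pshCore.Ty j Γ}
    {B : H.pshCore.Ty j' (H.pshCore.ext Γ A)} (σ : H.pshCore.Sub Δ (H.coreForall.allCon Γ))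
    (tk : (b : Bool) → H.pshCore.Tm Δ
      (H.pshCore.tySub (H.pshCore.pi A B) (H.pshCore.comp (H.coreForall.k b Γ) σ)))
    (t : H.pshCore.Tm Δ
      (H.pshCore.tySub (H.pshCore.pi (H.coreForall.allTy A) (H.coreForall.allTyExt B)) σ))

/-- The value of `t_b` at `δ`. -/
def evBase (b : Bool) {I : ℕ} (δ : Δ.1.obj I) : PiSet A.1 B.1
    (PSh.yl (Γ := Γ.1) (Γ.1.act (I := I + 1) (σ.1 I δ) (Cube.face b I))) := (tk b).1 I δ

/-- The value of `t` at `δ`. -/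
def evApex {I : ℕ} (δ : Δ.1.obj I) : PiSet A.1.shift (shiftExt B.1)
    (PSh.yl (Γ := Γ.1.shift) (I := I) (σ.1 I δ)) := t.1 I δ

theorem coe_apply_heq {Γ : H.pshCore.Con i} {A A' : H.pshCore.Ty j Γ} (h : A = A')
    (t : H.pshCore.Tm Γ A) (I : ℕ) (γ : Γ.1.obj I) :
    HEq ((H.pshCore.coe h t).1 I γ) (t.1 I γ) := by
  subst h; rfl

theorem dollar_base (b : Bool) (h) {I : ℕ} (δ : Δ.1.obj I) (x : A.1.obj (I + 1) (σ.1 I δ))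
    (u : H.pshCore.Tm (H.pshCore.ext Δ (H.pshCore.tySub (H.coreForall.allTy A) σ))
      (H.pshCore.tySub (H.pshCore.tySub A (H.pshCore.comp (H.coreForall.k b Γ) σ)) H.pshCore.p)) :
    (H.pshCore.dollar
        (H.pshCore.coe h
          (H.pshCore.tmSub (tk b) (H.pshCore.p (A := H.pshCore.tySub (H.coreForall.allTy A) σ))) :
          H.pshCore.Tm (H.pshCore.ext Δ (H.pshCore.tySub (H.coreForall.allTy A) σ))
            (H.pshCore.pi
              (H.pshCore.tySub (H.pshCore.tySub A (H.pshCore.comp (H.coreForall.k b Γ) σ))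
                H.pshCore.p)
              (H.pshCore.tySub
                (H.pshCore.tySub B (H.pshCore.up (H.pshCore.comp (H.coreForall.k b Γ) σ) A))
                (H.pshCore.up H.pshCore.p (H.pshCore.tySub A (H.pshCore.comp (H.coreForall.k b Γ) σ)))))) u).1 I ⟨δ, x⟩ =
      PiSet.ev (evBase σ tk b δ) (Cube.id I) (Γ.1.act_id _) (u.1 I ⟨δ, x⟩) := by
  refine (app_val (Γ := (H.pshCore.ext Δ (H.pshCore.tySub (H.coreForall.allTy A) σ)).1)
    (A := (A.subst _).1.subst _) (B := ((B.subst _).subst _).1)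
    (H.pshCore.coe h (H.pshCore.tmSub (tk b) H.pshCore.p)) ⟨δ, x⟩ (u.1 I ⟨δ, x⟩)).trans ?_
  exact PiSet.ev_subst (Γ := Γ.1) (A := A.1) (B := B.1)
    ((H.pshCore.comp (H.pshCore.comp (H.coreForall.k b Γ) σ) H.pshCore.p)) _
    _ (coe_apply_heq _ _ _ _) _ _ _

theorem app_apex (h) {I : ℕ} (δ : Δ.1.obj I) (x : A.1.obj (I + 1) (σ.1 I δ)) :
    (H.pshCore.app (H.pshCore.coe (h : _ = H.pshCore.pi _
      (H.pshCore.tySub (H.coreForall.allTyExt B) (H.pshCore.up σ (H.coreForall.allTy A)))) t)).1 I ⟨δ, x⟩ =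
        (PiSet.ev (evApex σ t δ) (Cube.id I) (Γ.1.shift.act_id _) x) := by
  refine (app_val _ _ _).trans ?_
  exact PiSet.ev_subst (Γ := Γ.1.shift) (A := A.1.shift) (B := shiftExt B.1) σ _ _
    (coe_apply_heq _ _ _ _) _ _ _

/-- Both sides of the compatibility condition are terms over `Δ ▷ (∀A)[σ]`, and application only
evaluates at the identity. The condition thus compares values at identities, at every `δ` and every
`x`. -/
theorem piCompat_iff : H.coreForall.PiCompat σ tk t ↔
    ∀ (b : Bool) (I : ℕ) (δ : Δ.1.obj I) (x : A.1.obj (I + 1) (σ.1 I δ)),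
      PiSet.ev (evBase σ tk b δ) (Cube.id I) (Γ.1.act_id _) (A.1.act (Cube.face b I) rfl x) =
      B.1.act (γ := ⟨σ.1 I δ, x⟩) (Cube.face b I) (total_act rfl rfl)
        (PiSet.ev (evApex σ t δ) (Cube.id I) (Γ.1.shift.act_id _) x) := by
  apply forall_congr'
  intro b
  have h1 := fun h {I} => dollar_base (I := I) σ tk b h
  have h2 := fun h {I} => app_apex (I := I) σ t h
  constructor
  · intro h I δ x
    have := eq_of_heq (DTm.heq_apply rfl h I ⟨δ, x⟩)
    refine (h1 _ δ x _).symm.trans (this.trans ?_)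
    exact congrArg (B.1.act (γ := ⟨σ.1 I δ, x⟩) (Cube.face b I) (total_act rfl rfl)) (h2 _ δ x)
  · intro h
    refine DTm.heq_of_forall rfl ?_
    rintro I ⟨δ, x⟩
    apply heq_of_eq
    refine (h1 _ δ x _).trans ((h I δ x).trans ?_)
    exact congrArg (B.1.act (γ := ⟨σ.1 I δ, x⟩) (Cube.face b I) (total_act rfl rfl)) (h2 _ δ x).symm

end UniverseHierarchy

/-- `∀p` -/
abbrev DPsh.wkShift {Γ : PSh.{w}} (P : DPsh Γ) : PSh.Sub P.total.shift Γ.shift := DTm.shift P.wk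

namespace UniverseHierarchy

open DPsh

variable {L : Type l} [SemilatticeSup L] [OrderBot L] {H : UniverseHierarchy.{l, w} L}

variable {i i' j j' : L} {Γ : H.pshCore.Con i} {Δ : H.pshCore.Con i'} {A : H.pshCore.Ty j Γ}
    {B : H.pshCore.Ty j' (H.pshCore.ext Γ A)} (σ : H.pshCore.Sub Δ (H.coreForall.allCon Γ))
    (tk : (b : Bool) → H.pshCore.Tm Δ
      (H.pshCore.tySub (H.pshCore.pi A B) (H.pshCore.comp (H.coreForall.k b Γ) σ)))
    (t : H.pshCore.Tm Δ
      (H.pshCore.tySub (H.pshCore.pi (H.coreForall.allTy A) (H.coreForall.allTyExt B)) σ))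
    (t₂ : H.pshCore.Tm Δ (H.pshCore.tySub (H.coreForall.allTy (H.pshCore.pi A B)) σ))

/-- The value of `t₂` at `δ`. -/
def evAll {I : ℕ} (δ : Δ.1.obj I) : PiSet A.1 B.1
    (PSh.yl (Γ := Γ.1) (I := I + 1) (σ.1 I δ)) := t₂.1 I δ

theorem app_var_val {I : ℕ} (γ : Γ.1.obj I) (T : PiSet A.1 B.1 (PSh.yl γ)) (x : A.1.obj I γ) :
    (H.pshCore.app (H.pshCore.coe (H.pshCore.pi_sub A B H.pshCore.p)
      (H.pshCore.q (Γ := Γ) (A := H.pshCore.pi A B)))).1 I ⟨⟨γ, T⟩, x⟩ =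
    T.ev (Cube.id I) (Γ.1.act_id γ) x := by
  refine (app_val (Γ := (H.pshCore.ext Γ (H.pshCore.pi A B)).1) (A := A.1.subst _)
    (B := B.1.subst _) (H.pshCore.coe (H.pshCore.pi_sub A B H.pshCore.p)
      (H.pshCore.q (Γ := Γ) (A := H.pshCore.pi A B))) ⟨γ, T⟩ x).trans ?_
  exact PiSet.ev_subst (Γ := Γ.1) (A := A.1) (B := B.1)
    (H.pshCore.p (Γ := Γ) (A := H.pshCore.pi A B)) _ _ (coe_apply_heq _ _ _ _) _ _ _

/-- The element of `(Π ∀A ∀B)[p]` over `(σ δ, t₂ δ)` given by `lam (∀(app q))`. -/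
noncomputable def apexAt {I : ℕ} (δ : Δ.1.obj I) :
    PiSet (A.1.shift.subst (wkShift (DPsh.pi A.1 B.1)))
    (DPsh.subst (shiftExt B.1) (up (wkShift (DPsh.pi A.1 B.1)) A.1.shift))
    (PSh.yl (Γ := (DPsh.pi A.1 B.1).total.shift) (I := I) ⟨σ.1 I δ, t₂.1 I δ⟩) :=
  (H.coreForall.piApex σ t₂).1 I δ

/-- Restriction in `∀(Π A B)` is along `suc g`, so evaluating the apex at `g` restricts `t₂ δ` along
`suc g` and then evaluates at the identity. The apex records exactly the values of `t₂ δ` at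
morphisms in the image of `suc`. -/
theorem apexAt_ev {I : ℕ} (δ : Δ.1.obj I) {K : ℕ} (g : Cube.Hom K I)
    (z : (DPsh.pi A.1 B.1).total.obj (K + 1))
    (h : (DPsh.pi A.1 B.1).total.act (I := I + 1) ⟨σ.1 I δ, t₂.1 I δ⟩ (Cube.suc g) = z)
    (x : A.1.obj (K + 1) z.1) :
    (apexAt σ t₂ δ).ev g h x = PiSet.ev (evAll σ t₂ δ) (Cube.suc g) (total_fst h) x := by
  refine (lam_ev (Γ := (DPsh.pi A.1 B.1).total.shift)
    (A := A.1.shift.subst (wkShift (DPsh.pi A.1 B.1)))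
    (B := DPsh.subst (shiftExt B.1) (up (wkShift (DPsh.pi A.1 B.1)) A.1.shift))
    (H.coreForall.allTmExt (H.pshCore.app (H.pshCore.coe (H.pshCore.pi_sub A B H.pshCore.p)
      (H.pshCore.q (Γ := Γ) (A := H.pshCore.pi A B))))) (I := I) ⟨σ.1 I δ, t₂.1 I δ⟩ g h x).trans ?_
  subst h
  refine (app_var_val (Γ := Γ) (I := K + 1) _ _ x).trans ?_
  refine (pi_act_ev (evAll σ t₂ δ) (Cube.suc g) rfl (Cube.id (K + 1)) _
    (by rw [Cube.comp_id]; rfl) x).trans ?_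
  exact PiSet.ev_congr _ (Cube.comp_id _) _ _ _

/-- The abstraction in the apex is formed over the context `∀(Γ ▷ Π A B)`; stability of `Π` under
`∀p` brings its type back to one substituted from `∀Γ`. -/
theorem piApex_ty :
    (DPsh.pi (A.1.shift.subst (wkShift (DPsh.pi A.1 B.1)))
      (DPsh.subst (shiftExt B.1) (up (wkShift (DPsh.pi A.1 B.1)) A.1.shift))).subst
      (H.coreForall.toAllExt (H.pshCore.pair σ t₂)) =
    (DPsh.pi A.1.shift (shiftExt B.1)).subst σ :=
  congrArg (fun X : DPsh (DPsh.pi A.1 B.1).total.shift =>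
      X.subst (H.coreForall.toAllExt (H.pshCore.pair σ t₂)))
    (DPsh.pi_subst A.1.shift (shiftExt B.1) (wkShift (DPsh.pi A.1 B.1))).symm

theorem piApex_heq_iff : HEq (H.coreForall.piApex σ t₂) t ↔
    ∀ (I : ℕ) (δ : Δ.1.obj I) (K : ℕ) (g : Cube.Hom K I) (γ' : Γ.1.obj (K + 1))
      (h : Γ.1.act (I := I + 1) (σ.1 I δ) (Cube.suc g) = γ') (x : A.1.obj (K + 1) γ'),
      PiSet.ev (evAll σ t₂ δ) (Cube.suc g) h x = PiSet.ev (evApex σ t δ) g h x := by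
  have key : HEq (H.coreForall.piApex σ t₂) t ↔ ∀ (I : ℕ) (δ : Δ.1.obj I),
      HEq (apexAt σ t₂ δ) (evApex σ t δ) :=
    ⟨fun h I δ => DTm.heq_apply (piApex_ty σ t₂) h I δ, fun h =>
      DTm.heq_of_forall (piApex_ty σ t₂) h⟩
  rw [key]
  refine forall_congr' fun I => forall_congr' fun δ => ?_
  refine (PiSet.heq_iff_ev (Γ := Γ.1.shift) (A := A.1.shift) (B := shiftExt B.1)
    (wkShift (DPsh.pi A.1 B.1)) (apexAt σ t₂ δ) (evApex σ t δ)).trans ⟨?_, ?_⟩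
  · rintro e K g _ rfl x
    exact (apexAt_ev σ t₂ δ g _ rfl x).symm.trans (e K g _ rfl x)
  · intro e K g z h x
    exact (apexAt_ev σ t₂ δ g z h x).trans (e K g _ _ x)

theorem evBase_nat (b : Bool) {J I : ℕ} (δ : Δ.1.obj I) (f : Cube.Hom J I) {δ' : Δ.1.obj J}
    (h : Δ.1.act δ f = δ') :
    (DPsh.pi A.1 B.1).act f ((H.pshCore.comp (H.coreForall.k b Γ) σ).nat' h) (evBase σ tk b δ) =
      evBase σ tk b δ' :=
  (tk b).2 J I f δ δ' h

theorem evApex_nat {J I : ℕ} (δ : Δ.1.obj I) (f : Cube.Hom J I) {δ' : Δ.1.obj J}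
    (h : Δ.1.act δ f = δ') :
    (DPsh.pi A.1.shift (shiftExt B.1)).act f (σ.nat' h) (evApex σ t δ) = evApex σ t δ' :=
  t.2 J I f δ δ' h

/-- Naturality in `δ`: a value at any `f` is a value at an identity, over `δ[f]`. With the analogous
lemma for the apex it spreads conditions at identities to all morphisms. -/
theorem evBase_ev (b : Bool) {J I : ℕ} (δ : Δ.1.obj I) (f : Cube.Hom J I) {δ' : Δ.1.obj J}
    (h : Δ.1.act δ f = δ') {γ' : Γ.1.obj J}
    (h' : Γ.1.act (Γ.1.act (I := I + 1) (σ.1 I δ) (Cube.face b I)) f = γ')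
    (h'' : Γ.1.act (Γ.1.act (I := J + 1) (σ.1 J δ') (Cube.face b J)) (Cube.id J) = γ')
    (x : A.1.obj J γ') :
    (evBase σ tk b δ).ev f h' x = (evBase σ tk b δ').ev (Cube.id J) h'' x := by
  rw [← evBase_nat σ tk b δ f h]
  refine Eq.trans ?_ (pi_act_ev (evBase σ tk b δ) f _ (Cube.id J) h''
    (by rw [Cube.comp_id]; exact h') x).symm
  exact PiSet.ev_congr _ (Cube.comp_id f).symm _ _ _

theorem evApex_ev {J I : ℕ} (δ : Δ.1.obj I) (f : Cube.Hom J I) {δ' : Δ.1.obj J}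
    (h : Δ.1.act δ f = δ') {γ' : Γ.1.obj (J + 1)} (h' : Γ.1.shift.act (σ.1 I δ) f = γ')
    (h'' : Γ.1.shift.act (σ.1 J δ') (Cube.id J) = γ') (x : A.1.obj (J + 1) γ') :
    (evApex σ t δ).ev f h' x = (evApex σ t δ').ev (Cube.id J) h'' x := by
  rw [← evApex_nat σ t δ f h]
  refine Eq.trans ?_ (pi_act_ev (evApex σ t δ) f _ (Cube.id J) h''
    (by rw [Cube.comp_id]; exact h') x).symm
  exact PiSet.ev_congr _ (Cube.comp_id f).symm _ _ _

variable {σ tk t t₂}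

/-- Gluing asks for agreement at every `g`, whereas compatibility gives it at identities only; both
values are moved to the identity over `δ[g]`. -/
theorem PiCompat.glueCompat (c : H.coreForall.PiCompat σ tk t) {I : ℕ} (δ : Δ.1.obj I) :
    GlueCompat (γ := σ.1 I δ) (fun b => evBase σ tk b δ) (evApex σ t δ) := by
  intro b n g γ' h x γ'' h' h'' x' hx
  obtain rfl : σ.1 n (Δ.1.act δ g) = γ' := (σ.nat g δ).symm.trans h
  subst h' hx
  have e := (piCompat_iff σ tk t).1 c b n (Δ.1.act δ g) x
  rw [evBase_ev σ tk b δ g rfl h'' (Γ.1.act_id _)]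
  refine Eq.trans ?_ e.symm
  exact congrArg (B.1.act (γ := ⟨σ.1 n (Δ.1.act δ g), x⟩) (Cube.face b n) (total_act rfl rfl))
    (evApex_ev σ t δ g rfl h (Γ.1.shift.act_id _) x)

/-- An element of `∀(Π A B)` is determined by its components. -/
theorem all_pi_ext
    {t₂' : H.pshCore.Tm Δ (H.pshCore.tySub (H.coreForall.allTy (H.pshCore.pi A B)) σ)}
    (hb : ∀ b, H.coreForall.piBase σ t₂ b = H.coreForall.piBase σ t₂' b)
    (ha : HEq (H.coreForall.piApex σ t₂) t) (ha' : HEq (H.coreForall.piApex σ t₂') t) :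
    t₂ = t₂' := by
  apply Subtype.ext
  funext I δ
  apply PiSet.ext_faces (T := evAll σ t₂ δ) (T' := evAll σ t₂' δ)
  · intro b K g γ' h x
    have h1 : (DPsh.pi A.1 B.1).act (Cube.face b I) rfl (evAll σ t₂ δ) =
        (DPsh.pi A.1 B.1).act (Cube.face b I) rfl (evAll σ t₂' δ) :=
      congrFun (congrFun (congrArg Subtype.val (hb b)) I) δ
    have h' := (Γ.1.act_comp _ _ _).symm.trans h
    refine (pi_act_ev (evAll σ t₂ δ) (Cube.face b I) rfl g h' h x).symm.trans ?_
    refine Eq.trans ?_ (pi_act_ev (evAll σ t₂' δ) (Cube.face b I) rfl g h' h x)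
    rw [h1]
  · intro n g γ' h x
    rw [(piApex_heq_iff σ t t₂).1 ha I δ n g γ' h x, (piApex_heq_iff σ t t₂').1 ha' I δ n g γ' h x]

theorem exists_mkAllPi (c : H.coreForall.PiCompat σ tk t) :
    ∃ t₂ : H.pshCore.Tm Δ (H.pshCore.tySub (H.coreForall.allTy (H.pshCore.pi A B)) σ),
      (∀ b, H.coreForall.piBase σ t₂ b = tk b) ∧ HEq (H.coreForall.piApex σ t₂) t := by
  choose T hT hT' using fun I (δ : Δ.1.obj I) => PiSet.exists_glue (PiCompat.glueCompat c δ)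
  refine ⟨⟨T, ?_⟩, ?_, ?_⟩
  · intro J I f δ δ' h
    -- Naturality of the glued family in `δ` is an equation between elements over a cube of
    -- dimension `J + 1`, so it too is checked on faces and on the image of `suc`. There it is
    -- naturality of `t_b` and of `t`.
    refine PiSet.ext_faces (γ := σ.1 J δ')
      (T := (DPsh.pi A.1 B.1).act (Cube.suc f) (σ.nat' h) (T I δ)) (T' := T J δ') ?_ ?_
    · intro b K g γ' h' x
      have e1 : Γ.1.act (I := I + 1) (σ.1 I δ)
          (Cube.comp (Cube.suc f) (Cube.comp (Cube.face b J) g)) = γ' :=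
        (Γ.1.act_comp _ _ _).trans
          ((congrArg (Γ.1.act · (Cube.comp (Cube.face b J) g)) (σ.nat' h)).trans h')
      -- The face slides past `suc f`, so the restriction of the glued element is evaluated through
      -- its own face, where it is `t_b`.
      have e2 : Cube.comp (Cube.suc f) (Cube.comp (Cube.face b J) g) =
          Cube.comp (Cube.face b I) (Cube.comp f g) := by
        rw [← Cube.assoc, ← Cube.face_nat, Cube.assoc]
      have e3 := (congrArg (Γ.1.act (I := I + 1) (σ.1 I δ)) e2).symm.trans e1
      have e4 := (Γ.1.act_comp _ _ _).symm.trans e3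
      have e5 := (Γ.1.act_comp _ _ _).symm.trans h'
      refine (pi_act_ev (T I δ) (Cube.suc f) _ _ _ e1 x).trans ?_
      refine (PiSet.ev_congr _ e2 e1 e3 x).trans ?_
      refine (pi_act_ev (T I δ) (Cube.face b I) rfl (Cube.comp f g) e4 e3 x).symm.trans ?_
      refine Eq.trans ?_ (pi_act_ev (T J δ') (Cube.face b J) rfl g e5 h' x)
      rw [hT, hT, ← evBase_nat σ tk b δ f h]
      exact (pi_act_ev (evBase σ tk b δ) f _ g e5 e4 x).symm
    · intro n g γ' h' x
      have e1 : Γ.1.act (I := I + 1) (σ.1 I δ)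
          (Cube.comp (Cube.suc f) (Cube.suc g)) = γ' :=
        (Γ.1.act_comp _ _ _).trans
          ((congrArg (Γ.1.act · (Cube.suc g)) (σ.nat' h)).trans h')
      have e3 := (congrArg (Γ.1.act (I := I + 1) (σ.1 I δ)) (Cube.suc_comp f g)).trans e1
      refine (pi_act_ev (T I δ) (Cube.suc f) _ _ _ e1 x).trans ?_
      refine (PiSet.ev_congr _ (Cube.suc_comp f g).symm e1 e3 x).trans ?_
      rw [hT', hT', ← evApex_nat σ t δ f h]
      exact (pi_act_ev (Γ := Γ.1.shift) (evApex σ t δ) f _ g h' e3 x).symm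
  · intro b
    apply Subtype.ext
    funext I δ
    exact hT I δ b
  · exact (piApex_heq_iff σ t _).2 hT'

/-- Both sides are values of the single family `t₂ δ`: the apex value sits at `suc id`, and
naturality of `t₂ δ` along a face gives the base value. -/
theorem piCompat_piBase (ht : HEq (H.coreForall.piApex σ t₂) t) :
    H.coreForall.PiCompat σ (H.coreForall.piBase σ t₂) t := by
  rw [piCompat_iff]
  intro b I δ x
  -- The apex is read at the identity, hence `t₂ δ` at `suc id`, which equals the identity only
  -- propositionally.
  have e0 : Γ.1.act (I := I + 1) (σ.1 I δ) (Cube.suc (Cube.id I)) = σ.1 I δ := by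
    rw [Cube.suc_id]; exact Γ.1.act_id _
  have e := (piApex_heq_iff σ t t₂).1 ht I δ I (Cube.id I) _ e0 x
  refine Eq.trans ?_
    (congrArg (B.1.act (γ := ⟨σ.1 I δ, x⟩) (Cube.face b I) (total_act rfl rfl)) e)
  have e1 : Γ.1.act (I := I + 1) (σ.1 I δ) (Cube.comp (Cube.suc (Cube.id I)) (Cube.face b I)) =
      Γ.1.act (I := I + 1) (σ.1 I δ) (Cube.face b I) := by
    rw [Cube.suc_id, Cube.id_comp]
  have e2 : Cube.comp (Cube.face b I) (Cube.id I) =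
      Cube.comp (Cube.suc (Cube.id I)) (Cube.face b I) := Cube.face_nat b _
  refine Eq.trans ?_ (PiSet.act_ev (evAll σ t₂ δ) _ _ _ rfl e1 _ rfl).symm
  refine (pi_act_ev (evAll σ t₂ δ) (Cube.face b I) rfl (Cube.id I) (Γ.1.act_id _)
    (by rw [e2]; exact e1) _).trans ?_
  exact PiSet.ev_congr _ e2 _ _ _

variable {i'' : L} {Θ : H.pshCore.Con i''}

/-- The pointwise condition over `Θ` at `θ` is the one over `Δ` at `ρ θ`. -/
theorem piCompat_sub (c : H.coreForall.PiCompat σ tk t) (ρ : H.pshCore.Sub Θ Δ) :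
    H.coreForall.PiCompat (H.pshCore.comp σ ρ) (fun b => H.pshCore.tmSub (tk b) ρ)
      (H.pshCore.tmSub t ρ) := by
  rw [piCompat_iff] at c
  exact (piCompat_iff (H.pshCore.comp σ ρ) (fun b => H.pshCore.tmSub (tk b) ρ)
    (H.pshCore.tmSub t ρ)).2 fun b I θ x => c b I (ρ.1 I θ) x

theorem piApex_sub (ht : HEq (H.coreForall.piApex σ t₂) t) (ρ : H.pshCore.Sub Θ Δ) :
    HEq (H.coreForall.piApex (H.pshCore.comp σ ρ) (H.pshCore.tmSub t₂ ρ))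
      (H.pshCore.tmSub t ρ) := by
  rw [piApex_heq_iff] at ht
  exact (piApex_heq_iff (H.pshCore.comp σ ρ) (H.pshCore.tmSub t ρ) (H.pshCore.tmSub t₂ ρ)).2
    fun I θ => ht I (ρ.1 I θ)

variable (σ t₂) in
theorem exists_piApex_heq : ∃ t : H.pshCore.Tm Δ
      (H.pshCore.tySub (H.pshCore.pi (H.coreForall.allTy A) (H.coreForall.allTyExt B)) σ),
    HEq (H.coreForall.piApex σ t₂) t :=
  ⟨cast (congrArg (DTm Δ.1) (piApex_ty σ t₂)) (H.coreForall.piApex σ t₂), (cast_heq _ _).symm⟩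

end UniverseHierarchy

/-! ### The cylinder over a presheaf -/

/-- Elements of the tensor product of `Γ` with the interval: an element of `Γ` at an endpoint of
the interval, or an element of `Γ` one dimension lower together with the dimension `m` on which the
coordinate in the interval is. -/
inductive PSh.CylObj (Γ : PSh.{w}) : ℕ → Type w
  | base (b : Bool) {K : ℕ} (γ : Γ.obj K) : CylObj Γ K
  | mid {n : ℕ} (m : ℕ) (hm : m ≤ n) (γ : Γ.obj n) : CylObj Γ (n + 1)

namespace Cube.Dec

variable {Γ Δ : PSh.{w}}

/-- The point of the cylinder over `γ` given by a morphism into `I + 1`. -/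
def cyl {I K : ℕ} {f : Hom K (I + 1)} (d : Dec f) (γ : Γ.obj I) : Γ.CylObj K :=
  match d with
  | face b g => .base b (Γ.act γ g)
  | suc g m hm => .mid m hm (Γ.act γ g)

/-- Uniqueness of decompositions: any convenient one may replace the chosen `dec`. -/
theorem cyl_congr {I K : ℕ} {f f' : Hom K (I + 1)} (d : Dec f) (d' : Dec f') (h : f = f')
    (γ : Γ.obj I) : d.cyl γ = d'.cyl γ := by
  subst h
  rw [Subsingleton.elim d d']

/-- Precomposing a decomposition with `suc g` changes neither its kind nor its endpoint or position;
it only prefixes the remaining factor with `g`. -/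
theorem cyl_suc_comp {I J K : ℕ} {f : Hom K (J + 1)} (g : Hom J I) (d : Dec f)
    (d' : Dec (comp (Cube.suc g) f)) (γ : Γ.obj I) : d'.cyl γ = d.cyl (Γ.act γ g) := by
  cases d with
  | face b k =>
    refine (cyl_congr d' (face b (comp g k)) ?_ γ).trans ?_
    · rw [← assoc, ← assoc, face_nat]
    · exact congrArg (PSh.CylObj.base b) (Γ.act_comp _ _ _)
  | suc k m hm =>
    refine (cyl_congr d' (suc (comp g k) m hm) ?_ γ).trans ?_
    · rw [suc_comp, assoc]
    · exact congrArg (PSh.CylObj.mid m hm) (Γ.act_comp _ _ _)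

end Cube.Dec

namespace PSh

variable {Γ Δ : PSh.{w}}

/-- Restriction in the cylinder. -/
noncomputable def CylObj.act {J K : ℕ} (c : Γ.CylObj K) (ρ : Cube.Hom J K) : Γ.CylObj J :=
  match c with
  | .base b γ => .base b (Γ.act γ ρ)
  | @mid _ n m _ γ => (Cube.dec (Cube.comp (Cube.cyc n m) ρ)).cyl γ

/-- The source of functoriality of the cylinder and of naturality of `cylYl`. A face stays a face
under further restriction. For `suc g ∘ cyc n m`, restriction decomposes `cyc n m ∘ ρ` afresh, and
`suc g` in front is harmless. -/
theorem _root_.Cube.Dec.cyl_act {I J K : ℕ} {f : Cube.Hom K (I + 1)} (d : Cube.Dec f)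
    (ρ : Cube.Hom J K) (d' : Cube.Dec (Cube.comp f ρ)) (γ : Γ.obj I) :
    (d.cyl γ).act ρ = d'.cyl γ := by
  cases d with
  | face b g =>
    refine Eq.trans ?_ (Cube.Dec.cyl_congr (.face b (Cube.comp g ρ)) d'
      (Cube.assoc _ _ _).symm γ)
    exact congrArg (CylObj.base b) (Γ.act_comp _ _ _).symm
  | suc g m hm =>
    have key : ∀ (f : Cube.Hom J (I + 1)) (d' : Cube.Dec f)
        (_ : f = Cube.comp (Cube.suc g) (Cube.comp (Cube.cyc _ m) ρ)),
        (Cube.dec (Cube.comp (Cube.cyc _ m) ρ)).cyl (Γ.act γ g) = d'.cyl γ := by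
      rintro _ d' rfl
      exact (Cube.Dec.cyl_suc_comp g _ d' γ).symm
    exact key _ d' (Cube.assoc _ _ _)

/-- The tensor product of `Γ` with the interval; `U`-valued families over it are the terms of type
`∀U`. -/
noncomputable def Cyl (Γ : PSh.{w}) : PSh.{w} where
  obj := Γ.CylObj
  act c ρ := c.act ρ
  act_id {K} c := by
    cases c with
    | base b γ => exact congrArg (CylObj.base b) (Γ.act_id γ)
    | @mid n m hm γ =>
      refine (Cube.Dec.cyl_congr _ (.suc (Cube.id n) m hm) ?_ γ).trans ?_
      · rw [Cube.suc_id, Cube.id_comp, Cube.comp_id]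
      · exact congrArg (CylObj.mid m hm) (Γ.act_id γ)
  act_comp {K J I} c f g := by
    cases c with
    | base b γ => exact congrArg (CylObj.base b) (Γ.act_comp γ f g)
    | @mid n m hm γ =>
      refine (Cube.Dec.cyl_congr _ (Cube.dec (Cube.comp (Cube.comp (Cube.cyc n m) f) g))
        (Cube.assoc _ _ _).symm γ).trans ?_
      exact (Cube.Dec.cyl_act _ g _ γ).symm

/-- The map `y (I + 1) → Cyl Γ` given by `γ`. -/
noncomputable def cylYl {I : ℕ} (γ : Γ.obj I) : Sub (y.{w} (I + 1)) Γ.Cyl :=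
  ⟨fun _ f => (Cube.dec f.down).cyl γ, by
    rintro J K g ⟨f⟩ _ rfl
    exact Cube.Dec.cyl_act _ g _ γ⟩

/-- Naturality in `γ`, which makes the pullbacks of a type over the cylinder into a term of type
`∀U`. -/
theorem cylYl_comp_yMap_suc {J I : ℕ} (f : Cube.Hom J I) {γ : Γ.obj I} {γ' : Γ.obj J}
    (h : Γ.act γ f = γ') : (cylYl γ).comp (yMap (Cube.suc f)) = cylYl γ' := by
  subst h
  apply Subtype.ext
  funext K g
  exact Cube.Dec.cyl_suc_comp f _ _ γ

/-- The inclusions of the two ends. -/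
noncomputable def cylBase (b : Bool) (Γ : PSh.{w}) : Sub Γ Γ.Cyl :=
  ⟨fun _ γ => .base b γ, by
    rintro J I f γ _ rfl
    rfl⟩

theorem cylYl_comp_yMap_face (b : Bool) {I : ℕ} (γ : Γ.obj I) :
    (cylYl γ).comp (yMap (Cube.face b I)) = (cylBase b Γ).comp (yl γ) := by
  apply Subtype.ext
  funext K g
  exact Cube.Dec.cyl_congr _ (.face b g.down) rfl γ

/-- The action of a substitution on the points of the cylinder. -/
def CylObj.map (σ : Sub Δ Γ) {K : ℕ} : Δ.CylObj K → Γ.CylObj K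
  | .base b δ => .base b (σ.1 _ δ)
  | .mid m hm δ => .mid m hm (σ.1 _ δ)

theorem _root_.Cube.Dec.map_cyl (σ : Sub Δ Γ) {I K : ℕ} {f : Cube.Hom K (I + 1)}
    (d : Cube.Dec f) (δ : Δ.obj I) : (d.cyl δ).map σ = d.cyl (σ.1 I δ) := by
  cases d with
  | face b g => exact congrArg (CylObj.base b) (σ.nat g δ).symm
  | suc g m hm => exact congrArg (CylObj.mid m hm) (σ.nat g δ).symm

/-- Functoriality of the cylinder. -/
noncomputable def cylMap (σ : Sub Δ Γ) : Sub Δ.Cyl Γ.Cyl :=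
  ⟨fun _ c => c.map σ, by
    rintro J I f c _ rfl
    cases c with
    | base b δ => exact congrArg (CylObj.base b) (σ.nat f δ)
    | mid m hm δ => exact (Cube.Dec.map_cyl σ _ δ).symm⟩

theorem cylMap_comp_cylYl (σ : Sub Δ Γ) {I : ℕ} (δ : Δ.obj I) :
    (cylMap σ).comp (cylYl δ) = cylYl (σ.1 I δ) := by
  apply Subtype.ext
  funext K g
  exact Cube.Dec.map_cyl σ _ δ

end PSh

/-! ### Families over the cylinder given by spans -/

namespace DPsh

open PSh (CylObj)

variable {Γ Δ : PSh.{w}} (Ak : Bool → DPsh Γ) (A : DPsh Γ)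
  (tk : (b : Bool) → DTm A.total ((Ak b).subst A.wk))

/-- The fibres of the family over the cylinder given by a span. -/
def spanObj {K : ℕ} : Γ.CylObj K → Type w
  | .base b γ => (Ak b).obj _ γ
  | .mid _ _ γ => A.obj _ γ

variable {Ak A}

/-- Restriction of an element of the apex along a morphism into the cylinder direction. -/
def spanRes {I K : ℕ} {f : Cube.Hom K (I + 1)} (d : Cube.Dec f) {γ : Γ.obj I} (x : A.obj I γ) :
    spanObj Ak A (d.cyl γ) :=
  match d with
  | .face b g => (tk b).1 _ ⟨Γ.act γ g, A.act g rfl x⟩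
  | .suc g _ _ => A.act g rfl x

/-- Restriction in `spanObj`. -/
noncomputable def spanAct {J K : ℕ} (ρ : Cube.Hom J K) (c : Γ.CylObj K) (x : spanObj Ak A c) :
    spanObj Ak A (c.act ρ) :=
  match K, c, ρ, x with
  | _, .base b _, ρ, x => (Ak b).act ρ rfl x
  | _, @CylObj.mid _ n m _ _, ρ, x => spanRes tk (Cube.dec (Cube.comp (Cube.cyc n m) ρ)) x

theorem spanRes_congr {I K : ℕ} {f f' : Cube.Hom K (I + 1)} (d : Cube.Dec f) (d' : Cube.Dec f')
    (h : f = f') {γ γ' : Γ.obj I} (hγ : γ = γ') {x : A.obj I γ} {x' : A.obj I γ'}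
    (hx : HEq x x') : HEq (spanRes tk d x) (spanRes tk d' x') := by
  subst h hγ hx
  rw [Subsingleton.elim d d']

theorem spanAct_congr {J K : ℕ} {ρ ρ' : Cube.Hom J K} (hρ : ρ = ρ') {c c' : Γ.CylObj K}
    (hc : c = c') {x : spanObj Ak A c} {x' : spanObj Ak A c'} (hx : HEq x x') :
    HEq (spanAct tk ρ c x) (spanAct tk ρ' c' x') := by
  subst hρ hc hx
  rfl

theorem act_act_heq (C : DPsh Γ) {K J I : ℕ} {γ : Γ.obj I} (f : Cube.Hom J I) (g : Cube.Hom K J)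
    (x : C.obj I γ) :
    HEq (C.act g rfl (C.act f rfl x) : C.obj K _) (C.act (Cube.comp f g) rfl x) := by
  rw [← C.act_comp f g rfl rfl (Γ.act_comp γ f g)]
  exact C.act_heq _ _ rfl rfl HEq.rfl

theorem spanRes_suc_comp {I J K : ℕ} {f : Cube.Hom K (J + 1)} (g : Cube.Hom J I)
    (d : Cube.Dec f) (d' : Cube.Dec (Cube.comp (Cube.suc g) f)) {γ : Γ.obj I} (x : A.obj I γ) :
    HEq (spanRes tk d' x) (spanRes tk d (A.act g rfl x)) := by
  cases d with
  | face b k =>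
    refine (spanRes_congr tk d' (.face b (Cube.comp g k)) ?_ rfl HEq.rfl).trans ?_
    · rw [← Cube.assoc, ← Cube.assoc, Cube.face_nat]
    · exact DTm.congr_heq (tk b) (total_ext (Γ.act_comp _ _ _) (act_act_heq A g k x).symm)
  | suc k m hm =>
    refine (spanRes_congr tk d' (.suc (Cube.comp g k) m hm) ?_ rfl HEq.rfl).trans ?_
    · rw [Cube.suc_comp, Cube.assoc]
    · exact (act_act_heq A g k x).symm

/-- The dependent version of `Cube.Dec.cyl_act`. Once an element has reached an end, further
restriction takes place in `A_b` and the claim is naturality of `t_b`; before that it is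
functoriality of `A`. -/
theorem spanAct_spanRes {I J K : ℕ} {f : Cube.Hom K (I + 1)} (d : Cube.Dec f)
    (ρ : Cube.Hom J K) (d' : Cube.Dec (Cube.comp f ρ)) {γ : Γ.obj I} (x : A.obj I γ) :
    HEq (spanAct tk ρ _ (spanRes tk d x)) (spanRes tk d' x) := by
  cases d with
  | face b g =>
    refine HEq.trans ?_ (spanRes_congr tk (.face b (Cube.comp g ρ)) d'
      (Cube.assoc _ _ _).symm rfl HEq.rfl)
    refine (heq_of_eq ((tk b).2 J K ρ ⟨_, A.act g rfl x⟩ _ rfl)).trans ?_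
    exact DTm.congr_heq (tk b) (total_ext (Γ.act_comp _ _ _).symm (act_act_heq A g ρ x))
  | suc g m hm =>
    have key : ∀ (f : Cube.Hom J (I + 1)) (d' : Cube.Dec f)
        (_ : f = Cube.comp (Cube.suc g) (Cube.comp (Cube.cyc _ m) ρ)),
        HEq (spanRes tk (Cube.dec (Cube.comp (Cube.cyc _ m) ρ)) (A.act g rfl x))
          (spanRes tk d' x) := by
      rintro _ d' rfl
      exact (spanRes_suc_comp tk g _ d' x).symm
    exact key _ d' (Cube.assoc _ _ _)

/-- The family over the cylinder given by a span `A₀ ← A → A₁`. -/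
noncomputable def spanTy : DPsh Γ.Cyl where
  obj _ c := spanObj Ak A c
  act {_ _ c _} ρ h x := cast (congrArg (spanObj Ak A) h) (spanAct tk ρ c x)
  act_id {K c} h x := by
    apply eq_of_heq
    refine (cast_heq _ _).trans ?_
    cases c with
    | base b γ => exact (Ak b).act_id_heq _ x
    | @mid n m hm γ =>
      refine (spanRes_congr tk _ (.suc (Cube.id n) m hm) ?_ rfl HEq.rfl).trans ?_
      · rw [Cube.suc_id, Cube.id_comp, Cube.comp_id]
      · exact A.act_id_heq _ x
  act_comp {K J I c c' c''} f g hf hg hfg x := by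
    apply eq_of_heq
    refine (cast_heq _ _).trans ?_
    refine HEq.trans ?_ (cast_heq _ _).symm
    refine HEq.trans ?_ (spanAct_congr tk rfl hf (cast_heq _ _).symm)
    cases c with
    | base b γ => exact (act_act_heq (Ak b) f g x).symm
    | @mid n m hm γ =>
      refine (spanRes_congr tk _ (Cube.dec (Cube.comp (Cube.comp (Cube.cyc n m) f) g))
        (Cube.assoc _ _ _).symm rfl HEq.rfl).trans ?_
      exact (spanAct_spanRes tk _ g _ x).symm

theorem spanTy_act_heq {J K : ℕ} (ρ : Cube.Hom J K) {c : Γ.CylObj K} {c' : Γ.CylObj J}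
    (h : Γ.Cyl.act c ρ = c') (x : spanObj Ak A c) :
    HEq ((spanTy tk).act ρ h x) (spanAct tk ρ c x) := cast_heq _ _

theorem spanTy_subst_cylBase (b : Bool) : (spanTy tk).subst (PSh.cylBase b Γ) = Ak b := by
  apply ext'
  · intro I γ; rfl
  · rintro J I f γ _ rfl x y hxy
    obtain rfl := eq_of_heq hxy
    rfl

theorem spanRes_subst (σ : PSh.Sub Δ Γ) {I K : ℕ} {f : Cube.Hom K (I + 1)} (d : Cube.Dec f)
    {δ : Δ.obj I} (x : A.obj I (σ.1 I δ)) :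
    HEq (spanRes tk d x) (spanRes (Ak := fun b => (Ak b).subst σ) (A := A.subst σ)
      (fun b => (tk b).subst (up σ A)) d (γ := δ) x) := by
  cases d with
  | face b g =>
    exact DTm.congr_heq (tk b) (total_ext (σ.nat g δ) (A.act_heq _ _ rfl rfl HEq.rfl))
  | suc g m' hm' => exact A.act_heq _ _ rfl rfl HEq.rfl

/-- Fibres over corresponding points are literally the same sets, and restriction uses the same
decomposition on both sides, because `cylMap` leaves ends and positions alone. This is the
substitution law of `unspan`. -/
theorem spanTy_subst_cylMap (σ : PSh.Sub Δ Γ) :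
    (spanTy tk).subst (PSh.cylMap σ) =
      spanTy (Ak := fun b => (Ak b).subst σ) (A := A.subst σ)
        (fun b => (tk b).subst (up σ A)) := by
  apply ext'
  · rintro I (_ | _) <;> rfl
  · rintro J I f c c' h x y hxy
    refine (spanTy_act_heq tk f ((PSh.cylMap σ).nat' h) x).trans
      (HEq.trans ?_ (spanTy_act_heq _ f h y).symm)
    cases c with
    | base b δ =>
      obtain rfl := eq_of_heq hxy
      exact (Ak b).act_heq _ _ rfl rfl HEq.rfl
    | @mid n m hm δ =>
      obtain rfl := eq_of_heq hxy
      exact spanRes_subst tk σ _ x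

end DPsh

/-- For comparing a leg of a recovered span with the original: both apex and base agree only
propositionally, so even the contexts of the two terms differ. -/
theorem DTm.heq_total {Γ : PSh.{w}} {A A' : DPsh Γ} (h : A' = A) {C : DPsh Γ}
    {C' : DPsh A'.total} (hC : C' = C.subst A'.wk) {t' : DTm A'.total C'}
    {t : DTm A.total (C.subst A.wk)}
    (ht : ∀ (I : ℕ) (γ : Γ.obj I) (x' : A'.obj I γ) (x : A.obj I γ), HEq x' x →
      HEq (t'.1 I ⟨γ, x'⟩) (t.1 I ⟨γ, x⟩)) : HEq t' t := by
  subst h hC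
  exact heq_of_eq (Subtype.ext (funext fun I => funext fun z =>
    eq_of_heq (ht I z.1 z.2 z.2 HEq.rfl)))

/-! ### Elements of `∀U` from the cylinder, and recovery of the span -/

namespace UniverseHierarchy

open DPsh

variable {L : Type l} [SemilatticeSup L] [OrderBot L] {H : UniverseHierarchy.{l, w} L}

section

variable {j : L} {Γ : PSh.{w}} {Ak : Bool → H.Ty j Γ} {A : H.Ty j Γ}
  (tk : (b : Bool) → DTm A.1.total ((Ak b).1.subst A.1.wk))

/-- The family `DPsh.spanTy` as a type of level `j`. -/
noncomputable def spanTy : H.Ty j Γ.Cyl :=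
  ⟨DPsh.spanTy tk, by
    rintro I (⟨b, γ⟩ | ⟨m, hm, γ⟩)
    · exact (Ak b).2 _ _
    · exact A.2 _ _⟩

end

/-- The term of type `∀U` given by a family over the cylinder. -/
noncomputable def codeCyl {j k : L} (h : j < k) {i : L} {Γ : H.pshCore.Con i}
    (C : H.Ty j Γ.1.Cyl) : H.coreForall.AllUniv h Γ :=
  ⟨fun I γ => H.codeEquiv h (I + 1) (C.subst (PSh.cylYl γ)), by
    intro J I f γ γ' hf
    change H.codeEquiv h (J + 1) (((H.codeEquiv h (I + 1)).symm
      (H.codeEquiv h (I + 1) (C.subst (PSh.cylYl γ)))).subst (PSh.yMap (Cube.suc f))) = _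
    rw [Equiv.symm_apply_apply]
    exact congrArg (fun s => H.codeEquiv h (J + 1) (C.subst s)) (PSh.cylYl_comp_yMap_suc f hf)⟩

theorem codeCyl_sub {j k : L} (h : j < k) {i i' : L} {Γ : H.pshCore.Con i} {Δ : H.pshCore.Con i'}
    (C : H.Ty j Γ.1.Cyl) (σ : H.pshCore.Sub Δ Γ) :
    H.pshCore.tmSub (codeCyl h C) σ = codeCyl h (C.subst (PSh.cylMap σ)) := by
  apply Subtype.ext
  funext I δ
  exact congrArg (fun s => H.codeEquiv h (I + 1) (C.subst s)) (PSh.cylMap_comp_cylYl σ δ).symm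

/-- On codes, `k_U` is restriction along a face `y I → y (I + 1)`, and `cylYl γ` composed with that
face is the end inclusion composed with `yl γ`. -/
theorem spanBase_codeCyl {j k : L} (h : j < k) {i : L} {Γ : H.pshCore.Con i}
    (C : H.Ty j Γ.1.Cyl) (b : Bool) :
    H.coreForall.spanBase h (codeCyl h C) b = C.subst (PSh.cylBase b Γ.1) := by
  have key : H.pshCore.tmSub (H.coreForall.kUniv h b)
      (H.pshCore.pair (H.coreForall.allEps Γ) (codeCyl h C)) =
      H.codeD h (C.subst (PSh.cylBase b Γ.1)) := by
    apply Subtype.ext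
    funext I γ
    change H.codeEquiv h I (((H.codeEquiv h (I + 1)).symm
      (H.codeEquiv h (I + 1) (C.subst (PSh.cylYl γ)))).subst (PSh.yMap (Cube.face b I))) = _
    rw [Equiv.symm_apply_apply]
    exact congrArg (fun s => H.codeEquiv h I (C.subst s)) (PSh.cylYl_comp_yMap_face b γ)
  exact (congrArg (H.elD h) key).trans (H.el_codeD h _)

/-- The points of `El` of a decoded family. -/
theorem dec_codeCyl {j k : L} (h : j < k) {i : L} {Γ : H.pshCore.Con i}
    (C : H.Ty j Γ.1.Cyl) {I : ℕ} (γ : Γ.1.obj I) :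
    (H.codeEquiv h (I + 1)).symm ((codeCyl h C).1 I γ) = C.subst (PSh.cylYl γ) :=
  (H.codeEquiv h (I + 1)).symm_apply_apply _

/-- The generic element `q` of `U`. -/
noncomputable def genericCode (H : UniverseHierarchy.{l, w} L) {j k : L} (h : j < k) :
    DTm (H.pshCore.ext H.pshCore.emp (H.pshCore.univ h)).1
      (H.univD h (H.pshCore.ext H.pshCore.emp (H.pshCore.univ h)).1) :=
  H.pshCore.coe (H.pshCore.univ_sub h _) H.pshCore.q

/-- The point of `◇ ▷ U` given by a value of a term of type `∀U`. -/
noncomputable def univPt {j k : L} (h : j < k) {i : L} {Γ : H.pshCore.Con i}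
    (C : H.Ty j Γ.1.Cyl) {I : ℕ} (γ : Γ.1.obj I) :
    (H.pshCore.ext H.pshCore.emp (H.pshCore.univ h)).1.obj (I + 1) :=
  ⟨PUnit.unit, (codeCyl h C).1 I γ⟩

/-- The apex and the legs of the span of `codeCyl h C` both restrict elements of the generic small
type, along `suc f` and along a face. Decoding turns this into restriction in `C`, starting from the
point `c` named by the identity. -/
theorem elAct_codeCyl_heq {j k : L} (h : j < k) {i : L} {Γ : H.pshCore.Con i}
    (C : H.Ty j Γ.1.Cyl) {J I : ℕ} (γ : Γ.1.obj I) (f : Cube.Hom J (I + 1)) {z}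
    (hf : (H.pshCore.ext H.pshCore.emp (H.pshCore.univ h)).1.act (univPt h C γ) f = z)
    (x : (dec (genericCode H h) (univPt h C γ)).1.obj (I + 1) ⟨Cube.id _⟩)
    {c : Γ.1.Cyl.obj (I + 1)} (hc : (Cube.dec (Cube.id (I + 1))).cyl γ = c)
    (y : C.1.obj (I + 1) c)
    (hxy : HEq x y) : HEq (elAct (genericCode H h) f hf x) (C.1.act f rfl y) := by
  refine (elAct_heq (genericCode H h) f hf x).trans ?_
  have key : ∀ (D : H.Ty j (PSh.y.{w} (I + 1))) (_ : D = C.subst (PSh.cylYl γ))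
      (x : D.1.obj (I + 1) ⟨Cube.id _⟩) (_ : HEq x y),
      HEq (D.1.act f rfl x) (C.1.act f rfl y) := by
    rintro _ rfl x hxy
    exact C.1.act_heq _ _ hc rfl hxy
  exact key _ (dec_codeCyl h C γ) x hxy

section

variable {i j k : L} (h : j < k) {Γ : H.pshCore.Con i} (Ak : Bool → H.pshCore.Ty j Γ)
  (A : H.pshCore.Ty j Γ)
  (tk : (b : Bool) → H.pshCore.Tm (H.pshCore.ext Γ A) (H.pshCore.tySub (Ak b) H.pshCore.p))

/-- The identity is `suc id ∘ cyc I 0`. The apex of an element of `∀U` therefore sees only the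
points at position `0`, which is what leaves room for different elements with the same span. -/
theorem dec_id_cyl {Γ : PSh.{w}} {I : ℕ} (γ : Γ.obj I) :
    (Cube.dec (Cube.id (I + 1))).cyl γ = .mid 0 (Nat.zero_le _) γ := by
  refine (Cube.Dec.cyl_congr _ (.suc (Cube.id I) 0 (Nat.zero_le _)) ?_ γ).trans ?_
  · rw [Cube.suc_id, Cube.id_comp, Cube.cyc_zero]
  · exact congrArg (PSh.CylObj.mid 0 _) (Γ.act_id γ)

theorem spanApex_obj {I : ℕ} (γ : Γ.1.obj I) :
    (H.coreForall.spanApex h (codeCyl h (spanTy tk))).1.obj I γ = A.1.obj I γ := by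
  change ((H.codeEquiv h (I + 1)).symm ((codeCyl h (spanTy tk)).1 I γ)).1.obj (I + 1)
    ⟨Cube.id (I + 1)⟩ = _
  rw [dec_codeCyl]
  change spanObj (fun b => (Ak b).1) A.1 ((Cube.dec (Cube.id (I + 1))).cyl γ) = _
  rw [dec_id_cyl]
  rfl

/-- `suc f` decomposes with position `0`, so restriction along it stays in the apex and is
restriction along `f` in `A`. -/
theorem spanApex_codeCyl :
    H.coreForall.spanApex h (codeCyl h (spanTy tk)) = A := by
  apply Ty.ext
  apply DPsh.ext'
  · exact fun I γ => spanApex_obj h Ak A tk γ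
  · intro J I f γ γ' hf x y hxy
    refine (elAct_codeCyl_heq h (spanTy tk) γ (Cube.suc f)
      (PSh.Sub.nat' (H.coreForall.toAllExt (H.pshCore.pair (H.coreForall.allEps Γ) _)) hf) x
      (dec_id_cyl γ) y hxy).trans ?_
    refine (spanTy_act_heq tk (Cube.suc f) (c := .mid 0 (Nat.zero_le _) γ) rfl y).trans ?_
    refine (spanRes_congr tk _ (.suc f 0 (Nat.zero_le _)) ?_ rfl HEq.rfl).trans ?_
    · rw [Cube.cyc_zero, Cube.cyc_zero, Cube.id_comp, Cube.comp_id]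
    · exact A.1.act_heq _ _ rfl rfl HEq.rfl

theorem spanBase_spanTy (b : Bool) :
    H.coreForall.spanBase h (codeCyl h (spanTy tk)) b = Ak b :=
  (spanBase_codeCyl h _ b).trans (Ty.ext (spanTy_subst_cylBase tk b))

/-- A face decomposes as itself after the identity, so restriction along it is `t_b` applied at the
same point, up to restriction along identities. -/
theorem spanLeg_codeCyl (b : Bool) :
    HEq (H.coreForall.spanLeg h (codeCyl h (spanTy tk)) b) (tk b) := by
  refine DTm.heq_total (congrArg Subtype.val (spanApex_codeCyl h Ak A tk)) (C := (Ak b).1)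
    (congrArg (fun X : H.Ty j Γ.1 => X.1.subst (DPsh.wk _)) (spanBase_spanTy h Ak A tk b)) ?_
  intro I γ x y hxy
  have hz : (H.pshCore.ext H.pshCore.emp (H.pshCore.univ h)).1.act
    (univPt h (spanTy tk) γ) (Cube.face b I) = _ := rfl
  refine (elAct_codeCyl_heq h (spanTy tk) γ (Cube.face b I) hz x (dec_id_cyl γ) y hxy).trans ?_
  refine (spanTy_act_heq tk (Cube.face b I) (c := .mid 0 (Nat.zero_le _) γ) rfl y).trans ?_
  refine (spanRes_congr tk _ (.face b (Cube.id I)) ?_ rfl HEq.rfl).trans ?_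
  · rw [Cube.cyc_zero, Cube.id_comp, Cube.comp_id]
  · exact DTm.congr_heq (tk b) (total_ext (Γ.1.act_id γ) (A.1.act_id_heq _ _))

end

end UniverseHierarchy

/-! ### The global structure, and an element of `∀U` that is not an unspan -/

namespace UniverseHierarchy

open DPsh

variable {L : Type l} [SemilatticeSup L] [OrderBot L] (H : UniverseHierarchy.{l, w} L)

/-- The presheaf model of the global theory. -/
noncomputable def coreGlobal : GlobalStructure H.pshCore where
  toForallStructure := H.coreForall
  mkAllPi _ _ _ c := (exists_mkAllPi c).choose
  mkAllPi_sub σ tk t c ρ tk' t' htk ht := by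
    obtain rfl : tk' = fun b => H.pshCore.tmSub (tk b) ρ := funext fun b => eq_of_heq (htk b)
    obtain rfl := eq_of_heq ht
    have c' := piCompat_sub c ρ
    have h := (exists_mkAllPi c).choose_spec
    have h' := (exists_mkAllPi c').choose_spec
    -- `mkAllPi` is obtained by choice; the substitution law holds because both sides have the same
    -- components.
    refine ⟨c', heq_of_eq (all_pi_ext (fun b => ?_) (piApex_sub h.2 ρ) h'.2)⟩
    rw [h'.1 b]
    exact congrArg (fun s => H.pshCore.tmSub s ρ) (h.1 b)
  piBase_mkAllPi _ _ _ c := (exists_mkAllPi c).choose_spec.1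
  piApex_mkAllPi _ _ _ c := (exists_mkAllPi c).choose_spec.2
  mkAllPi_eta σ t₂ := by
    obtain ⟨t, ht⟩ := exists_piApex_heq σ t₂
    have c := piCompat_piBase ht
    have h := (exists_mkAllPi c).choose_spec
    exact ⟨t, c, ht.symm, all_pi_ext h.1 h.2 ht⟩
  unspan h _ _ _ tk := codeCyl h (spanTy tk)
  unspan_sub h _ _ _ _ tk σ := heq_of_eq <| (codeCyl_sub h _ σ).trans <|
    congrArg (codeCyl h) (Ty.ext (spanTy_subst_cylMap tk σ))
  spanBase_unspan h _ Ak A tk b := spanBase_spanTy h Ak A tk b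
  spanApex_unspan h _ Ak A tk := spanApex_codeCyl h Ak A tk
  spanLeg_unspan h _ Ak A tk b := spanLeg_codeCyl h Ak A tk b

/-- The points of the interval, other than the first dimension and the end points, have weight
`true`. -/
def _root_.PSh.CylObj.weight {Γ : PSh.{w}} {K : ℕ} : Γ.CylObj K → Bool
  | .base _ _ => false
  | .mid m _ _ => decide (m ≠ 0)

/-- The family with two-element fibres over the cylinder in which restriction between points of
different weight exchanges the two elements. -/
noncomputable def twist (j : L) (Γ : PSh.{w}) : H.Ty j Γ.Cyl :=
  ⟨{  obj _ _ := ULift Bool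
      act {_ _ c c'} _ _ x := ⟨xor x.down (xor (PSh.CylObj.weight c) (PSh.CylObj.weight c'))⟩
      act_id _ x := by simp
      act_comp _ _ _ _ _ x := by
        -- The total exchange along a composite depends only on the weights at its two ends, the
        -- middle one cancelling; hence functoriality.
        have key : ∀ x p q r : Bool, xor x (xor p r) = xor (xor x (xor p q)) (xor q r) := by
          decide
        exact congrArg ULift.up (key _ _ _ _) },
    fun _ _ => H.mono bot_le (H.lift Bool)⟩

/-- A one-dimensional element `γ` is needed, since position `1` first occurs over the square. No
span at all, and not merely the span of `twist`, yields the twisted element. -/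
theorem codeCyl_spanTy_ne_twist {i j k : L} (h : j < k) {Γ : H.pshCore.Con i}
    (γ : Γ.1.obj 1) (Ak : Bool → H.pshCore.Ty j Γ) (A : H.pshCore.Ty j Γ)
    (tk : (b : Bool) → H.pshCore.Tm (H.pshCore.ext Γ A) (H.pshCore.tySub (Ak b) H.pshCore.p)) :
    codeCyl h (spanTy tk) ≠ codeCyl h (H.twist j Γ.1) := by
  intro e
  have e1 : (spanTy tk).subst (PSh.cylYl γ) = (H.twist j Γ.1).subst (PSh.cylYl γ) := by
    rw [← dec_codeCyl h, ← dec_codeCyl h, e]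
  -- Equality of types over `y 2` is strict, so elements of the fibres and their restrictions can be
  -- compared heterogeneously.
  have key : ∀ (C D : H.Ty j (PSh.y.{w} 2)) (_ : C = D) (f : Cube.Hom 2 2)
      (g : (PSh.y.{w} 2).obj 2) (y : D.1.obj 2 g), ∃ x : C.1.obj 2 g, HEq x y ∧
      HEq (C.1.act f rfl x) (D.1.act f rfl y) := by
    rintro C _ rfl f g y
    exact ⟨y, HEq.rfl, HEq.rfl⟩
  obtain ⟨x, hx, hxy⟩ := key _ _ e1 (Cube.symm 0) ⟨Cube.id 2⟩ (ULift.up true)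
  let c : Γ.1.CylObj 2 := (Cube.dec (Cube.id 2)).cyl γ
  have hc : c = .mid 0 (Nat.zero_le _) γ := dec_id_cyl γ
  have h1 : HEq ((spanTy tk).1.act (Cube.symm 0) rfl (γ := c) x) x := by
    refine (spanTy_act_heq tk (Cube.symm 0) (c := c) rfl x).trans ?_
    have e2 : spanObj (fun b => (Ak b).1) A.1 c = A.1.obj 1 γ := by rw [hc]; rfl
    refine (spanAct_congr tk rfl hc (x' := cast e2 x) (cast_heq _ _).symm).trans ?_
    -- The symmetry of the square is `suc id ∘ cyc 1 1`: in a span family it moves position `0` to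
    -- position `1` through the identity of `A` at `γ`.
    refine (spanRes_congr tk _ (.suc (Cube.id 1) 1 le_rfl) ?_ rfl HEq.rfl).trans ?_
    · rw [Cube.suc_id, Cube.cyc_zero, Cube.cyc_one]
    · exact (A.1.act_id_heq _ _).trans (cast_heq _ _)
  -- In the twisted family the weight changes between positions `0` and `1`, so the same restriction
  -- exchanges the two elements.
  have h2 : ((H.twist j Γ.1).subst (PSh.cylYl γ)).1.act (γ := ⟨Cube.id 2⟩) (Cube.symm 0) rfl
      (ULift.up true) = ULift.up false := by
    have hc' : (Cube.dec (Cube.comp (Cube.id 2) (Cube.symm 0))).cyl γ =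
        .mid 1 le_rfl (Γ.1.act γ (Cube.id 1)) := by
      refine Cube.Dec.cyl_congr _ (.suc (Cube.id 1) 1 le_rfl) ?_ γ
      rw [Cube.suc_id, Cube.cyc_one]
    change ULift.up (xor true (xor c.weight
      ((Cube.dec (Cube.comp (Cube.id 2) (Cube.symm 0))).cyl γ).weight)) = _
    rw [hc, hc']
    rfl
  have h3 : HEq ((spanTy tk).1.act (Cube.symm 0) rfl (γ := c) x) (ULift.up.{w} false) := by
    rw [← h2]
    refine HEq.trans ?_ hxy
    exact DPsh.act_heq _ _ ((PSh.cylYl γ).nat' rfl) rfl rfl HEq.rfl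
  have h4 := eq_of_heq (hx.symm.trans (h1.symm.trans h3))
  exact absurd (congrArg ULift.down h4) (by decide)

end UniverseHierarchy

/-- The conclusion of the main theorem, for an arbitrary model and raw operations on it. -/
def HasGlobalStructure {L : Type l} [SemilatticeSup L] [OrderBot L] (M : CoreModel.{l, a, b} L)
    (O : ForallOps M) : Prop :=
  ∃ G : GlobalStructure M,
    G.toForallOps = O ∧
    ∀ (j k : L) (h : j < k), ∃ (i : L) (Γ : M.Con i)
      (a₂ : G.AllUniv h Γ)
      (tk : (b : Bool) → M.Tm (M.ext Γ (G.spanApex h a₂))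
        (M.tySub (G.spanBase h a₂ b) M.p)),
      (∀ b, HEq (tk b) (G.spanLeg h a₂ b)) ∧
        G.unspan h (G.spanBase h a₂) (G.spanApex h a₂) tk ≠ a₂

theorem HasGlobalStructure.congr {L : Type l} [SemilatticeSup L] [OrderBot L]
    {M M' : CoreModel.{l, a, b} L} (h : M = M') {O : ForallOps M} {O' : ForallOps M'}
    (hO : HEq O O') (hG : HasGlobalStructure M O) : HasGlobalStructure M' O' := by
  subst h
  rwa [← eq_of_heq hO]

/-- The counterexample lives over the empty context, which has an element in dimension one. It
serves every pair of levels because `twist` has two-element fibres, available in all universes. -/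
theorem UniverseHierarchy.hasGlobalStructure_core {L : Type l} [SemilatticeSup L] [OrderBot L]
    (H : UniverseHierarchy.{l, w} L) : HasGlobalStructure H.pshCore H.coreOps :=
  ⟨H.coreGlobal, rfl, fun j _ h => ⟨⊥, H.pshCore.emp,
    codeCyl h (H.twist j H.pshCore.emp.1), fun b => H.coreForall.spanLeg h _ b,
    fun _ => HEq.rfl, H.codeCyl_spanTy_ne_twist h PUnit.unit _ _ _⟩⟩

/-- Presheaves over the cube category model the global theory, with `∀`, `k`, `R`, `S` given by
precomposition with `suc` and restriction along the face, degeneracy and symmetry maps; `unspan` is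
not an inverse of the map from `∀U` to spans. -/
theorem mainTheorem2 {L : Type l} [SemilatticeSup L] [OrderBot L]
    (H : UniverseHierarchy.{l, w} L) :
    ∃ G : GlobalStructure H.pshModel,
      G.toForallOps = H.pshOps ∧
      ∀ (j k : L) (h : j < k), ∃ (i : L) (Γ : H.pshModel.Con i)
        (a₂ : G.AllUniv h Γ)
        (tk : (b : Bool) → H.pshModel.Tm (H.pshModel.ext Γ (G.spanApex h a₂))
          (H.pshModel.tySub (G.spanBase h a₂ b) H.pshModel.p)),
        (∀ b, HEq (tk b) (G.spanLeg h a₂ b)) ∧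
          G.unspan h (G.spanBase h a₂) (G.spanApex h a₂) tk ≠ a₂ :=
  H.hasGlobalStructure_core.congr H.pshCore_eq H.coreOps_heq
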